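/- \textbf{Setting.} Write $E_x$, $x=(a|b)\in\mathbb F_2^{2n}$, for the Hermitian $n$-qubit Pauli operators $i^{a\cdot b}X^aZ^b$ (in the exponent of $i$, $a\cdot b$ counts the positions with $a_i=b_i=1$) and $B((a|b),(a'|b'))=a'\cdot b-a\cdot b'$ for the symplectic form. A stabilizer code $Q$ on $n$ qubits is given by $s$ linearly independent generators $g_1,\dots,g_s\in\mathbb F_2^{2n}$ with $B(g_i,g_j)=0$; $Q$ also denotes their span, and it encodes $m=n-s$ qubits. Its syndrome $y\in\mathbb F_2^s$ is the pattern of eigenvalues $(-1)^{y_i}$ of the $E_{g_i}$. A decoder of $Q$ is a unitary $U:(\mathbb C^2)^{\otimes n}\to(\mathbb C^2)^{\otimes s}\otimes(\mathbb C^2)^{\otimes m}$ with $UE_{g_i}U^\dagger=Z_i\otimes 1$ for all $i$. A finite nonempty family $\{Q_k\}_{k\in\mathcal K}$ of such codes, with common $n$ and $s$, is a stabilizer purity testing code with error $\epsilon\ge 0$ if $\#\{k : x\in Q_k^\perp\setminus Q_k\}\le\epsilon\,\#\mathcal K$ for every $x\ne 0$. \textbf{The protocol} (Alice sends an $m$-qubit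 state to Bob, given $\{Q_k\}$ and a decoder $U_k$ of each $Q_k$). (i) Alice prepares $|\Phi^+\rangle^{\otimes n}$, where $|\Phi^+\rangle=(|00\rangle+|11\rangle)/\sqrt2$, and sends the second half of each pair to Bob. (ii) Bob announces receipt. (iii) Alice chooses $k\in\mathcal K$ uniformly and announces it. (iv) Both measure the syndrome of $Q_k$ (Alice with the complex conjugate operators, so that the outcomes agree on perfect pairs); Alice announces her outcome; Bob compares and announces whether they agree; if not, he aborts and rejects. (v) Both decode and discard the syndrome register, Bob with $U_k$ and Alice with $\overline{U_k}$. (vi) Alice teleports her message with the resulting $m$ pairs: she measures in the Bell basis and announces the outcome, Bob applies the Pauli correction, outputs the $m$ qubits and accepts. \textbf{The adversary} holds an arbitrary finite-dimensional quantum system, applies an arbitrary quantum instrument jointly to that system and the $n$ qubits in transit, reads all classical messages and may act on the held system after each of them. The adversary may jam any quantum or classical message, on the basis of everything learned so far, but cannot alter or forge classical messages (the classical channel is authenticated). If a message is jammed, Bob rejects. \textbf{Security.} Bob's final output is a density matrix $\rho_{Bob}$ of an $m$-qubit system $M$ and a qubit $V$ with basis states $|\mathrm{acc}\rangle,|\mathrm{rej}\rangle$,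 averaged over all executions. An interactive protocol is a secure quantum authentication protocol with soundness error $\epsilon$ if for every pure $m$-qubit state $|\psi\rangle$: without intervention, $\rho_{Bob}=|\psi\rangle\langle\psi|\otimes|\mathrm{acc}\rangle\langle\mathrm{acc}|$; and for every adversary, $\mathrm{Tr}(P_1^{|\psi\rangle}\rho_{Bob})\ge 1-\epsilon$, where $$P_1^{|\psi\rangle}=|\psi\rangle\langle\psi|\otimes I_V+I_M\otimes|\mathrm{rej}\rangle\langle\mathrm{rej}|-|\psi\rangle\langle\psi|\otimes|\mathrm{rej}\rangle\langle\mathrm{rej}|.$$ \textbf{Statement.} (1) There is an absolute constant $c\in\mathbb N$ such that every stabilizer code on $n$ qubits with $s$ generators and $m=n-s$ has a decoder that is carried out by a circuit of at most $c(n+1)^c$ gates from $\{X, H, S=\mathrm{diag}(1,i), \mathrm{CNOT}\}$ on the $n$ qubits. (2) If $\{Q_k\}$ is a stabilizer purity testing code with error $\epsilon$, then, for every choice of decoders, the protocol is a secure interactive quantum authentication protocol with soundness error $\epsilon$. (3) Let $r,s\ge1$, $n=rs$, $m=(r-1)s$, and let $L=GF(2^s)\subset F=GF(2^{2n})$. There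 are a basis $f_0,\dots,f_{2r-1}$ of $F$ over $L$, and an $\mathbb F_2$-linear identification $\varphi$ of $F$ with $\mathbb F_2^{2n}$ under which $B$ corresponds to $\mathrm{Tr}(xy^{2^n})$, where $\mathrm{Tr}\,z=\sum_{i<2n}z^{2^i}$. For every such choice, let the codes $Q_k$ be the images under $\varphi$ of the $2^s+1$ lines over $L$ spanned by $\sum_i y^i f_i$ ($y\in L$) and by $f_{2r-1}$ (the points of a normal rational curve), each generated by the $\varphi$-images of the multiples of its spanning vector by an arbitrary $\mathbb F_2$-basis of $L$. With these codes and any decoders, the protocol is a secure interactive quantum authentication protocol with soundness error $\frac{2r}{2^s+1}$, and hence with soundness error $2r\cdot2^{-n/r}$, which for fixed $r$ is exponentially small in $n$. -/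

import Mathlib

noncomputable section

open Matrix Kronecker

/-! ### Qubits, Pauli operators -/

/-- Bit strings of length `n`: the labels of the computational basis of `n` qubits. -/
abbrev Bits (n : ℕ) : Type := Fin n → ZMod 2

/-- Labels `x = (a|b)` of the errors in the `n`-qubit Pauli group, up to phase. -/
abbrev PauliVec (n : ℕ) : Type := Bits n × Bits n

/-- The sign `(-1)^t`. -/
def sgn (t : ZMod 2) : ℂ := if t = 0 then 1 else -1

/-- The symplectic form `B((a|b), (a'|b')) = a'·b - a·b'`. -/
def symp {n : ℕ} (x y : PauliVec n) : ZMod 2 := y.1 ⬝ᵥ x.2 - x.1 ⬝ᵥ y.2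

/-- The number of positions at which the Pauli operator labelled `x` is a `Y`. -/
def numY {n : ℕ} (x : PauliVec n) : ℕ := ∑ i, (x.1 i).val * (x.2 i).val

/-- The Hermitian Pauli operator `E_x = i^(number of Y's) X^a Z^b` for `x = (a|b)`, where
`X^a Z^b |t⟩ = (-1)^(b·t) |t + a⟩`. -/
def pauli {n : ℕ} (x : PauliVec n) : Matrix (Bits n) (Bits n) ℂ :=
  fun t' t => if t' = t + x.1 then Complex.I ^ numY x * sgn (x.2 ⬝ᵥ t) else 0

/-! ### Quantum operations -/

/-- A quantum instrument with classical outcomes in `C`, from a system with basis `a` to a system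
with basis `b`, in operator-sum form: outcome `c` occurs with the (unnormalised) state
`∑ j, K_{c,j} ρ K_{c,j}†`, where `∑ c, ∑ j, K_{c,j}† K_{c,j} = 1`. -/
structure Instrument (C a b : Type) [Fintype C] [DecidableEq a] [Fintype b] where
  κ : Type
  [fintypeκ : Fintype κ]
  kraus : C → κ → Matrix b a ℂ
  complete : ∑ c, ∑ j, (kraus c j)ᴴ * kraus c j = 1

attribute [instance] Instrument.fintypeκ

/-- A (trace-preserving) superoperator: an instrument with a single outcome. -/
abbrev Channel (a b : Type) [DecidableEq a] [Fintype b] : Type 1 := Instrument Unit a b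

namespace Instrument

variable {C a b : Type} [Fintype C] [DecidableEq a] [Fintype b]

/-- The instrument with one Kraus operator for each outcome. -/
def ofKraus (K : C → Matrix b a ℂ) (h : ∑ c, (K c)ᴴ * K c = 1) : Instrument C a b where
  κ := Unit
  kraus c _ := K c
  complete := by simpa using h

/-- The channel `ρ ↦ V ρ V†` of an isometry `V`. -/
def ofIsometry (V : Matrix b a ℂ) (h : Vᴴ * V = 1) : Channel a b :=
  ofKraus (fun _ => V) (by simpa using h)

/-- The branch of outcome `c` of an instrument, acting on a part of a larger system: `lift` is
the map `K ↦ 1 ⊗ K ⊗ 1` that makes each Kraus operator act on that part. -/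
def branch {X Y : Type} [Fintype X] (μ : Instrument C a b)
    (lift : Matrix b a ℂ → Matrix Y X ℂ) (c : C) (ρ : Matrix X X ℂ) : Matrix Y Y ℂ :=
  ∑ j, lift (μ.kraus c j) * ρ * (lift (μ.kraus c j))ᴴ

/-- The instrument that does nothing and always lets the message through. -/
def idle (a : Type) [Fintype a] [DecidableEq a] : Instrument Bool a a :=
  ofKraus (fun c => if c then 1 else 0) (by simp)

end Instrument

/-! ### Interactive protocols

In a joint system `E × A × B`, the first part is held by the adversary, the second by Alice and
the third by Bob. -/

/-- An operator of the adversary on `E × A × B`. -/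
def liftE {a b : Type} (A B : Type) [DecidableEq A] [DecidableEq B] (K : Matrix b a ℂ) :
    Matrix (b × A × B) (a × A × B) ℂ := K ⊗ₖ (1 : Matrix (A × B) (A × B) ℂ)

/-- An operator of Alice on `E × A × B`. -/
def liftA {a b : Type} (E B : Type) [DecidableEq E] [DecidableEq B] (K : Matrix b a ℂ) :
    Matrix (E × b × B) (E × a × B) ℂ := (1 : Matrix E E ℂ) ⊗ₖ (K ⊗ₖ (1 : Matrix B B ℂ))

/-- An operator of Bob on `E × A × B`. -/
def liftB {a b : Type} (E A : Type) [DecidableEq E] [DecidableEq A] (K : Matrix b a ℂ) :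
    Matrix (E × A × b) (E × A × a) ℂ := (1 : Matrix E E ℂ) ⊗ₖ ((1 : Matrix A A ℂ) ⊗ₖ K)

/-- An interactive protocol between Alice, whose system has basis `A`, and Bob, whose system has
basis `B`, over an insecure quantum channel and a public authenticated classical channel. At the
end Bob outputs `m` qubits and a qubit `V` with basis states `true` (`acc`) and `false` (`rej`).
All classical messages are public, so what follows an announcement may depend on it. -/
inductive Protocol (m : ℕ) : Type → Type → Type 1
  /-- The protocol ends with Bob's output. -/
  | finish {A B : Type} [Fintype A] [DecidableEq A] [Fintype B] [DecidableEq B]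
      (out : Channel B (Bits m × Bool)) : Protocol m A B
  /-- Alice acts on her system. -/
  | aliceDoes {A B A' : Type} [Fintype A] [DecidableEq A] [Fintype B] [DecidableEq B]
      [Fintype A'] [DecidableEq A']
      (op : Channel A A') (next : Protocol m A' B) : Protocol m A B
  /-- Bob acts on his system. -/
  | bobDoes {A B B' : Type} [Fintype A] [DecidableEq A] [Fintype B] [DecidableEq B]
      [Fintype B'] [DecidableEq B']
      (op : Channel B B') (next : Protocol m A B') : Protocol m A B
  /-- Alice measures her system and announces the outcome. -/
  | aliceSays {A B A' C : Type} [Fintype A] [DecidableEq A] [Fintype B] [DecidableEq B]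
      [Fintype A'] [DecidableEq A'] [Fintype C]
      (μ : Instrument C A A') (next : C → Protocol m A' B) : Protocol m A B
  /-- Bob measures his system and announces the outcome. -/
  | bobSays {A B B' C : Type} [Fintype A] [DecidableEq A] [Fintype B] [DecidableEq B]
      [Fintype B'] [DecidableEq B'] [Fintype C]
      (μ : Instrument C B B') (next : C → Protocol m A B') : Protocol m A B
  /-- Alice prepares a system `T` and sends it to Bob through the quantum channel. -/
  | aliceSends {A B A' T : Type} [Fintype A] [DecidableEq A] [Fintype B] [DecidableEq B]
      [Fintype A'] [DecidableEq A'] [Fintype T] [DecidableEq T]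
      (op : Channel A (A' × T)) (next : Protocol m A' (B × T)) : Protocol m A B
  /-- Bob prepares a system `T` and sends it to Alice through the quantum channel. -/
  | bobSends {A B B' T : Type} [Fintype A] [DecidableEq A] [Fintype B] [DecidableEq B]
      [Fintype B'] [DecidableEq B'] [Fintype T] [DecidableEq T]
      (op : Channel B (B' × T)) (next : Protocol m (A × T) B') : Protocol m A B

namespace Protocol

variable {m : ℕ}

/-- The strategies of an adversary who holds a `d`-dimensional system.  The adversary reads each
classical announcement and then acts on the system held; a quantum message in transit is acted on
jointly with that system.  In either case the instrument's outcome is `true` if the adversary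
delivers the message and `false` if it is jammed.  Classical messages cannot be altered. -/
def Attack : {A B : Type} → Protocol m A B → ℕ → Type 1
  | _, _, finish _, _ => PUnit
  | _, _, aliceDoes _ next, d => Attack next d
  | _, _, bobDoes _ next, d => Attack next d
  | _, _, aliceSays (C := C) _ next, d =>
      (c : C) → (d' : ℕ) × Instrument Bool (Fin d) (Fin d') × Attack (next c) d'
  | _, _, bobSays (C := C) _ next, d =>
      (c : C) → (d' : ℕ) × Instrument Bool (Fin d) (Fin d') × Attack (next c) d'
  | _, _, aliceSends (T := T) _ next, d =>
      (d' : ℕ) × Instrument Bool (Fin d × T) (Fin d' × T) × Attack next d'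
  | _, _, bobSends (T := T) _ next, d =>
      (d' : ℕ) × Instrument Bool (Fin d × T) (Fin d' × T) × Attack next d'

/-- The absence of intervention. -/
def passive : {A B : Type} → (p : Protocol m A B) → (d : ℕ) → Attack p d
  | _, _, finish _, _ => PUnit.unit
  | _, _, aliceDoes _ next, d => passive next d
  | _, _, bobDoes _ next, d => passive next d
  | _, _, aliceSays _ next, d => fun c => ⟨d, Instrument.idle _, passive (next c) d⟩
  | _, _, bobSays _ next, d => fun c => ⟨d, Instrument.idle _, passive (next c) d⟩
  | _, _, aliceSends _ next, d => ⟨d, Instrument.idle _, passive next d⟩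
  | _, _, bobSends _ next, d => ⟨d, Instrument.idle _, passive next d⟩

/-- Bob's output after a message was jammed, an event of probability `q`: he rejects. -/
def jammed (m : ℕ) (q : ℂ) : Matrix (Bits m × Bool) (Bits m × Bool) ℂ :=
  Matrix.single (0, false) (0, false) q

/-- Alice's message is handed to the adversary. -/
def fromAlice (E A T B : Type) : (E × T) × A × B → E × (A × T) × B :=
  fun x => (x.1.1, (x.2.1, x.1.2), x.2.2)

/-- The adversary hands the message to Bob. -/
def toBob (E A T B : Type) : E × A × (B × T) → (E × T) × A × B :=
  fun x => ((x.1, x.2.2.2), x.2.1, x.2.2.1)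

/-- Bob's message is handed to the adversary. -/
def fromBob (E A T B : Type) : (E × T) × A × B → E × A × (B × T) :=
  fun x => (x.1.1, x.2.1, (x.2.2, x.1.2))

/-- The adversary hands the message to Alice. -/
def toAlice (E A T B : Type) : E × (A × T) × B → (E × T) × A × B :=
  fun x => ((x.1, x.2.1.2), x.2.1.1, x.2.2)

/-- Bob's output, averaged over all executions of the protocol, when the joint state of adversary,
Alice and Bob is `ρ` and the adversary follows the given strategy. -/
def run : {A B : Type} → (p : Protocol m A B) → (d : ℕ) → Attack p d →
    Matrix (Fin d × A × B) (Fin d × A × B) ℂ → Matrix (Bits m × Bool) (Bits m × Bool) ℂ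
  | A, _, finish out, d, _, ρ => fun x y =>
      ∑ e, ∑ i, out.branch (liftB (Fin d) A) () ρ (e, i, x) (e, i, y)
  | _, B, aliceDoes op next, d, att, ρ =>
      run next d att (op.branch (liftA (Fin d) B) () ρ)
  | A, _, bobDoes op next, d, att, ρ =>
      run next d att (op.branch (liftB (Fin d) A) () ρ)
  | _, B, aliceSays (A' := A') μ next, d, att, ρ =>
      ∑ c, (run (next c) (att c).1 (att c).2.2
          ((att c).2.1.branch (liftE A' B) true (μ.branch (liftA (Fin d) B) c ρ))
        + jammed m
          ((att c).2.1.branch (liftE A' B) false (μ.branch (liftA (Fin d) B) c ρ)).trace)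
  | A, _, bobSays (B' := B') μ next, d, att, ρ =>
      ∑ c, (run (next c) (att c).1 (att c).2.2
          ((att c).2.1.branch (liftE A B') true (μ.branch (liftB (Fin d) A) c ρ))
        + jammed m
          ((att c).2.1.branch (liftE A B') false (μ.branch (liftB (Fin d) A) c ρ)).trace)
  | _, B, aliceSends (A' := A') (T := T) op next, d, att, ρ =>
      let σ := (op.branch (liftA (Fin d) B) () ρ).submatrix
        (fromAlice (Fin d) A' T B) (fromAlice (Fin d) A' T B)
      run next att.1 att.2.2
          ((att.2.1.branch (liftE A' B) true σ).submatrix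
            (toBob (Fin att.1) A' T B) (toBob (Fin att.1) A' T B))
        + jammed m (att.2.1.branch (liftE A' B) false σ).trace
  | A, _, bobSends (B' := B') (T := T) op next, d, att, ρ =>
      let σ := (op.branch (liftB (Fin d) A) () ρ).submatrix
        (fromBob (Fin d) A T B') (fromBob (Fin d) A T B')
      run next att.1 att.2.2
          ((att.2.1.branch (liftE A B') true σ).submatrix
            (toAlice (Fin att.1) A T B') (toAlice (Fin att.1) A T B'))
        + jammed m (att.2.1.branch (liftE A B') false σ).trace

end Protocol

/-! ### Security of interactive quantum authentication protocols -/

/-- The density matrix `|ψ⟩⟨ψ|`. -/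
def proj {a : Type} (ψ : a → ℂ) : Matrix a a ℂ := vecMulVec ψ (star ψ)

/-- `|acc⟩⟨acc|`. -/
def accProj : Matrix Bool Bool ℂ := Matrix.single true true 1

/-- `|rej⟩⟨rej|`. -/
def rejProj : Matrix Bool Bool ℂ := Matrix.single false false 1

/-- The projector onto "the message is `ψ` or Bob rejects". -/
def passProj {m : ℕ} (ψ : Bits m → ℂ) : Matrix (Bits m × Bool) (Bits m × Bool) ℂ :=
  proj ψ ⊗ₖ (1 : Matrix Bool Bool ℂ) + (1 : Matrix (Bits m) (Bits m) ℂ) ⊗ₖ rejProj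
    - proj ψ ⊗ₖ rejProj

/-- The joint state at the start: Alice holds the message `ψ`, the other two hold nothing. -/
def startState {m : ℕ} (ψ : Bits m → ℂ) :
    Matrix (Fin 1 × Bits m × Unit) (Fin 1 × Bits m × Unit) ℂ :=
  (1 : Matrix (Fin 1) (Fin 1) ℂ) ⊗ₖ (proj ψ ⊗ₖ (1 : Matrix Unit Unit ℂ))

/-- An interactive protocol by which Alice sends `m` qubits to Bob is a secure quantum
authentication protocol with soundness error `ε`: for every pure state `ψ`, without intervention
Bob outputs `ψ` and accepts, and whatever the adversary does, Bob's output has fidelity at least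
`1 - ε` to "the message is `ψ` or Bob rejects". -/
def IsSecure {m : ℕ} (p : Protocol m (Bits m) Unit) (ε : ℝ) : Prop :=
  ∀ ψ : Bits m → ℂ, star ψ ⬝ᵥ ψ = 1 →
    p.run 1 (p.passive 1) (startState ψ) = proj ψ ⊗ₖ accProj ∧
    ∀ att : p.Attack 1, 1 - ε ≤ (passProj ψ * p.run 1 att (startState ψ)).trace.re

/-! ### Stabilizer codes and purity testing codes -/

/-- A stabilizer code on `n` qubits with `s` independent, pairwise commuting generators. -/
structure StabilizerCode (n s : ℕ) where
  gen : Fin s → PauliVec n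
  independent : LinearIndependent (ZMod 2) gen
  isotropic : ∀ i j, symp (gen i) (gen j) = 0

/-- The totally isotropic subspace `Q` of a stabilizer code. -/
def StabilizerCode.space {n s : ℕ} (Q : StabilizerCode n s) :
    Submodule (ZMod 2) (PauliVec n) := Submodule.span (ZMod 2) (Set.range Q.gen)

/-- `x ∈ Q^⊥ - Q`: the error `x` is undetectable. -/
def StabilizerCode.Undetectable {n s : ℕ} (Q : StabilizerCode n s) (x : PauliVec n) : Prop :=
  (∀ y ∈ Q.space, symp y x = 0) ∧ x ∉ Q.space

/-- A stabilizer purity testing code with error `ε`. -/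
def IsPurityTestingCode {n s : ℕ} {K : Type} [Fintype K] (Q : K → StabilizerCode n s)
    (ε : ℝ) : Prop :=
  0 ≤ ε ∧ ∀ x : PauliVec n, x ≠ 0 →
    (Nat.card {k // (Q k).Undetectable x} : ℝ) ≤ ε * Fintype.card K

/-- The projector `(1 + (-1)^t E_x) / 2` onto the eigenspace of `E_x` for the eigenvalue
`(-1)^t`. -/
def eigenProj {n : ℕ} (x : PauliVec n) (t : ZMod 2) : Matrix (Bits n) (Bits n) ℂ :=
  (1 / 2 : ℂ) • (1 + sgn t • pauli x)

/-- The operator of measuring `E_{g_0}, …, E_{g_{s-1}}` with outcomes `y_0, …, y_{s-1}`. -/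
def syndromeProj {n : ℕ} : {s : ℕ} → (Fin s → PauliVec n) → Bits s → Matrix (Bits n) (Bits n) ℂ
  | 0, _, _ => 1
  | _ + 1, g, y => eigenProj (g 0) (y 0) * syndromeProj (fun i => g i.succ) (fun i => y i.succ)

/-- A decoder of a stabilizer code that encodes `m` qubits in `n`: a unitary from `n` qubits to a
syndrome register and `m` message qubits that carries each generator `E_{g_i}` to the operator `Z`
on the `i`-th syndrome qubit, and hence the coset with syndrome `y` onto `|y⟩ ⊗ (ℂ²)^{⊗ m}`. -/
structure Decoder {n s : ℕ} (Q : StabilizerCode n s) (m : ℕ) where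
  U : Matrix (Bits s × Bits m) (Bits n) ℂ
  isometry : Uᴴ * U = 1
  coisometry : U * Uᴴ = 1
  intertwines : ∀ i, U * pauli (Q.gen i) =
    (Matrix.diagonal fun z : Bits s × Bits m => sgn (z.1 i)) * U

/-! ### Facts needed to see that the steps of the protocol are quantum operations -/

theorem sgn_add (u v : ZMod 2) : sgn (u + v) = sgn u * sgn v := by
  revert u v; unfold sgn
  have h : ∀ u : ZMod 2, u = 0 ∨ u = 1 := by decide
  intro u v
  rcases h u with rfl | rfl <;> rcases h v with rfl | rfl <;> simp [show (1:ZMod 2)+1 = 0 from rfl]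

theorem sgn_mul_self (u : ZMod 2) : sgn u * sgn u = 1 := by
  unfold sgn; split_ifs <;> simp

theorem star_sgn (u : ZMod 2) : star (sgn u) = sgn u := by
  unfold sgn; split_ifs <;> simp

theorem bits_add_self {n : ℕ} (a : Bits n) : a + a = 0 := by
  funext i; exact CharTwo.add_self_eq_zero _

theorem bits_eq_add {n : ℕ} (a b c : Bits n) : a = b + c ↔ b = a + c := by
  constructor <;> (rintro rfl; rw [add_assoc, bits_add_self, add_zero])

theorem I_pow_mul_star (k : ℕ) : Complex.I ^ k * star (Complex.I ^ k) = 1 := by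
  rw [star_pow, ← mul_pow]; simp

theorem sgn_natCast (k : ℕ) : sgn (k : ZMod 2) = (-1) ^ k := by
  induction k with
  | zero => simp [sgn]
  | succ k ih => rw [Nat.cast_succ, sgn_add, ih, pow_succ]; simp [sgn]

theorem I_pow_numY {n : ℕ} (x : PauliVec n) :
    Complex.I ^ numY x * Complex.I ^ numY x = sgn (x.2 ⬝ᵥ x.1) := by
  have h : x.2 ⬝ᵥ x.1 = ((numY x : ℕ) : ZMod 2) := by
    simp [numY, dotProduct, mul_comm]
  rw [h, sgn_natCast, ← mul_pow, Complex.I_mul_I]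

theorem star_I_pow_numY {n : ℕ} (x : PauliVec n) :
    star (Complex.I ^ numY x) = Complex.I ^ numY x * sgn (x.2 ⬝ᵥ x.1) := by
  have h := I_pow_mul_star (numY x)
  have h1 := I_pow_numY x
  have h2 := sgn_mul_self (x.2 ⬝ᵥ x.1)
  linear_combination (Complex.I ^ numY x * sgn (x.2 ⬝ᵥ x.1)) * h
    - (star (Complex.I ^ numY x) * sgn (x.2 ⬝ᵥ x.1)) * h1 - star (Complex.I ^ numY x) * h2

theorem pauli_conjTranspose {n : ℕ} (x : PauliVec n) : (pauli x)ᴴ = pauli x := by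
  ext t' t
  simp only [conjTranspose_apply, pauli]
  by_cases h : t' = t + x.1
  · have h' : t = t' + x.1 := (bits_eq_add _ _ _).1 h
    rw [if_pos h', if_pos h, star_mul', star_I_pow_numY, star_sgn, mul_assoc, ← sgn_add, h,
      dotProduct_add, add_comm (x.2 ⬝ᵥ t), ← add_assoc, CharTwo.add_self_eq_zero, zero_add]
  · have h' : ¬ t = t' + x.1 := fun e => h ((bits_eq_add _ _ _).1 e)
    rw [if_neg h', if_neg h, star_zero]

theorem pauli_mul_self {n : ℕ} (x : PauliVec n) : pauli x * pauli x = 1 := by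
  ext t' t
  rw [mul_apply, Finset.sum_eq_single (t + x.1)]
  · simp only [pauli, if_true, one_apply, add_assoc, bits_add_self, add_zero]
    by_cases h : t' = t
    · subst h
      rw [if_pos rfl, if_pos rfl, dotProduct_add, sgn_add]
      have h1 := I_pow_numY x
      have h2 := sgn_mul_self (x.2 ⬝ᵥ x.1)
      have h3 := sgn_mul_self (x.2 ⬝ᵥ t')
      linear_combination (sgn (x.2 ⬝ᵥ t') * sgn (x.2 ⬝ᵥ t') * sgn (x.2 ⬝ᵥ x.1)) * h1 +
        (sgn (x.2 ⬝ᵥ t') * sgn (x.2 ⬝ᵥ t')) * h2 + h3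
    · rw [if_neg h, if_neg h, zero_mul]
  · intro b _ hb
    simp [pauli, hb]
  · simp

theorem pauli_unitary {n : ℕ} (x : PauliVec n) : (pauli x)ᴴ * pauli x = 1 := by
  rw [pauli_conjTranspose, pauli_mul_self]

theorem sum_eigenProj {n : ℕ} (x : PauliVec n) :
    ∑ t, (eigenProj x t)ᴴ * eigenProj x t = 1 := by
  have h : ∀ t, (eigenProj x t)ᴴ * eigenProj x t = eigenProj x t := by
    intro t
    simp only [eigenProj, conjTranspose_smul, conjTranspose_add, conjTranspose_one,
      pauli_conjTranspose, star_sgn, smul_mul_smul_comm, mul_add, add_mul, one_mul, mul_one,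
      pauli_mul_self, sgn_mul_self]
    simp only [smul_add, smul_smul]
    norm_num
    module
  simp only [h]
  have : (Finset.univ : Finset (ZMod 2)) = {0, 1} := rfl
  rw [this, Finset.sum_insert (by decide), Finset.sum_singleton]
  simp only [eigenProj, sgn, if_true, one_ne_zero, if_false]
  module

theorem sum_syndromeProj {n s : ℕ} (g : Fin s → PauliVec n) :
    ∑ y, (syndromeProj g y)ᴴ * syndromeProj g y = 1 := by
  induction s with
  | zero => simp [syndromeProj]
  | succ s ih =>
    rw [← (Fin.consEquiv (fun _ : Fin (s + 1) => ZMod 2)).sum_comp, Fintype.sum_prod_type,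
      Finset.sum_comm]
    rw [← ih (fun i => g i.succ)]
    refine Finset.sum_congr rfl fun y _ => ?_
    simp only [syndromeProj, Fin.consEquiv_apply, Fin.cons_zero, Fin.cons_succ,
      conjTranspose_mul]
    calc ∑ t, (syndromeProj (fun i => g i.succ) y)ᴴ * (eigenProj (g 0) t)ᴴ *
          (eigenProj (g 0) t * syndromeProj (fun i => g i.succ) y)
        = (syndromeProj (fun i => g i.succ) y)ᴴ *
          (∑ t, (eigenProj (g 0) t)ᴴ * eigenProj (g 0) t) *
            syndromeProj (fun i => g i.succ) y := by
          rw [Finset.mul_sum, Finset.sum_mul]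
          exact Finset.sum_congr rfl fun t _ => by simp only [mul_assoc]
      _ = _ := by rw [sum_eigenProj, mul_one]

/-- Entrywise complex conjugation preserves the completeness relation. -/
theorem complete_conj {a b C : Type} [Fintype C] [DecidableEq a] [Fintype b]
    (K : C → Matrix b a ℂ) (h : ∑ c, (K c)ᴴ * K c = 1) :
    ∑ c, ((K c).map star)ᴴ * (K c).map star = 1 := by
  have h2 := congrArg (fun M : Matrix a a ℂ => M.map (starRingEnd ℂ)) h
  ext i j
  have h3 := congrFun (congrFun h2 i) j
  simp only [map_apply, Matrix.sum_apply, mul_apply, conjTranspose_apply, map_sum, map_mul,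
    one_apply] at h3 ⊢
  simpa [apply_ite] using h3

/-- An operation on one part of a system is an operation on the whole. -/
theorem complete_one_kronecker {a b X C : Type} [Fintype C] [DecidableEq a] [Fintype b]
    [Fintype X] [DecidableEq X] (K : C → Matrix b a ℂ) (h : ∑ c, (K c)ᴴ * K c = 1) :
    ∑ c, ((1 : Matrix X X ℂ) ⊗ₖ K c)ᴴ * ((1 : Matrix X X ℂ) ⊗ₖ K c) = 1 := by
  simp only [conjTranspose_kronecker, ← mul_kronecker_mul, conjTranspose_one, mul_one]
  ext ⟨i, i'⟩ ⟨j, j'⟩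
  have h3 := congrFun (congrFun h i') j'
  simp only [Matrix.sum_apply] at h3 ⊢
  simp only [kroneckerMap_apply, ← Finset.mul_sum, h3, one_apply, Prod.mk.injEq]
  split_ifs <;> simp_all

theorem sum_sgn_dotProduct {n : ℕ} (c : Bits n) :
    ∑ v : Bits n, sgn (v ⬝ᵥ c) = if c = 0 then 2 ^ n else 0 := by
  split_ifs with h
  · subst h; simp [sgn]
  · obtain ⟨i, hi⟩ : ∃ i, c i ≠ 0 := by
      by_contra! h'; exact h (funext h')
    have hi1 : c i = 1 := by
      revert hi; generalize c i = u; revert u; decide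
    have e := Equiv.sum_comp (Equiv.addRight (Pi.single i (1 : ZMod 2) : Bits n))
      (fun v : Bits n => sgn (v ⬝ᵥ c))
    simp only [Equiv.coe_addRight, add_dotProduct, sgn_add, single_dotProduct, hi1,
      mul_one] at e
    rw [← Finset.sum_mul] at e
    have h1 : sgn 1 = -1 := by simp [sgn]
    rw [h1] at e
    linear_combination (-1 / 2 : ℂ) * e

/-! ### The steps of the protocol -/

section

variable {n m s : ℕ}

/-- Alice, holding the message, prepares `n` pairs in the state
`|Φ⁺⟩^{⊗ n} = 2^{-n/2} ∑ t, |t⟩|t⟩` and keeps the first half of each pair. -/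
def eprMatrix (m n : ℕ) : Matrix ((Bits m × Bits n) × Bits n) (Bits m) ℂ :=
  fun x t => if x.1.1 = t ∧ x.1.2 = x.2 then ((1 / Real.sqrt (2 ^ n) : ℝ) : ℂ) else 0

theorem sqrt_two_pow_sq (n : ℕ) :
    ((1 / Real.sqrt (2 ^ n) : ℝ) : ℂ) * ((1 / Real.sqrt (2 ^ n) : ℝ) : ℂ) * 2 ^ n = 1 := by
  have h : (1 / Real.sqrt (2 ^ n)) * (1 / Real.sqrt (2 ^ n)) * 2 ^ n = 1 := by
    rw [div_mul_div_comm, Real.mul_self_sqrt (by positivity)]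
    field_simp
  exact_mod_cast h

theorem eprMatrix_isometry (m n : ℕ) : (eprMatrix m n)ᴴ * eprMatrix m n = 1 := by
  ext t t'
  have h := sqrt_two_pow_sq n
  have hr : star ((1 / Real.sqrt (2 ^ n) : ℝ) : ℂ) = ((1 / Real.sqrt (2 ^ n) : ℝ) : ℂ) :=
    Complex.conj_ofReal _
  simp only [mul_apply, conjTranspose_apply, eprMatrix, one_apply]
  generalize ((1 / Real.sqrt (2 ^ n) : ℝ) : ℂ) = r at h hr
  simp only [Fintype.sum_prod_type, apply_ite star, hr, star_zero, ite_and, ite_mul, zero_mul,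
    mul_ite, mul_zero, Finset.sum_ite_eq, Finset.sum_ite_irrel, Finset.sum_const_zero,
    Finset.mem_univ, if_true]
  rw [Finset.sum_eq_single t]
  · by_cases e : t = t'
    · subst e
      simp only [if_true, Finset.sum_const, Finset.card_univ, Fintype.card_fun, ZMod.card,
        Fintype.card_fin, nsmul_eq_mul, Nat.cast_pow, Nat.cast_ofNat]
      rw [mul_comm, h]
    · simp [e]
  · intro b _ hb; simp [hb]
  · simp

/-- Alice generates the pairs; the second half of each is the system sent to Bob. -/
def prepareEPR (m n : ℕ) : Channel (Bits m) ((Bits m × Bits n) × Bits n) :=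
  Instrument.ofIsometry (eprMatrix m n) (eprMatrix_isometry m n)

/-- Bob announces that he has received the qubits. -/
def acknowledge (n : ℕ) : Instrument Unit (Unit × Bits n) (Bits n) :=
  Instrument.ofKraus (fun _ => (1 : Matrix (Bits n) (Bits n) ℂ).submatrix id Prod.snd) (by
    ext ⟨_, i⟩ ⟨_, j⟩
    simp [mul_apply, one_apply, Prod.ext_iff])

/-- A uniformly random element of `K` is chosen. -/
def chooseUniformly (K A : Type) [Fintype K] [Nonempty K] [Fintype A] [DecidableEq A] :
    Instrument K A A :=
  Instrument.ofKraus (fun _ => ((1 / Real.sqrt (Fintype.card K) : ℝ) : ℂ) • 1) (by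
    have h : (Fintype.card K : ℝ) *
        ((1 / Real.sqrt (Fintype.card K)) * (1 / Real.sqrt (Fintype.card K))) = 1 := by
      rw [div_mul_div_comm, Real.mul_self_sqrt (by positivity)]
      have : (Fintype.card K : ℝ) ≠ 0 := by exact_mod_cast Fintype.card_ne_zero
      field_simp
    have h2 : (Fintype.card K : ℂ) * (((1 / Real.sqrt (Fintype.card K) : ℝ) : ℂ) *
        ((1 / Real.sqrt (Fintype.card K) : ℝ) : ℂ)) = 1 := by exact_mod_cast h
    simp only [conjTranspose_smul, conjTranspose_one, smul_mul_smul_comm, mul_one,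
      Finset.sum_const, Finset.card_univ, ← Nat.cast_smul_eq_nsmul ℂ, smul_smul]
    rw [show star (((1 / Real.sqrt (Fintype.card K) : ℝ) : ℂ)) =
      ((1 / Real.sqrt (Fintype.card K) : ℝ) : ℂ) from Complex.conj_ofReal _, h2, one_smul])

/-- Alice measures the syndrome on her halves of the pairs.  Since `(E ⊗ Ē)|Φ⁺⟩^{⊗ n} = |Φ⁺⟩^{⊗ n}`
for every unitary `E`, Alice's operators are the complex conjugates of Bob's: on perfect pairs the
two syndromes then agree. -/
def aliceSyndrome (Q : StabilizerCode n s) (m : ℕ) :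
    Instrument (Bits s) (Bits m × Bits n) (Bits m × Bits n) :=
  Instrument.ofKraus
    (fun y => (1 : Matrix (Bits m) (Bits m) ℂ) ⊗ₖ (syndromeProj Q.gen y).map star)
    (complete_one_kronecker _ (complete_conj _ (sum_syndromeProj Q.gen)))

/-- Bob measures the syndrome and announces whether it is `y`. -/
def bobCompare (Q : StabilizerCode n s) (y : Bits s) : Instrument Bool (Bits n) (Bits n) where
  κ := Bits s
  kraus ok y' := if ok = decide (y' = y) then syndromeProj Q.gen y' else 0
  complete := by
    rw [Finset.sum_comm]
    rw [← sum_syndromeProj Q.gen]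
    refine Finset.sum_congr rfl fun y' _ => ?_
    rw [Fintype.sum_bool]
    by_cases h : y' = y <;> simp [h]

/-- Bob decodes and discards the syndrome register. -/
def bobDecode {Q : StabilizerCode n s} (D : Decoder Q m) : Channel (Bits n) (Bits m) where
  κ := Bits s
  kraus _ z := D.U.submatrix (fun t => (z, t)) id
  complete := by
    rw [Fintype.sum_unique, ← D.isometry]
    ext i j
    simp [Matrix.sum_apply, mul_apply, Fintype.sum_prod_type]

/-- Alice decodes her halves of the pairs, with the complex conjugate of Bob's decoder, and discards
the syndrome register. -/
def aliceDecode {Q : StabilizerCode n s} (D : Decoder Q m) :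
    Channel (Bits m × Bits n) (Bits m × Bits m) where
  κ := Bits s
  kraus _ z := (1 : Matrix (Bits m) (Bits m) ℂ) ⊗ₖ (D.U.submatrix (fun t => (z, t)) id).map star
  complete := by
    rw [Fintype.sum_unique]
    have h := (bobDecode D).complete
    rw [Fintype.sum_unique] at h
    exact complete_one_kronecker _ (complete_conj _ h)

/-- The bra `⟨β_p|` of the Bell state `|β_p⟩ = (E_p ⊗ 1)|Φ⁺⟩^{⊗ m}`. -/
def bellBra (p : PauliVec m) : Matrix Unit (Bits m × Bits m) ℂ :=
  fun _ x => ((1 / Real.sqrt (2 ^ m) : ℝ) : ℂ) * star (pauli p x.1 x.2)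

theorem sum_bellBra : ∑ p : PauliVec m, (bellBra p)ᴴ * bellBra p = 1 := by
  ext ⟨a, b⟩ ⟨a', b'⟩
  have h := sqrt_two_pow_sq m
  have hr : star ((1 / Real.sqrt (2 ^ m) : ℝ) : ℂ) = ((1 / Real.sqrt (2 ^ m) : ℝ) : ℂ) :=
    Complex.conj_ofReal _
  simp only [Matrix.sum_apply, mul_apply, conjTranspose_apply, bellBra, Fintype.sum_unique,
    star_mul', star_star]
  generalize ((1 / Real.sqrt (2 ^ m) : ℝ) : ℂ) = r at h hr
  rw [hr, Fintype.sum_prod_type, Finset.sum_eq_single (a + b)]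
  · have hu : a = b + (a + b) := (bits_eq_add _ _ _).2 (by rw [← add_assoc, bits_add_self, zero_add])
    by_cases hu' : a' = b' + (a + b)
    · have key : ∀ v : Bits m, r * pauli (a + b, v) a b * (r * star (pauli (a + b, v) a' b')) =
          r * r * sgn (v ⬝ᵥ (b + b')) := by
        intro v
        have h1 := I_pow_mul_star (numY ((a + b, v) : PauliVec m))
        simp only [pauli]
        rw [if_pos hu, if_pos hu', star_mul', star_sgn, dotProduct_add, sgn_add]
        linear_combination (r * r * sgn (v ⬝ᵥ b) * sgn (v ⬝ᵥ b')) * h1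
      rw [Finset.sum_congr rfl fun v _ => key v, ← Finset.mul_sum, sum_sgn_dotProduct]
      by_cases hb : b = b'
      · subst hb
        rw [if_pos (bits_add_self _), h, hu', ← hu, one_apply_eq]
      · have hb2 : ¬ b + b' = 0 := fun e => hb (by
          have := (bits_eq_add 0 b b').1 e.symm; rwa [zero_add] at this)
        rw [if_neg hb2, mul_zero, one_apply_ne]
        simp [hb]
    · have hne : ((a, b) : Bits m × Bits m) ≠ (a', b') := by
        rintro e
        obtain ⟨rfl, rfl⟩ := Prod.mk.inj e
        exact hu' hu
      rw [one_apply_ne hne]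
      exact Finset.sum_eq_zero fun v _ => by simp [pauli, hu']
  · intro u _ hu
    refine Finset.sum_eq_zero fun v _ => ?_
    have : ¬ a = b + u := fun e => hu (by
      rw [e, add_assoc, add_comm u b, ← add_assoc, bits_add_self, zero_add])
    simp [pauli, this]
  · simp

/-- Alice measures her message and her halves of the pairs in the Bell basis. -/
def bellMeasurement (m : ℕ) : Instrument (PauliVec m) (Bits m × Bits m) Unit :=
  Instrument.ofKraus bellBra sum_bellBra

/-- The isometry `|t⟩ ↦ E_p|t⟩|acc⟩`. -/
def correctMatrix (p : PauliVec m) : Matrix (Bits m × Bool) (Bits m) ℂ :=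
  fun x t => if x.2 = true then pauli p x.1 t else 0

theorem correctMatrix_isometry (p : PauliVec m) :
    (correctMatrix p)ᴴ * correctMatrix p = 1 := by
  rw [← pauli_unitary p]
  ext i j
  rw [mul_apply, mul_apply, Fintype.sum_prod_type]
  simp [conjTranspose_apply, correctMatrix]

/-- Bob corrects his qubits by `E_p`, outputs them and accepts. -/
def correctAndAccept (p : PauliVec m) : Channel (Bits m) (Bits m × Bool) :=
  Instrument.ofIsometry (correctMatrix p) (correctMatrix_isometry p)

/-- Bob discards his qubits and rejects. -/
def reject (n m : ℕ) : Channel (Bits n) (Bits m × Bool) where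
  κ := Bits n
  kraus _ t := Matrix.single (0, false) t 1
  complete := by
    rw [Fintype.sum_unique]
    simp only [conjTranspose_single, single_mul_single_same, star_one, mul_one]
    ext i j
    simp [Matrix.sum_apply, Matrix.single_apply, one_apply, ite_and]

/-- The purity testing based protocol for sending `m` qubits with the codes `Q k`. -/
def purityProtocol {K : Type} [Fintype K] [Nonempty K] (Q : K → StabilizerCode n s)
    (D : ∀ k, Decoder (Q k) m) : Protocol m (Bits m) Unit :=
  .aliceSends (prepareEPR m n) <|
  .bobSays (acknowledge n) fun _ =>
  .aliceSays (chooseUniformly K (Bits m × Bits n)) fun k =>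
  .aliceSays (aliceSyndrome (Q k) m) fun y =>
  .bobSays (bobCompare (Q k) y) fun ok =>
  if ok then
    .aliceDoes (aliceDecode (D k)) <|
    .bobDoes (bobDecode (D k)) <|
    .aliceSays (bellMeasurement m) fun p =>
    .finish (correctAndAccept p)
  else
    .finish (reject n m)

/-! ### Circuits -/

/-- The elementary gates on `n` qubits: the `NOT`, Hadamard and phase gates on one qubit and the
controlled `NOT` on two. -/
inductive Gate (n : ℕ)
  | X (i : Fin n)
  | H (i : Fin n)
  | S (i : Fin n)
  | CNOT (i j : Fin n) (h : i ≠ j)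

/-- The unitary of a gate. -/
def Gate.matrix : Gate n → Matrix (Bits n) (Bits n) ℂ
  | X i => fun x t => if x = t + Pi.single i 1 then 1 else 0
  | H i => fun x t =>
      if ∀ j, j ≠ i → x j = t j then ((1 / Real.sqrt 2 : ℝ) : ℂ) * sgn (x i * t i) else 0
  | S i => Matrix.diagonal fun t => Complex.I ^ (t i).val
  | CNOT i j _ => fun x t => if x = t + Pi.single j (t i) then 1 else 0

/-- The unitary of a circuit, whose first gate is the head of the list. -/
def circuitMatrix : List (Gate n) → Matrix (Bits n) (Bits n) ℂ
  | [] => 1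
  | g :: c => circuitMatrix c * g.matrix

/-- The circuit carries out the decoder: after it, the first `s` qubits are the syndrome register
and the last `m` qubits are the message. -/
def Decoder.IsComputedBy {Q : StabilizerCode n s} (D : Decoder Q m) (h : s + m = n)
    (c : List (Gate n)) : Prop :=
  ∀ (z : Bits s) (t : Bits m) (x : Bits n),
    D.U (z, t) x = circuitMatrix c (fun i => Fin.append z t (Fin.cast h.symm i)) x

/-! ### The codes from normal rational curves -/

/-- The data that determine the codes: the fields `L = GF(2^s)` and `F = GF(2^(2rs))`, the latter
as a `2r`-dimensional vector space over the former, bases, and an identification of `F` with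
`GF(2)^(2n)`, `n = rs`, that carries the symplectic form `Tr (x y^(2^(rs)))`, where
`Tr z = ∑ i < 2rs, z^(2^i)`, to the standard symplectic form. -/
structure CurveData (r s : ℕ) where
  L : Type
  F : Type
  [fieldL : Field L]
  [fintypeL : Fintype L]
  [fieldF : Field F]
  [algebraL : Algebra (ZMod 2) L]
  [algebraF : Algebra (ZMod 2) F]
  [algebraLF : Algebra L F]
  [tower : IsScalarTower (ZMod 2) L F]
  basisL : Module.Basis (Fin s) (ZMod 2) L
  basisF : Module.Basis (Fin (2 * r)) L F
  φ : F ≃ₗ[ZMod 2] PauliVec (r * s)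
  symplectic : ∀ x y, algebraMap (ZMod 2) F (symp (φ x) (φ y)) =
    ∑ i ∈ Finset.range (2 * r * s), (x * y ^ 2 ^ (r * s)) ^ 2 ^ i

namespace CurveData

variable {r : ℕ} (d : CurveData r s)

attribute [instance] fieldL fintypeL fieldF algebraL algebraF algebraLF tower

/-- The points `[1 : y : y² : ⋯ : y^(2r-1)]`, for `y ∈ L`, and `[0 : ⋯ : 0 : 1]` of the normal
rational curve, as vectors in `F`. -/
def point : Option d.L → d.F
  | some y => ∑ i : Fin (2 * r), y ^ (i : ℕ) • d.basisF i
  | none => ∑ i : Fin (2 * r), (if (i : ℕ) + 1 = 2 * r then (1 : d.L) else 0) • d.basisF i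

theorem point_ne_zero (hr : 0 < r) (k : Option d.L) : d.point k ≠ 0 := by
  intro h
  cases k with
  | some y =>
    have h2 := (Fintype.linearIndependent_iff.1 d.basisF.linearIndependent) _ h ⟨0, by omega⟩
    simp at h2
  | none =>
    have h2 := (Fintype.linearIndependent_iff.1 d.basisF.linearIndependent) _ h
      ⟨2 * r - 1, by omega⟩
    rw [if_pos (by simp; omega)] at h2
    exact one_ne_zero h2

theorem pow_card_F (x : d.F) : x ^ 2 ^ (2 * r * s) = x := by
  let : Fintype d.F := Fintype.ofEquiv _ d.φ.symm.toEquiv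
  have h : Fintype.card d.F = 2 ^ (2 * r * s) := by
    rw [Fintype.card_congr d.φ.toEquiv]
    simp only [Fintype.card_prod, Fintype.card_fun, ZMod.card, Fintype.card_fin]
    ring
  rw [← h, FiniteField.pow_card]

theorem pow_card_L (x : d.L) : x ^ 2 ^ s = x := by
  have h : Fintype.card d.L = 2 ^ s := by
    rw [Fintype.card_congr d.basisL.equivFun.toEquiv]
    simp
  rw [← h, FiniteField.pow_card]

theorem pow_card_L_pow (r : ℕ) (x : d.L) : x ^ 2 ^ (r * s) = x := by
  induction r with
  | zero => simp
  | succ r ih => rw [Nat.succ_mul, pow_add, pow_mul, ih, pow_card_L]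

/-- The code of a point: the binary space underlying the line over `L` that the point is. -/
def code (hr : 0 < r) (k : Option d.L) : StabilizerCode (r * s) s where
  gen j := d.φ (d.basisL j • d.point k)
  independent := by
    have h1 : LinearIndependent (ZMod 2) fun j => d.basisL j • d.point k := by
      refine d.basisL.linearIndependent.map_injOn
        (LinearMap.toSpanSingleton d.L d.F (d.point k) |>.restrictScalars (ZMod 2)) ?_
      intro a _ b _ h
      exact smul_left_injective d.L (d.point_ne_zero hr k) h
    exact h1.map' d.φ.toLinearMap d.φ.ker
  isotropic i j := by
    apply (algebraMap (ZMod 2) d.F).injective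
    rw [d.symplectic, map_zero, mul_assoc, two_mul, Finset.sum_range_add]
    have hF := d.pow_card_F (d.point k)
    generalize d.point k = v at hF
    have hz : (d.basisL i • v * (d.basisL j • v) ^ 2 ^ (r * s)) ^ 2 ^ (r * s) =
        d.basisL i • v * (d.basisL j • v) ^ 2 ^ (r * s) := by
      rw [mul_assoc, two_mul, pow_add, pow_mul] at hF
      simp only [smul_pow, mul_pow, d.pow_card_L_pow, smul_mul_smul_comm]
      rw [hF, mul_comm v]
    simp only [pow_add, pow_mul _ (2 ^ (r * s)), hz]
    have : CharP d.F 2 := charP_of_injective_algebraMap (algebraMap (ZMod 2) d.F).injective 2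
    exact CharTwo.add_self_eq_zero _

end CurveData

end

end

/-! Soundness. Since `passProj ψ = 1 - failProj ψ`, where `failProj ψ` is the event that Bob accepts
a message other than `ψ`, and since every run preserves the trace, it suffices to bound the
probability of `failProj ψ` by `ε`. After the transmission, each Kraus branch of the attack leaves a
pure state, described by a family of operators `G e` indexed by the adversary's basis: Bob's
operators multiply `G e` on the left, Alice's complex conjugate operators multiply it on the right
by an adjoint, and the adversary's later actions only mix the index `e`. Agreement on the syndrome
`y` turns `G e` into `P * G e * P`, with `P` the projector of `y`.

Expand `G e` in Pauli operators `E_x`. If `x` anticommutes with a generator, then `P * E_x * P = 0`;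
if `x` lies in the code, `E_x * P` is a multiple of `P`. So the part of `G e` made of errors that
are not undetectable becomes a multiple of `P`: perfect encoded pairs, in product with the
adversary's system. Teleportation through these delivers `ψ` exactly, so this part alone has failure
probability zero. The remaining part may be superposed with it, but in the Heisenberg picture the
failure event is a positive operator, and a vector of expectation zero lies in the kernel of a
positive operator. The cross terms therefore vanish (`IsOperation.trace_mul_proj_add`), and the
failure probability is that of the undetectable part alone, hence at most its squared norm
(`IsOperation.trace_mul_proj_le`). By Parseval this norm is the total weight of the undetectable
errors, which the adversary cannot increase once the code is known; averaging over the codes and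
exchanging the sums over codes and errors gives the factor `ε`. Both facts on positive duals apply
because the rest of any protocol, with any attack, is a quantum operation
(`Protocol.isOperation_run`).

Without intervention every stage yields a multiple of the ideal output, and preservation of the
trace shows that the factor is one.

Normal rational curves. If `x` is undetectable for the code of a point, the point lies in an
`L`-subspace that depends only on `x`, proper when `x ≠ 0`. A functional vanishing on that subspace
becomes, along the affine part of the curve, a nonzero polynomial of degree at most `2r - 1`. So at
most `2r` of the `2^s + 1` points are bad, the point at infinity included. The field data exist
because `Tr (x y^(2^(rs)))` is alternating and nondegenerate, hence equivalent to the standard form.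

Decoders. Elementary gates act on Pauli labels by symplectic maps. Symplectic elimination carries
the generators one after another to single `Z` operators, with at most `3n + 1` gates each, while
fixing the `Z`s already obtained; `X` gates then repair the signs. -/

/-! ### Quantum operations in the Heisenberg picture. -/

section Operations

open Matrix Kronecker ComplexOrder

/-- `Φ` is the action on states of a quantum operation: it has a dual `Ψ` on effects that is
unital, additive and positive. -/
def IsOperation {X Y : Type} [Fintype X] [DecidableEq X] [Fintype Y] [DecidableEq Y]
    (Φ : Matrix X X ℂ → Matrix Y Y ℂ) : Prop :=
  ∃ Ψ : Matrix Y Y ℂ → Matrix X X ℂ, Ψ 1 = 1 ∧ (∀ R S, Ψ (R - S) = Ψ R - Ψ S) ∧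
    (∀ R, R.PosSemidef → (Ψ R).PosSemidef) ∧ ∀ R ρ, (R * Φ ρ).trace = (Ψ R * ρ).trace

section

variable {X Y Z : Type} [Fintype X] [DecidableEq X] [Fintype Y] [DecidableEq Y]
  [Fintype Z] [DecidableEq Z]

/-- The dual of a measurement followed by an operation that depends on the outcome is `R ↦ ∑ K†
Ψ_c(R) K`. This is the step from which runs of protocols are built up. -/
theorem IsOperation.sum_branch {C a b : Type} [Fintype C] [DecidableEq a] [Fintype b]
    (μ : Instrument C a b) {lift : Matrix b a ℂ → Matrix Y X ℂ}
    (hlift : ∑ c, ∑ j, (lift (μ.kraus c j))ᴴ * lift (μ.kraus c j) = 1)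
    {Φ : C → Matrix Y Y ℂ → Matrix Z Z ℂ} (h : ∀ c, IsOperation (Φ c)) :
    IsOperation fun ρ => ∑ c, Φ c (μ.branch lift c ρ) := by
  choose Ψ h1 h2 h3 h4 using h
  refine ⟨fun R => ∑ c, ∑ j, (lift (μ.kraus c j))ᴴ * Ψ c R * lift (μ.kraus c j), ?_, ?_, ?_, ?_⟩
  · simpa only [h1, Matrix.mul_one] using hlift
  · intro R S
    simp only [h2, Matrix.mul_sub, Matrix.sub_mul, Finset.sum_sub_distrib]
  · intro R hR
    exact posSemidef_sum _ fun c _ => posSemidef_sum _ fun j _ =>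
      (h3 c R hR).conjTranspose_mul_mul_same _
  · intro R ρ
    simp only [Matrix.mul_sum, Matrix.sum_mul, trace_sum, h4, Instrument.branch]
    refine Finset.sum_congr rfl fun c _ => Finset.sum_congr rfl fun j _ => ?_
    rw [← Matrix.mul_assoc, trace_mul_comm]
    simp only [Matrix.mul_assoc]

theorem IsOperation.branch {a b : Type} [DecidableEq a] [Fintype b]
    (μ : Channel a b) {lift : Matrix b a ℂ → Matrix Y X ℂ}
    (hlift : ∑ c, ∑ j, (lift (μ.kraus c j))ᴴ * lift (μ.kraus c j) = 1)
    {Φ : Matrix Y Y ℂ → Matrix Z Z ℂ} (h : IsOperation Φ) :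
    IsOperation fun ρ => Φ (μ.branch lift () ρ) := by
  simpa using IsOperation.sum_branch μ hlift (Φ := fun _ => Φ) fun _ => h

theorem IsOperation.submatrix {Φ : Matrix Y Y ℂ → Matrix Z Z ℂ} (h : IsOperation Φ)
    (e : Y ≃ X) : IsOperation fun ρ : Matrix X X ℂ => Φ (ρ.submatrix e e) := by
  obtain ⟨Ψ, h1, h2, h3, h4⟩ := h
  refine ⟨fun R => (Ψ R).submatrix e.symm e.symm, ?_, ?_, ?_, ?_⟩
  · simp [h1]
  · intro R S; simp only [h2]; rfl
  · intro R hR; exact (h3 R hR).submatrix _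
  · intro R ρ
    rw [h4]
    have : ρ = (ρ.submatrix e e).submatrix e.symm e.symm := by ext; simp
    conv_rhs => rw [this, submatrix_mul_equiv]
    simp only [trace, diag, submatrix_apply]
    exact (Equiv.sum_comp e.symm fun i => (Ψ R * ρ.submatrix e e) i i).symm

theorem IsOperation.trace_eq {Φ : Matrix X X ℂ → Matrix Y Y ℂ} (h : IsOperation Φ)
    (ρ : Matrix X X ℂ) : (Φ ρ).trace = ρ.trace := by
  obtain ⟨Ψ, h1, -, -, h4⟩ := h
  simpa [h1] using h4 1 ρ

theorem IsOperation.trace_mul_sum {Φ : Matrix X X ℂ → Matrix Y Y ℂ} (h : IsOperation Φ)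
    (R : Matrix Y Y ℂ) {ι : Type} (s : Finset ι) (ρ : ι → Matrix X X ℂ) :
    (R * Φ (∑ i ∈ s, ρ i)).trace = ∑ i ∈ s, (R * Φ (ρ i)).trace := by
  obtain ⟨Ψ, -, -, -, h4⟩ := h
  simp only [h4, Matrix.mul_sum, trace_sum]

omit [DecidableEq X] in
theorem trace_mul_proj (T : Matrix X X ℂ) (v : X → ℂ) :
    (T * proj v).trace = star v ⬝ᵥ T *ᵥ v := by
  rw [proj, mul_vecMulVec, trace_vecMulVec, dotProduct_comm]

theorem trace_proj (v : X → ℂ) : (proj v).trace = star v ⬝ᵥ v := by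
  simpa using trace_mul_proj 1 v

/-- The dual is positive and unital, so `R ≤ 1` gives `Ψ R ≤ 1`. The vector `v` need not be
normalised: unnormalised branches of measurements are used throughout. -/
theorem IsOperation.trace_mul_proj_le {Φ : Matrix X X ℂ → Matrix Y Y ℂ} (h : IsOperation Φ)
    {R : Matrix Y Y ℂ} (hR' : (1 - R).PosSemidef) (v : X → ℂ) :
    (R * Φ (proj v)).trace ≤ star v ⬝ᵥ v := by
  obtain ⟨Ψ, h1, h2, h3, h4⟩ := h
  have := (h3 _ hR').dotProduct_mulVec_nonneg v
  rw [h2, h1, sub_mulVec, dotProduct_sub, one_mulVec, sub_nonneg, ← trace_mul_proj, ← h4] at this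
  exact this

/-- The operator `Ψ R` is positive and has expectation zero at `v`, so it annihilates `v`, and the
cross terms between `v` and `w` disappear along with the diagonal one. This is what excludes
interference between harmless and harmful errors, so that no constant is lost in the bound. -/
theorem IsOperation.trace_mul_proj_add {Φ : Matrix X X ℂ → Matrix Y Y ℂ} (h : IsOperation Φ)
    {R : Matrix Y Y ℂ} (hR : R.PosSemidef) {v : X → ℂ} (hv : (R * Φ (proj v)).trace = 0)
    (w : X → ℂ) : (R * Φ (proj (v + w))).trace = (R * Φ (proj w)).trace := by
  obtain ⟨Ψ, h1, h2, h3, h4⟩ := h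
  have hT := h3 R hR
  rw [h4, trace_mul_proj] at hv ⊢
  rw [h4, trace_mul_proj]
  have h0 := (hT.dotProduct_mulVec_zero_iff v).1 hv
  have h0' : star v ⬝ᵥ Ψ R *ᵥ w = 0 := by
    rw [dotProduct_mulVec]
    have := congrArg star h0
    rw [star_mulVec, hT.isHermitian.eq, star_zero] at this
    rw [this, zero_dotProduct]
  rw [mulVec_add, h0, zero_add, star_add, add_dotProduct, h0', zero_add]

end

/-! ### Completeness of lifted instruments -/

section

variable {C a b A B E : Type} [Fintype C] [DecidableEq a] [Fintype b]
  [Fintype A] [DecidableEq A] [Fintype B] [DecidableEq B] [Fintype E] [DecidableEq E]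

theorem sum_kronecker {ι l m n p : Type} (s : Finset ι) (K : ι → Matrix l m ℂ)
    (M : Matrix n p ℂ) : (∑ i ∈ s, K i) ⊗ₖ M = ∑ i ∈ s, K i ⊗ₖ M := by
  ext ⟨i, i'⟩ ⟨j, j'⟩
  simp [kroneckerMap_apply, Matrix.sum_apply, Finset.sum_mul]

theorem kronecker_sum {ι l m n p : Type} (s : Finset ι) (M : Matrix n p ℂ)
    (K : ι → Matrix l m ℂ) : M ⊗ₖ (∑ i ∈ s, K i) = ∑ i ∈ s, M ⊗ₖ K i := by
  ext ⟨i, i'⟩ ⟨j, j'⟩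
  simp [kroneckerMap_apply, Matrix.sum_apply, Finset.mul_sum]

theorem liftE_complete [Fintype a] (μ : Instrument C a b) :
    ∑ c, ∑ j, (liftE A B (μ.kraus c j))ᴴ * liftE A B (μ.kraus c j) = 1 := by
  simp only [liftE, conjTranspose_kronecker, ← mul_kronecker_mul, conjTranspose_one, mul_one,
    ← sum_kronecker, μ.complete, one_kronecker_one]

theorem liftA_complete [Fintype a] (μ : Instrument C a b) :
    ∑ c, ∑ j, (liftA E B (μ.kraus c j))ᴴ * liftA E B (μ.kraus c j) = 1 := by
  simp only [liftA, conjTranspose_kronecker, ← mul_kronecker_mul, conjTranspose_one, mul_one,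
    ← sum_kronecker, ← kronecker_sum, μ.complete, one_kronecker_one]

theorem liftB_complete [Fintype a] (μ : Instrument C a b) :
    ∑ c, ∑ j, (liftB E A (μ.kraus c j))ᴴ * liftB E A (μ.kraus c j) = 1 := by
  simp only [liftB, conjTranspose_kronecker, ← mul_kronecker_mul, conjTranspose_one, mul_one,
    ← kronecker_sum, μ.complete, one_kronecker_one]

/-- Jamming replaces the state by a fixed rejecting one; the dual sends an effect to its value
there, times the identity. -/
theorem isOperation_jammed (m : ℕ) :
    IsOperation fun ρ : Matrix A A ℂ => Protocol.jammed m ρ.trace := by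
  refine ⟨fun R => R (0, false) (0, false) • 1, by simp, fun R S => by simp [sub_smul], ?_, ?_⟩
  · intro R hR
    exact PosSemidef.one.smul (hR.diag_nonneg (i := (0, false)))
  · intro R ρ
    simp [Protocol.jammed, trace_mul_single]

/-- The state of Bob's part of a joint system. -/
def bobState (ρ : Matrix (E × A × B) (E × A × B) ℂ) : Matrix B B ℂ :=
  fun x y => ∑ e, ∑ i, ρ (e, i, x) (e, i, y)

-- The dual of a partial trace tensors an effect with identities.
theorem isOperation_bobState : IsOperation (bobState (E := E) (A := A) (B := B)) := by
  refine ⟨fun R => 1 ⊗ₖ (1 ⊗ₖ R), by simp, ?_, ?_, ?_⟩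
  · intro R S
    ext ⟨i, i', i''⟩ ⟨j, j', j''⟩
    simp [kroneckerMap_apply, mul_sub]
  · intro R hR
    exact PosSemidef.one.kronecker (PosSemidef.one.kronecker hR)
  · intro R ρ
    simp only [trace, diag, mul_apply, Fintype.sum_prod_type, kroneckerMap_apply, one_apply,
      ite_mul, one_mul, zero_mul, Finset.sum_ite_irrel, Finset.sum_const_zero,
      Finset.sum_ite_eq, Finset.mem_univ, if_true, bobState, Finset.mul_sum]
    rw [Finset.sum_congr rfl fun x _ => Finset.sum_comm, Finset.sum_comm]
    refine Finset.sum_congr rfl fun e _ => ?_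
    rw [Finset.sum_congr rfl fun x _ => Finset.sum_comm, Finset.sum_comm]

end

end Operations

/-! ### Every run of a protocol is a quantum operation. -/

namespace Protocol

open Matrix

variable {m : ℕ} {A B : Type}

/-- Bob's output when the adversary has just heard an announcement, after which the protocol goes
on as `p`. -/
def heard [Fintype A] [Fintype B] [DecidableEq A] [DecidableEq B] (p : Protocol m A B) {d : ℕ}
    (att : (d' : ℕ) × Instrument Bool (Fin d) (Fin d') × p.Attack d')
    (ρ : Matrix (Fin d × A × B) (Fin d × A × B) ℂ) : Matrix (Bits m × Bool) (Bits m × Bool) ℂ :=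
  p.run att.1 att.2.2 (att.2.1.branch (liftE A B) true ρ) +
    jammed m (att.2.1.branch (liftE A B) false ρ).trace

theorem isOperation_heard_of [Fintype A] [DecidableEq A] [Fintype B] [DecidableEq B]
    {p : Protocol m A B} {d : ℕ}
    (att : (d' : ℕ) × Instrument Bool (Fin d) (Fin d') × p.Attack d')
    (h : IsOperation (p.run att.1 att.2.2)) : IsOperation (p.heard att) := by
  -- Delivering and jamming are the two outcomes of one instrument of the adversary, followed by the
  -- rest of the protocol or by rejection.
  have := IsOperation.sum_branch att.2.1 (liftE_complete (A := A) (B := B) att.2.1)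
    (Φ := fun c => if c then p.run att.1 att.2.2 else fun ρ => jammed m ρ.trace) (by
      rintro (_ | _)
      · exact isOperation_jammed m
      · exact h)
  simp only [Fintype.sum_bool] at this
  exact this

end Protocol

namespace Protocol

open Matrix

variable {m : ℕ} {A B : Type}

theorem isOperation_run [Fintype A] [DecidableEq A] [Fintype B] [DecidableEq B]
    (p : Protocol m A B) (d : ℕ) (att : p.Attack d) : IsOperation (p.run d att) := by
  -- Each constructor of `Protocol` stores its own instances; those of the statement are generalised
  -- here, so that in each case they can be identified with the stored ones.
  rename_i hA hA' hB hB'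
  revert hA hA' hB hB'
  induction p generalizing d with
  | @finish A B iA iA' iB iB' out =>
    intro hA hA' hB hB'
    obtain rfl := Subsingleton.elim hA iA
    obtain rfl := Subsingleton.elim hA' iA'
    obtain rfl := Subsingleton.elim hB iB
    obtain rfl := Subsingleton.elim hB' iB'
    change IsOperation fun ρ => run _ d att ρ
    simp only [run]
    have h := IsOperation.branch out (liftB_complete (E := Fin d) (A := A) out) isOperation_bobState
    exact h
  | @aliceDoes A B A' iA iA' iB iB' _ _ op next ih =>
    intro hA hA' hB hB'
    obtain rfl := Subsingleton.elim hA iA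
    obtain rfl := Subsingleton.elim hA' iA'
    obtain rfl := Subsingleton.elim hB iB
    obtain rfl := Subsingleton.elim hB' iB'
    change IsOperation fun ρ => run _ d att ρ
    simp only [run]
    have h := IsOperation.branch op (liftA_complete (E := Fin d) (B := B) op) (ih d att)
    exact h
  | @bobDoes A B B' iA iA' iB iB' _ _ op next ih =>
    intro hA hA' hB hB'
    obtain rfl := Subsingleton.elim hA iA
    obtain rfl := Subsingleton.elim hA' iA'
    obtain rfl := Subsingleton.elim hB iB
    obtain rfl := Subsingleton.elim hB' iB'
    change IsOperation fun ρ => run _ d att ρ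
    simp only [run]
    have h := IsOperation.branch op (liftB_complete (E := Fin d) (A := A) op) (ih d att)
    exact h
  | @aliceSays A B A' C iA iA' iB iB' _ _ _ μ next ih =>
    intro hA hA' hB hB'
    obtain rfl := Subsingleton.elim hA iA
    obtain rfl := Subsingleton.elim hA' iA'
    obtain rfl := Subsingleton.elim hB iB
    obtain rfl := Subsingleton.elim hB' iB'
    change IsOperation fun ρ => run _ d att ρ
    simp only [run]
    have h := IsOperation.sum_branch μ (liftA_complete (E := Fin d) (B := B) μ)
      fun c => isOperation_heard_of (att c) (ih c (att c).1 (att c).2.2)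
    exact h
  | @bobSays A B B' C iA iA' iB iB' _ _ _ μ next ih =>
    intro hA hA' hB hB'
    obtain rfl := Subsingleton.elim hA iA
    obtain rfl := Subsingleton.elim hA' iA'
    obtain rfl := Subsingleton.elim hB iB
    obtain rfl := Subsingleton.elim hB' iB'
    change IsOperation fun ρ => run _ d att ρ
    simp only [run]
    have h := IsOperation.sum_branch μ (liftB_complete (E := Fin d) (A := A) μ)
      fun c => isOperation_heard_of (att c) (ih c (att c).1 (att c).2.2)
    exact h
  | @aliceSends A B A' T iA iA' iB iB' _ _ _ _ op next ih =>
    intro hA hA' hB hB'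
    obtain rfl := Subsingleton.elim hA iA
    obtain rfl := Subsingleton.elim hA' iA'
    obtain rfl := Subsingleton.elim hB iB
    obtain rfl := Subsingleton.elim hB' iB'
    have h1 := IsOperation.submatrix (ih att.1 att.2.2)
      ⟨toBob (Fin att.1) A' T B, fun x => (x.1.1, x.2.1, (x.2.2, x.1.2)),
        fun _ => rfl, fun _ => rfl⟩
    have h2 := IsOperation.sum_branch att.2.1 (liftE_complete (A := A') (B := B) att.2.1)
      (Φ := fun c => if c then (fun ρ => next.run att.1 att.2.2
          (ρ.submatrix (toBob (Fin att.1) A' T B) (toBob (Fin att.1) A' T B)))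
        else fun ρ => jammed m ρ.trace) (by
        rintro (_ | _)
        · exact isOperation_jammed m
        · exact h1)
    have h3 := IsOperation.branch op (liftA_complete (E := Fin d) (B := B) op)
      (h2.submatrix ⟨fromAlice (Fin d) A' T B, fun x => ((x.1, x.2.1.2), x.2.1.1, x.2.2),
        fun _ => rfl, fun _ => rfl⟩)
    simp only [Fintype.sum_bool] at h3
    change IsOperation fun ρ => run _ d att ρ
    simp only [run]
    exact h3
  | @bobSends A B B' T iA iA' iB iB' _ _ _ _ op next ih =>
    intro hA hA' hB hB'
    obtain rfl := Subsingleton.elim hA iA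
    obtain rfl := Subsingleton.elim hA' iA'
    obtain rfl := Subsingleton.elim hB iB
    obtain rfl := Subsingleton.elim hB' iB'
    have h1 := IsOperation.submatrix (ih att.1 att.2.2)
      ⟨toAlice (Fin att.1) A T B', fun x => (x.1.1, (x.2.1, x.1.2), x.2.2),
        fun _ => rfl, fun _ => rfl⟩
    have h2 := IsOperation.sum_branch att.2.1 (liftE_complete (A := A) (B := B') att.2.1)
      (Φ := fun c => if c then (fun ρ => next.run att.1 att.2.2
          (ρ.submatrix (toAlice (Fin att.1) A T B') (toAlice (Fin att.1) A T B')))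
        else fun ρ => jammed m ρ.trace) (by
        rintro (_ | _)
        · exact isOperation_jammed m
        · exact h1)
    have h3 := IsOperation.branch op (liftB_complete (E := Fin d) (A := A) op)
      (h2.submatrix ⟨fromBob (Fin d) A T B', fun x => ((x.1, x.2.2.2), x.2.1, x.2.2.1),
        fun _ => rfl, fun _ => rfl⟩)
    simp only [Fintype.sum_bool] at h3
    change IsOperation fun ρ => run _ d att ρ
    simp only [run]
    exact h3

theorem isOperation_heard [Fintype A] [DecidableEq A] [Fintype B] [DecidableEq B]
    (p : Protocol m A B) {d : ℕ}
    (att : (d' : ℕ) × Instrument Bool (Fin d) (Fin d') × p.Attack d') :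
    IsOperation (p.heard att) :=
  isOperation_heard_of att (p.isOperation_run _ _)

end Protocol

/-! ### Pauli operators, Parseval's identity and syndrome projectors. -/

noncomputable section PauliAlgebra

open Matrix

variable {n s m : ℕ}

theorem zmod_two_eq (u : ZMod 2) : u = 0 ∨ u = 1 := by
  revert u; decide

/-- The operator `X^a Z^b`. -/
def xz (x : PauliVec n) : Matrix (Bits n) (Bits n) ℂ :=
  fun t' t => if t' = t + x.1 then sgn (x.2 ⬝ᵥ t) else 0

theorem pauli_eq_smul_xz (x : PauliVec n) : pauli x = (Complex.I ^ numY x) • xz x := by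
  ext t' t
  simp [pauli, xz]

theorem xz_eq_smul_pauli (x : PauliVec n) : xz x = star (Complex.I ^ numY x) • pauli x := by
  rw [pauli_eq_smul_xz, smul_smul, mul_comm, I_pow_mul_star, one_smul]

/-- The sign comes from moving the `Z` part of `x` past the `X` part of `y`. Products are computed
for `xz` because the powers of `i` in `pauli` are not multiplicative. -/
theorem xz_mul (x y : PauliVec n) : xz x * xz y = sgn (x.2 ⬝ᵥ y.1) • xz (x + y) := by
  ext t' t
  rw [mul_apply, Finset.sum_eq_single (t + y.1)]
  · simp only [xz, if_true, Matrix.smul_apply, smul_eq_mul, Prod.fst_add, Prod.snd_add, dotProduct_add,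
      add_dotProduct, sgn_add, show t + y.1 + x.1 = t + (x.1 + y.1) by abel]
    split_ifs <;> ring
  · intro b _ hb
    simp [xz, hb]
  · simp

theorem symp_add_left (x y z : PauliVec n) : symp (x + y) z = symp x z + symp y z := by
  simp only [symp, Prod.fst_add, Prod.snd_add, dotProduct_add, add_dotProduct]
  ring

theorem symp_smul_left (c : ZMod 2) (x y : PauliVec n) : symp (c • x) y = c * symp x y := by
  simp [symp, mul_sub]

theorem pauli_zero : pauli (0 : PauliVec n) = 1 := by
  ext t' t
  simp [pauli, numY, sgn, one_apply]

theorem pauli_mul_comm (x y : PauliVec n) :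
    pauli x * pauli y = sgn (symp x y) • (pauli y * pauli x) := by
  simp only [pauli_eq_smul_xz, smul_mul_smul_comm, xz_mul, smul_smul, add_comm x y]
  congr 1
  have h := sgn_mul_self (y.2 ⬝ᵥ x.1)
  rw [symp, CharTwo.sub_eq_add, sgn_add, dotProduct_comm y.1, dotProduct_comm x.1]
  linear_combination (-Complex.I ^ numY x * Complex.I ^ numY y * sgn (x.2 ⬝ᵥ y.1)) * h

theorem exists_pauli_add (x y : PauliVec n) :
    ∃ c : ℂ, pauli (x + y) = c • (pauli x * pauli y) := by
  refine ⟨Complex.I ^ numY (x + y) * star (Complex.I ^ numY x) * star (Complex.I ^ numY y) *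
    sgn (x.2 ⬝ᵥ y.1), ?_⟩
  rw [pauli_eq_smul_xz, pauli_eq_smul_xz x, pauli_eq_smul_xz y, smul_mul_smul_comm, xz_mul,
    smul_smul, smul_smul]
  congr 1
  linear_combination (-Complex.I ^ numY (x + y)) * ((I_pow_mul_star (numY x)) +
    (Complex.I ^ numY x * star (Complex.I ^ numY x)) * (I_pow_mul_star (numY y)) +
    (Complex.I ^ numY x * star (Complex.I ^ numY x)) *
     (Complex.I ^ numY y * star (Complex.I ^ numY y)) * sgn_mul_self (x.2 ⬝ᵥ y.1))

/-! ### Expansion of an operator in Pauli operators -/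

/-- The squared norm of a vector. -/
def nrm {ι : Type} [Fintype ι] (v : ι → ℂ) : ℝ := ∑ i, Complex.normSq (v i)

theorem star_dotProduct_self {ι : Type} [Fintype ι] (v : ι → ℂ) :
    star v ⬝ᵥ v = (nrm v : ℂ) := by
  simp [nrm, dotProduct, Complex.normSq_eq_conj_mul_self]

theorem nrm_nonneg {ι : Type} [Fintype ι] (v : ι → ℂ) : 0 ≤ nrm v :=
  Finset.sum_nonneg fun _ _ => Complex.normSq_nonneg _

theorem nrm_mulVec_of_isometry {ι κ : Type} [Fintype ι] [Fintype κ] [DecidableEq κ]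
    {V : Matrix ι κ ℂ} (h : Vᴴ * V = 1) (v : κ → ℂ) : nrm (V *ᵥ v) = nrm v := by
  have : ((nrm (V *ᵥ v) : ℝ) : ℂ) = nrm v := by
    rw [← star_dotProduct_self, ← star_dotProduct_self, star_mulVec, ← dotProduct_mulVec,
      mulVec_mulVec, h, one_mulVec]
  exact_mod_cast this

/-- The matrix whose rows are the Bell bras. -/
def bellMatrix (n : ℕ) : Matrix (PauliVec n) (Bits n × Bits n) ℂ := fun p => bellBra p ()

theorem bellMatrix_isometry : (bellMatrix n)ᴴ * bellMatrix n = 1 := by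
  rw [← sum_bellBra]
  ext i j
  simp [mul_apply, Matrix.sum_apply, bellMatrix]

/-- There are as many Bell states as basis vectors, so the isometry is unitary: the normalised Pauli
operators form an orthonormal basis of the space of operators. -/
theorem bellMatrix_coisometry : bellMatrix n * (bellMatrix n)ᴴ = 1 :=
  (mul_eq_one_comm_of_card_eq _ _ _ (by simp [Fintype.card_prod])).1 bellMatrix_isometry

/-- The coefficient of `E_x` in the expansion of `G` in normalised Pauli operators. -/
def pauliCoeff (G : Matrix (Bits n) (Bits n) ℂ) (x : PauliVec n) : ℂ :=
  (bellMatrix n *ᵥ fun t => G t.1 t.2) x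

/-- The operator with given coefficients in normalised Pauli operators. -/
def pauliSum (c : PauliVec n → ℂ) : Matrix (Bits n) (Bits n) ℂ :=
  ∑ x, (((1 / Real.sqrt (2 ^ n) : ℝ) : ℂ) * c x) • pauli x

theorem pauliSum_apply (c : PauliVec n → ℂ) (t : Bits n × Bits n) :
    pauliSum c t.1 t.2 = ((bellMatrix n)ᴴ *ᵥ c) t := by
  have hr : star ((1 / Real.sqrt (2 ^ n) : ℝ) : ℂ) = ((1 / Real.sqrt (2 ^ n) : ℝ) : ℂ) :=
    Complex.conj_ofReal _
  simp only [pauliSum, Matrix.sum_apply, Matrix.smul_apply, smul_eq_mul, mulVec, dotProduct,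
    conjTranspose_apply, bellMatrix, bellBra, star_mul', star_star, hr]
  exact Finset.sum_congr rfl fun x _ => by ring

theorem pauliSum_pauliCoeff (G : Matrix (Bits n) (Bits n) ℂ) : pauliSum (pauliCoeff G) = G := by
  ext a b
  have h := pauliSum_apply (pauliCoeff G) (a, b)
  have h2 : pauliCoeff G = bellMatrix n *ᵥ fun t => G t.1 t.2 := rfl
  rw [h2, mulVec_mulVec, bellMatrix_isometry, one_mulVec] at h
  exact h

theorem nrm_pauliSum (c : PauliVec n → ℂ) :
    (nrm fun t : Bits n × Bits n => pauliSum c t.1 t.2) = nrm c := by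
  simp only [pauliSum_apply]
  exact nrm_mulVec_of_isometry (V := (bellMatrix n)ᴴ)
    (by rw [conjTranspose_conjTranspose, bellMatrix_coisometry]) c

theorem nrm_pauliCoeff (G : Matrix (Bits n) (Bits n) ℂ) :
    nrm (pauliCoeff G) = nrm fun t : Bits n × Bits n => G t.1 t.2 :=
  nrm_mulVec_of_isometry bellMatrix_isometry _

/-! ### Syndrome projectors -/

/-- If `U` makes every generator diagonal with signs `(-1)^(f i z)`, each factor of the syndrome
projector becomes the indicator of one bit, and the product becomes the indicator of the whole
syndrome. Applied to a decoder, this yields the properties of the projectors without any commutation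
argument among the generators. -/
theorem mul_syndromeProj {κ : Type} [Fintype κ] [DecidableEq κ] (U : Matrix κ (Bits n) ℂ)
    (g : Fin s → PauliVec n) (f : Fin s → κ → ZMod 2)
    (h : ∀ i, U * pauli (g i) = (diagonal fun z => sgn (f i z)) * U) (y : Bits s) :
    U * syndromeProj g y = (diagonal fun z => if (fun i => f i z) = y then (1 : ℂ) else 0) * U := by
  induction s with
  | zero =>
    have : ∀ z, (fun i => f i z) = y := fun z => Subsingleton.elim _ _
    simp [syndromeProj, this]
  | succ s ih =>
    have h0 : U * eigenProj (g 0) (y 0) =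
        (diagonal fun z => if f 0 z = y 0 then (1 : ℂ) else 0) * U := by
      rw [eigenProj, Matrix.mul_smul, Matrix.mul_add, Matrix.mul_smul, h]
      ext z t
      simp only [Matrix.smul_apply, Matrix.add_apply, Matrix.mul_one, diagonal_mul, smul_eq_mul]
      rcases zmod_two_eq (f 0 z) with e | e <;> rcases zmod_two_eq (y 0) with e' | e' <;>
        simp [e, e', sgn] <;> ring
    rw [show syndromeProj g y = eigenProj (g 0) (y 0) *
        syndromeProj (fun i => g i.succ) (fun i => y i.succ) from rfl, ← Matrix.mul_assoc, h0, Matrix.mul_assoc,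
      ih (fun i => g i.succ) (fun i => f i.succ) (fun i => h i.succ) fun i => y i.succ,
      ← Matrix.mul_assoc, diagonal_mul_diagonal]
    congr 2
    funext z
    have : (fun i => f i z) = y ↔
        f 0 z = y 0 ∧ (fun i : Fin s => f i.succ z) = fun i => y i.succ := by
      simp only [funext_iff, Fin.forall_fin_succ]
    simp only [this]
    split_ifs <;> simp_all

namespace Decoder

variable {Q : StabilizerCode n s}

theorem mul_syndromeProj (D : Decoder Q m) (y : Bits s) :
    D.U * syndromeProj Q.gen y =
      (diagonal fun z : Bits s × Bits m => if z.1 = y then (1 : ℂ) else 0) * D.U :=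
  _root_.mul_syndromeProj D.U Q.gen (fun i z => z.1 i) D.intertwines y

theorem syndromeProj_eq (D : Decoder Q m) (y : Bits s) :
    syndromeProj Q.gen y =
      D.Uᴴ * ((diagonal fun z : Bits s × Bits m => if z.1 = y then (1 : ℂ) else 0) * D.U) := by
  rw [← D.mul_syndromeProj, ← Matrix.mul_assoc, D.isometry, Matrix.one_mul]

theorem syndromeProj_conjTranspose (D : Decoder Q m) (y : Bits s) :
    (syndromeProj Q.gen y)ᴴ = syndromeProj Q.gen y := by
  rw [D.syndromeProj_eq, conjTranspose_mul, conjTranspose_mul, conjTranspose_conjTranspose,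
    diagonal_conjTranspose, Matrix.mul_assoc]
  congr 3
  funext z
  simp [apply_ite]

theorem syndromeProj_mul (D : Decoder Q m) (y y' : Bits s) :
    syndromeProj Q.gen y * syndromeProj Q.gen y' =
      if y = y' then syndromeProj Q.gen y else 0 := by
  have : D.U * (syndromeProj Q.gen y * syndromeProj Q.gen y') =
      D.U * if y = y' then syndromeProj Q.gen y else 0 := by
    rw [← Matrix.mul_assoc, D.mul_syndromeProj, Matrix.mul_assoc, D.mul_syndromeProj,
      ← Matrix.mul_assoc, diagonal_mul_diagonal]
    split_ifs with h
    · subst h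
      rw [D.mul_syndromeProj]
      congr 2; funext z; simp
    · rw [Matrix.mul_zero, ← Matrix.zero_mul D.U, ← diagonal_zero]
      congr 2; funext z
      split_ifs <;> simp_all
  have h2 := congrArg (D.Uᴴ * ·) this
  simpa only [← Matrix.mul_assoc, D.isometry, Matrix.one_mul] using h2

theorem pauli_mul_syndromeProj (D : Decoder Q m) (i : Fin s) (y : Bits s) :
    pauli (Q.gen i) * syndromeProj Q.gen y = sgn (y i) • syndromeProj Q.gen y := by
  have : D.U * (pauli (Q.gen i) * syndromeProj Q.gen y) =
      D.U * (sgn (y i) • syndromeProj Q.gen y) := by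
    rw [← Matrix.mul_assoc, D.intertwines, Matrix.mul_assoc, D.mul_syndromeProj,
      ← Matrix.mul_assoc, diagonal_mul_diagonal, Matrix.mul_smul, D.mul_syndromeProj,
      ← Matrix.smul_mul, ← diagonal_smul]
    congr 2; funext z
    simp only [Pi.smul_apply, smul_eq_mul]
    split_ifs with h
    · rw [h]
    · simp
  have h2 := congrArg (D.Uᴴ * ·) this
  simpa only [← Matrix.mul_assoc, D.isometry, Matrix.one_mul] using h2

theorem syndromeProj_mul_pauli (D : Decoder Q m) (i : Fin s) (y : Bits s) :
    syndromeProj Q.gen y * pauli (Q.gen i) = sgn (y i) • syndromeProj Q.gen y := by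
  have h := congrArg conjTranspose (D.pauli_mul_syndromeProj i y)
  rwa [conjTranspose_mul, conjTranspose_smul, D.syndromeProj_conjTranspose, pauli_conjTranspose,
    star_sgn] at h

/-- A detectable error changes the syndrome. -/
theorem syndromeProj_mul_pauli_mul_of_symp (D : Decoder Q m) (y : Bits s) (x : PauliVec n)
    (hx : ∃ z ∈ Q.space, symp z x ≠ 0) :
    syndromeProj Q.gen y * pauli x * syndromeProj Q.gen y = 0 := by
  -- Being linear in its first argument, the form against `x` would vanish on the whole code if it
  -- vanished on the generators.
  obtain ⟨i, hi⟩ : ∃ i, symp (Q.gen i) x ≠ 0 := by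
    by_contra! h
    obtain ⟨z, hz, hzx⟩ := hx
    refine hzx ?_
    induction hz using Submodule.span_induction with
    | mem z hz => obtain ⟨i, rfl⟩ := hz; exact h i
    | zero => simp [symp]
    | add a b _ _ ha hb =>
      rw [symp_add_left]
      by_cases h1 : symp a x = 0
      · by_cases h2 : symp b x = 0
        · rw [h1, h2, add_zero]
        · exact absurd (hb h2) h2
      · exact absurd (ha h1) h1
    | smul c a _ ha =>
      rw [symp_smul_left]
      by_cases h1 : symp a x = 0
      · rw [h1, mul_zero]
      · exact absurd (ha h1) h1
  have h1 : symp (Q.gen i) x = 1 := (zmod_two_eq _).resolve_left hi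
  -- The generator is absorbed by the left projector, or first moved past the error and then
  -- absorbed by the right one. The two results differ by a sign, so the sandwiched error is its own
  -- negative.
  have h2 : syndromeProj Q.gen y * (pauli (Q.gen i) * pauli x) * syndromeProj Q.gen y =
      sgn (y i) • (syndromeProj Q.gen y * pauli x * syndromeProj Q.gen y) := by
    rw [← Matrix.mul_assoc, D.syndromeProj_mul_pauli, Matrix.smul_mul, Matrix.smul_mul]
  have h3 : syndromeProj Q.gen y * (pauli (Q.gen i) * pauli x) * syndromeProj Q.gen y =
      -sgn (y i) • (syndromeProj Q.gen y * pauli x * syndromeProj Q.gen y) := by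
    rw [pauli_mul_comm, h1, Matrix.mul_smul, Matrix.smul_mul, ← Matrix.mul_assoc,
      Matrix.mul_assoc _ (pauli (Q.gen i)), D.pauli_mul_syndromeProj, Matrix.mul_smul, smul_smul]
    simp only [sgn, one_ne_zero, if_false, neg_one_mul]
  have h4 : sgn (y i) ≠ 0 := fun e => by simpa [e] using sgn_mul_self (y i)
  rw [h2] at h3
  have h5 : ((2 : ℂ) * sgn (y i)) •
      (syndromeProj Q.gen y * pauli x * syndromeProj Q.gen y) = 0 := by
    rw [mul_smul, two_smul]
    nth_rewrite 1 [h3]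
    rw [neg_smul, neg_add_cancel]
  exact (smul_eq_zero.1 h5).resolve_left (mul_ne_zero two_ne_zero h4)

/-- An error in the code acts trivially. -/
theorem exists_pauli_mul_syndromeProj (D : Decoder Q m) (y : Bits s) {x : PauliVec n} (hx : x ∈ Q.space) :
    ∃ c : ℂ, pauli x * syndromeProj Q.gen y = c • syndromeProj Q.gen y := by
  induction hx using Submodule.span_induction with
  | mem z hz => obtain ⟨i, rfl⟩ := hz; exact ⟨_, D.pauli_mul_syndromeProj i y⟩
  | zero => exact ⟨1, by rw [pauli_zero, Matrix.one_mul, one_smul]⟩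
  | add a b _ _ ha hb =>
    obtain ⟨c, hc⟩ := ha
    obtain ⟨c', hc'⟩ := hb
    obtain ⟨d, hd⟩ := exists_pauli_add a b
    refine ⟨d * c' * c, ?_⟩
    rw [hd, Matrix.smul_mul, Matrix.mul_assoc, hc', Matrix.mul_smul, hc, smul_smul, smul_smul]
  | smul c a _ ha =>
    rcases zmod_two_eq c with rfl | rfl
    · exact ⟨1, by rw [zero_smul, pauli_zero, Matrix.one_mul, one_smul]⟩
    · simpa using ha

end Decoder

end PauliAlgebra

/-! ### Pure joint states as families of operators, and the failure event. -/

noncomputable section JointStates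

open Matrix Kronecker ComplexOrder

/-! ### Pure states of the joint system -/

theorem proj_zero {ι : Type} : proj (0 : ι → ℂ) = 0 := by
  simp [proj]

theorem proj_submatrix {ι κ : Type} (v : ι → ℂ) (f : κ → ι) :
    (proj v).submatrix f f = proj (v ∘ f) := rfl

theorem nrm_comp_equiv {ι κ : Type} [Fintype ι] [Fintype κ] (v : ι → ℂ) (e : κ ≃ ι) :
    nrm (v ∘ e) = nrm v :=
  e.sum_comp fun i => Complex.normSq (v i)

theorem mul_proj_mul {ι κ : Type} [Fintype ι] (K : Matrix κ ι ℂ) (v : ι → ℂ) :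
    K * proj v * Kᴴ = proj (K *ᵥ v) := by
  rw [proj, mul_vecMulVec, vecMulVec_mul, proj, star_mulVec]

theorem Instrument.branch_proj {C a b X Y : Type} [Fintype C] [DecidableEq a] [Fintype b]
    [Fintype X] (μ : Instrument C a b) (lift : Matrix b a ℂ → Matrix Y X ℂ) (c : C)
    (v : X → ℂ) :
    μ.branch lift c (proj v) = ∑ j, proj (lift (μ.kraus c j) *ᵥ v) := by
  simp only [Instrument.branch, mul_proj_mul]

theorem Instrument.branch_sum {C a b X Y ι : Type} [Fintype C] [DecidableEq a] [Fintype b]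
    [Fintype X] (μ : Instrument C a b) (lift : Matrix b a ℂ → Matrix Y X ℂ) (c : C)
    (s : Finset ι) (ρ : ι → Matrix X X ℂ) :
    μ.branch lift c (∑ i ∈ s, ρ i) = ∑ i ∈ s, μ.branch lift c (ρ i) := by
  simp only [Instrument.branch, Matrix.mul_sum, Matrix.sum_mul]
  exact Finset.sum_comm

theorem Instrument.branch_ofKraus_proj {C a b X Y : Type} [Fintype C] [DecidableEq a]
    [Fintype b] [Fintype X] (K : C → Matrix b a ℂ) (h : ∑ c, (K c)ᴴ * K c = 1)
    (lift : Matrix b a ℂ → Matrix Y X ℂ) (c : C) (v : X → ℂ) :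
    (Instrument.ofKraus K h).branch lift c (proj v) = proj (lift (K c) *ᵥ v) := by
  rw [Instrument.branch_proj]
  change ∑ _ : Unit, proj (lift (K c) *ᵥ v) = _
  simp

theorem sum_nrm_mulVec {ι κ X Y : Type} [Fintype ι] [Fintype κ] [Fintype X] [DecidableEq X]
    [Fintype Y] (K : ι → κ → Matrix Y X ℂ) (h : ∑ c, ∑ j, (K c j)ᴴ * K c j = 1) (v : X → ℂ) :
    ∑ c, ∑ j, nrm (K c j *ᵥ v) = nrm v := by
  have : ((∑ c, ∑ j, nrm (K c j *ᵥ v) : ℝ) : ℂ) = nrm v := by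
    push_cast
    simp only [← star_dotProduct_self, star_mulVec, ← dotProduct_mulVec, mulVec_mulVec]
    simp only [← dotProduct_sum, ← sum_mulVec, h, one_mulVec]
  exact_mod_cast this

theorem sum_nrm_mulVec_le {ι κ X Y : Type} [Fintype ι] [Fintype κ] [Fintype X] [DecidableEq X]
    [Fintype Y] (K : ι → κ → Matrix Y X ℂ) (h : ∑ c, ∑ j, (K c j)ᴴ * K c j = 1) (c : ι)
    (v : X → ℂ) : ∑ j, nrm (K c j *ᵥ v) ≤ nrm v := by
  rw [← sum_nrm_mulVec K h v]
  exact Finset.single_le_sum (f := fun c => ∑ j, nrm (K c j *ᵥ v))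
    (fun c _ => Finset.sum_nonneg fun j _ => nrm_nonneg _) (Finset.mem_univ c)

section

variable {m d d' : ℕ} {α α' β β' : Type}

/-- The vector `∑ ψ_t (G_e)_{ba} |e⟩|t⟩|a⟩|b⟩`, where the adversary holds `|e⟩`, Alice holds the
message `|t⟩` and `|a⟩`, and Bob holds `|b⟩`. -/
def jointState (ψ : Bits m → ℂ) (G : Fin d → Matrix β α ℂ) :
    Fin d × (Bits m × α) × β → ℂ :=
  fun x => ψ x.2.1.1 * G x.1 x.2.2 x.2.1.2

theorem jointState_add (ψ : Bits m → ℂ) (G G' : Fin d → Matrix β α ℂ) :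
    jointState ψ (fun e => G e + G' e) = jointState ψ G + jointState ψ G' := by
  funext x
  simp [jointState, mul_add]

theorem jointState_smul (ψ : Bits m → ℂ) (c : ℂ) (G : Fin d → Matrix β α ℂ) :
    jointState ψ (fun e => c • G e) = c • jointState ψ G := by
  funext x
  simp only [jointState, Matrix.smul_apply, smul_eq_mul, Pi.smul_apply]
  ring

theorem jointState_zero (ψ : Bits m → ℂ) :
    jointState ψ (fun _ : Fin d => (0 : Matrix β α ℂ)) = 0 := by
  funext x
  simp [jointState]

theorem nrm_jointState [Fintype α] [Fintype β] {ψ : Bits m → ℂ} (hψ : nrm ψ = 1)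
    (G : Fin d → Matrix β α ℂ) :
    nrm (jointState ψ G) = ∑ e, nrm fun t : β × α => G e t.1 t.2 := by
  simp only [nrm, jointState, Complex.normSq_mul, Fintype.sum_prod_type] at hψ ⊢
  refine Finset.sum_congr rfl fun e _ => ?_
  simp only [← Finset.mul_sum]
  rw [← Finset.sum_mul, hψ, one_mul, Finset.sum_comm]

theorem liftE_mulVec_jointState [Fintype α] [DecidableEq α] [Fintype β] [DecidableEq β]
    (K : Matrix (Fin d') (Fin d) ℂ) (ψ : Bits m → ℂ) (G : Fin d → Matrix β α ℂ) :
    liftE (Bits m × α) β K *ᵥ jointState ψ G =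
      jointState ψ fun e => ∑ e', K e e' • G e' := by
  funext ⟨e, t, b⟩
  simp only [liftE, mulVec, dotProduct, Fintype.sum_prod_type (α₁ := Fin d), kroneckerMap_apply,
    one_apply, mul_ite, ite_mul, mul_one, mul_zero, zero_mul, Finset.sum_ite_eq, Finset.mem_univ,
    if_true, jointState, Matrix.sum_apply, Matrix.smul_apply, smul_eq_mul, Finset.mul_sum]
  exact Finset.sum_congr rfl fun e' _ => by ring

theorem liftB_mulVec_jointState [Fintype α] [DecidableEq α] [Fintype β]
    (K : Matrix β' β ℂ) (ψ : Bits m → ℂ) (G : Fin d → Matrix β α ℂ) :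
    liftB (Fin d) (Bits m × α) K *ᵥ jointState ψ G = jointState ψ fun e => K * G e := by
  funext ⟨e, t, b⟩
  simp only [liftB, mulVec, dotProduct, Fintype.sum_prod_type (α₁ := Fin d),
    Fintype.sum_prod_type (α₁ := Bits m × α), kroneckerMap_apply,
    one_apply, ite_mul, one_mul, zero_mul, Finset.sum_ite_irrel,
    Finset.sum_const_zero, Finset.sum_ite_eq, Finset.mem_univ,
    if_true, jointState, Matrix.mul_apply, Finset.mul_sum]
  exact Finset.sum_congr rfl fun e' _ => by ring

/-- The transposition trick: an operator on Alice's half of a pair acts on the operator `G e` from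
the right, by its transpose. The complex conjugation in the protocol turns the transpose into an
adjoint. -/
theorem liftA_mulVec_jointState [Fintype α] [Fintype β] [DecidableEq β]
    (K : Matrix α' α ℂ) (ψ : Bits m → ℂ) (G : Fin d → Matrix β α ℂ) :
    liftA (Fin d) β ((1 : Matrix (Bits m) (Bits m) ℂ) ⊗ₖ K.map star) *ᵥ jointState ψ G =
      jointState ψ fun e => G e * Kᴴ := by
  funext ⟨e, t, b⟩
  simp only [liftA, mulVec, dotProduct, Fintype.sum_prod_type, kroneckerMap_apply,
    one_apply, ite_mul, one_mul, mul_one, zero_mul, mul_ite, mul_zero, Finset.sum_ite_irrel,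
    Finset.sum_const_zero, Finset.sum_ite_eq, Finset.mem_univ, map_apply, conjTranspose_apply,
    if_true, jointState, Matrix.mul_apply, Finset.mul_sum]
  exact Finset.sum_congr rfl fun e' _ => by ring

end

/-! ### The projector onto the undetected failures -/

section

variable {m : ℕ}

/-- The projector onto "Bob accepts and the message is not `ψ`". -/
def failProj (ψ : Bits m → ℂ) : Matrix (Bits m × Bool) (Bits m × Bool) ℂ :=
  (1 - proj ψ) ⊗ₖ accProj

theorem accProj_add_rejProj : accProj + rejProj = 1 := by
  ext (_ | _) (_ | _) <;> simp [accProj, rejProj]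

theorem passProj_eq (ψ : Bits m → ℂ) : passProj ψ = 1 - failProj ψ := by
  have h : rejProj = 1 - accProj := by rw [← accProj_add_rejProj, add_sub_cancel_left]
  rw [passProj, failProj, h]
  ext ⟨i, i'⟩ ⟨j, j'⟩
  simp only [Matrix.sub_apply, Matrix.add_apply, kroneckerMap_apply, one_apply, Prod.mk.injEq,
    ite_and]
  split_ifs <;> ring

theorem posSemidef_one_sub_proj {ψ : Bits m → ℂ} (hψ : star ψ ⬝ᵥ ψ = 1) :
    (1 - proj ψ).PosSemidef := by
  have h1 : (proj ψ)ᴴ = proj ψ := by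
    ext i j
    simp [proj, vecMulVec_apply, mul_comm]
  have h2 : proj ψ * proj ψ = proj ψ := by
    rw [proj, vecMulVec_mul_vecMulVec, hψ, one_smul]
  have h3 : 1 - proj ψ = (1 - proj ψ)ᴴ * (1 - proj ψ) := by
    rw [conjTranspose_sub, h1, conjTranspose_one]
    simp [sub_mul, mul_sub, h2]
  rw [h3]
  exact posSemidef_conjTranspose_mul_self _

theorem posSemidef_accProj : accProj.PosSemidef := by
  have : accProj = accProjᴴ * accProj := by simp [accProj]
  rw [this]
  exact posSemidef_conjTranspose_mul_self _

theorem posSemidef_rejProj : rejProj.PosSemidef := by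
  have : rejProj = rejProjᴴ * rejProj := by simp [rejProj]
  rw [this]
  exact posSemidef_conjTranspose_mul_self _

theorem posSemidef_failProj {ψ : Bits m → ℂ} (hψ : star ψ ⬝ᵥ ψ = 1) :
    (failProj ψ).PosSemidef :=
  (posSemidef_one_sub_proj hψ).kronecker posSemidef_accProj

theorem posSemidef_one_sub_failProj (ψ : Bits m → ℂ) :
    (1 - failProj ψ).PosSemidef := by
  have : 1 - failProj ψ = proj ψ ⊗ₖ accProj + 1 ⊗ₖ rejProj := by
    have h : rejProj = 1 - accProj := by rw [← accProj_add_rejProj, add_sub_cancel_left]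
    rw [failProj, h]
    ext ⟨i, i'⟩ ⟨j, j'⟩
    simp only [Matrix.sub_apply, Matrix.add_apply, kroneckerMap_apply, one_apply, Prod.mk.injEq,
      ite_and]
    split_ifs <;> ring
  rw [this]
  exact ((posSemidef_vecMulVec_self_star ψ).kronecker posSemidef_accProj).add
    (PosSemidef.one.kronecker posSemidef_rejProj)

/-- A jammed run rejects and so never counts as a failure; only the delivering branches of an attack
have to be followed. -/
theorem failProj_mul_jammed (ψ : Bits m → ℂ) (q : ℂ) :
    failProj ψ * Protocol.jammed m q = 0 := by
  ext i j
  rw [mul_apply, Matrix.zero_apply]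
  refine Finset.sum_eq_zero fun x _ => ?_
  by_cases hx : (0, false) = x
  · subst hx
    simp [failProj, accProj, kroneckerMap_apply]
  · simp [Protocol.jammed, hx]

theorem failProj_mul_proj {ψ : Bits m → ℂ} (hψ : star ψ ⬝ᵥ ψ = 1) :
    failProj ψ * (proj ψ ⊗ₖ accProj) = 0 := by
  rw [failProj, ← mul_kronecker_mul, Matrix.sub_mul, proj, vecMulVec_mul_vecMulVec, hψ, one_smul,
    Matrix.one_mul, sub_self, zero_kronecker]

end

end JointStates

/-! ### Decoding and teleportation through perfect pairs. -/

noncomputable section ProtocolStages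

open Matrix Kronecker

namespace Protocol

section

variable {m : ℕ} {A B : Type} [Fintype A] [DecidableEq A] [Fintype B] [DecidableEq B]

theorem heard_passive (p : Protocol m A B) (d : ℕ) (ρ : Matrix (Fin d × A × B) (Fin d × A × B) ℂ) :
    p.heard ⟨d, Instrument.idle _, p.passive d⟩ ρ = p.run d (p.passive d) ρ := by
  have h1 : (Instrument.idle (Fin d)).branch (liftE A B) true ρ = ρ := by
    change ∑ _ : Unit, _ = _
    simp [Instrument.idle, Instrument.ofKraus, liftE]
  have h2 : (Instrument.idle (Fin d)).branch (liftE A B) false ρ = 0 := by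
    change ∑ _ : Unit, _ = _
    simp [Instrument.idle, Instrument.ofKraus, liftE]
  simp [heard, h1, h2, jammed]

theorem trace_failProj_mul_heard_proj (p : Protocol m A B) {d : ℕ}
    (att : (d' : ℕ) × Instrument Bool (Fin d) (Fin d') × p.Attack d')
    (ψ : Bits m → ℂ) (v : Fin d × A × B → ℂ) :
    (failProj ψ * p.heard att (proj v)).trace =
      ∑ j, (failProj ψ * p.run att.1 att.2.2
        (proj (liftE A B (att.2.1.kraus true j) *ᵥ v))).trace := by
  rw [heard, Matrix.mul_add, failProj_mul_jammed, add_zero, Instrument.branch_proj,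
    (p.isOperation_run _ _).trace_mul_sum]

end

section

variable {m n d : ℕ}

/-- The state after Alice's Bell measurement, when the decoded pairs were perfect. -/
def teleported (p : PauliVec m) (ψ : Bits m → ℂ) (c : Fin d → ℂ) : Fin d × Unit × Bits m → ℂ :=
  fun x => c x.1 * (pauli p *ᵥ ψ) x.2.2

theorem liftE_mulVec_teleported {d' : ℕ} (K : Matrix (Fin d') (Fin d) ℂ) (p : PauliVec m)
    (ψ : Bits m → ℂ) (c : Fin d → ℂ) :
    liftE Unit (Bits m) K *ᵥ teleported p ψ c = teleported p ψ (K *ᵥ c) := by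
  funext ⟨e, t, b⟩
  simp only [liftE, mulVec, dotProduct, Fintype.sum_prod_type (α₁ := Fin d), kroneckerMap_apply,
    one_apply, mul_ite, ite_mul, mul_one, mul_zero, zero_mul, Finset.sum_ite_eq, Finset.mem_univ,
    if_true, teleported, Finset.sum_mul]
  exact Finset.sum_congr rfl fun e' _ => by ring

theorem liftB_correctMatrix_mulVec_teleported (p : PauliVec m) (ψ : Bits m → ℂ) (c : Fin d → ℂ) :
    liftB (Fin d) Unit (correctMatrix p) *ᵥ teleported p ψ c =
      fun x => c x.1 * (if x.2.2.2 then ψ x.2.2.1 else 0) := by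
  funext ⟨e, t, b, v⟩
  have h : (pauli p *ᵥ (pauli p *ᵥ ψ)) b = ψ b := by
    rw [mulVec_mulVec, pauli_mul_self, one_mulVec]
  have h2 : (liftB (Fin d) Unit (correctMatrix p) *ᵥ teleported p ψ c) (e, t, b, v) =
      ∑ u, correctMatrix p (b, v) u * (c e * (pauli p *ᵥ ψ) u) := by
    simp only [liftB, mulVec, dotProduct, Fintype.sum_prod_type, kroneckerMap_apply,
      one_apply, ite_mul, one_mul, zero_mul, Finset.sum_ite_irrel,
      Finset.sum_const_zero, Finset.sum_ite_eq, Finset.mem_univ, if_true, teleported,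
      Fintype.sum_unique]
  rw [h2]
  cases v with
  | false => simp [correctMatrix]
  | true =>
    simp only [correctMatrix, if_true]
    rw [← h]
    simp only [mulVec, dotProduct, Finset.mul_sum]
    exact Finset.sum_congr rfl fun u _ => Finset.sum_congr rfl fun u' _ => by ring

/-- Bob's correction undoes `E_p` because `E_p` squares to one. The adversary's vector `c` stays in
a product with `ψ` and enters only through its squared norm. -/
theorem run_correctAndAccept (p : PauliVec m) (ψ : Bits m → ℂ) (c : Fin d → ℂ)
    (att : (finish (A := Unit) (correctAndAccept p)).Attack d) :
    (finish (A := Unit) (correctAndAccept p)).run d att (proj (teleported p ψ c)) =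
      (∑ e, c e * star (c e)) • (proj ψ ⊗ₖ accProj) := by
  simp only [run]
  rw [correctAndAccept, Instrument.ofIsometry, Instrument.branch_ofKraus_proj,
    liftB_correctMatrix_mulVec_teleported]
  ext ⟨x, v⟩ ⟨x', v'⟩
  simp only [proj, vecMulVec_apply, Fintype.sum_unique, Matrix.smul_apply, kroneckerMap_apply,
    Pi.star_apply, smul_eq_mul, Finset.sum_mul, accProj, single_apply]
  refine Finset.sum_congr rfl fun e _ => ?_
  cases v <;> cases v' <;> simp
  ring

/-- The teleportation identity. The family `c e • 1` is the unnormalised maximally entangled state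
times `c`, so contracting it with the Bell bra moves the message to Bob as `E_p ψ`; the adjoint that
appears is harmless because `E_p` is Hermitian. -/
theorem bellBra_mulVec_jointState (p : PauliVec m) (ψ : Bits m → ℂ) (c : Fin d → ℂ) :
    liftA (Fin d) (Bits m) (bellBra p) *ᵥ
        jointState ψ (fun e => c e • (1 : Matrix (Bits m) (Bits m) ℂ)) =
      teleported p ψ fun e => ((1 / Real.sqrt (2 ^ m) : ℝ) : ℂ) * c e := by
  funext ⟨e, t, b⟩
  have h : (pauli p *ᵥ ψ) b = ∑ u, star (pauli p u b) * ψ u := by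
    simp only [mulVec, dotProduct]
    exact Finset.sum_congr rfl fun u _ => by
      rw [← conjTranspose_apply, pauli_conjTranspose]
  simp only [teleported, h, Finset.mul_sum]
  simp only [liftA, mulVec, dotProduct, Fintype.sum_prod_type, kroneckerMap_apply,
    one_apply, ite_mul, one_mul, mul_one, zero_mul, mul_ite, mul_zero, Finset.sum_ite_irrel,
    Finset.sum_const_zero, Finset.sum_ite_eq, Finset.sum_ite_eq', Finset.mem_univ,
    if_true, jointState, Matrix.smul_apply, smul_eq_mul, bellBra]
  exact Finset.sum_congr rfl fun u _ => by ring

end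

section

variable {n m s d : ℕ} {Q : StabilizerCode n s} (D : Decoder Q m)

/-- The part of the protocol that follows the agreement of the syndromes. -/
def decodeAndTeleport : Protocol m (Bits m × Bits n) (Bits n) :=
  .aliceDoes (aliceDecode D) <|
  .bobDoes (bobDecode D) <|
  .aliceSays (bellMeasurement m) fun p =>
  .finish (correctAndAccept p)

/-- The part of the protocol that follows Alice's announcement of her syndrome `y`. -/
def compareSyndrome (y : Bits s) : Protocol m (Bits m × Bits n) (Bits n) :=
  .bobSays (bobCompare Q y) fun ok =>
  if ok then decodeAndTeleport D else .finish (reject n m)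

/-- The part of the protocol that follows Alice's announcement of the code. -/
def measureSyndrome : Protocol m (Bits m × Bits n) (Bits n) :=
  .aliceSays (aliceSyndrome Q m) (compareSyndrome D)

/-- A decoder carries the syndrome projector to `|y⟩⟨y| ⊗ 1`; the statement lists the blocks of this
operator. -/
theorem decode_syndromeProj (y z z' : Bits s) :
    D.U.submatrix (fun t => (z', t)) id * syndromeProj Q.gen y *
        (D.U.submatrix (fun t => (z, t)) id)ᴴ =
      if z = y ∧ z' = y then (1 : Matrix (Bits m) (Bits m) ℂ) else 0 := by
  have h : D.U * syndromeProj Q.gen y * D.Uᴴ =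
      diagonal fun z : Bits s × Bits m => if z.1 = y then (1 : ℂ) else 0 := by
    rw [D.mul_syndromeProj, Matrix.mul_assoc, D.coisometry, Matrix.mul_one]
  ext t' t
  have h2 := congrFun (congrFun h (z', t')) (z, t)
  have h3 : (D.U.submatrix (fun t => (z', t)) id * syndromeProj Q.gen y *
        (D.U.submatrix (fun t => (z, t)) id)ᴴ) t' t =
      (D.U * syndromeProj Q.gen y * D.Uᴴ) (z', t') (z, t) := rfl
  rw [h3, h2, diagonal_apply]
  by_cases h4 : z' = z
  · subst h4
    by_cases h5 : z' = y <;> simp [h5, one_apply]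
  · have : ¬ (z = y ∧ z' = y) := fun h => h4 (h.2.trans h.1.symm)
    simp [this, h4]

/-- Both syndrome registers are in the state `|y⟩`, so discarding them keeps one term of the double
sum and the state remains pure: `m` perfect pairs, uncorrelated with the adversary. -/
theorem decode_jointState (y : Bits s) (ψ : Bits m → ℂ) (c : Fin d → ℂ) :
    (bobDecode D).branch (liftB (Fin d) (Bits m × Bits m)) ()
      ((aliceDecode D).branch (liftA (Fin d) (Bits n)) ()
        (proj (jointState ψ fun e => c e • syndromeProj Q.gen y))) =
      proj (jointState ψ fun e => c e • (1 : Matrix (Bits m) (Bits m) ℂ)) := by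
  rw [Instrument.branch_proj, Instrument.branch_sum]
  simp only [Instrument.branch_proj]
  change ∑ z : Bits s, ∑ z' : Bits s, proj (liftB (Fin d) (Bits m × Bits m)
    (D.U.submatrix (fun t => (z', t)) id) *ᵥ (liftA (Fin d) (Bits n)
      ((1 : Matrix (Bits m) (Bits m) ℂ) ⊗ₖ (D.U.submatrix (fun t => (z, t)) id).map star) *ᵥ
        jointState ψ fun e => c e • syndromeProj Q.gen y)) = _
  simp only [liftA_mulVec_jointState, liftB_mulVec_jointState, Matrix.smul_mul,
    Matrix.mul_smul, ← Matrix.mul_assoc, decode_syndromeProj]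
  rw [Finset.sum_eq_single y, Finset.sum_eq_single y]
  · simp
  · intro z' _ hz'
    simp [hz', jointState_zero, proj_zero]
  · simp
  · intro z _ hz
    simp [hz, jointState_zero, proj_zero]
  · simp

theorem run_decodeAndTeleport (y : Bits s) (ψ : Bits m → ℂ) (c : Fin d → ℂ)
    (att : (decodeAndTeleport D).Attack d) :
    (decodeAndTeleport D).run d att (proj (jointState ψ fun e => c e • syndromeProj Q.gen y)) =
      ∑ p, heard (.finish (correctAndAccept p)) (att p)
        (proj (teleported p ψ fun e => ((1 / Real.sqrt (2 ^ m) : ℝ) : ℂ) * c e)) := by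
  have h : (decodeAndTeleport D).run d att
      (proj (jointState ψ fun e => c e • syndromeProj Q.gen y)) =
      ∑ p, heard (.finish (correctAndAccept p)) (att p)
        ((bellMeasurement m).branch (liftA (Fin d) (Bits m)) p
        ((bobDecode D).branch (liftB (Fin d) (Bits m × Bits m)) ()
          ((aliceDecode D).branch (liftA (Fin d) (Bits n)) ()
            (proj (jointState ψ fun e => c e • syndromeProj Q.gen y))))) := rfl
  rw [h, decode_jointState]
  refine Finset.sum_congr rfl fun p _ => ?_
  rw [bellMeasurement, Instrument.branch_ofKraus_proj, bellBra_mulVec_jointState]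

end

end Protocol

end ProtocolStages

/-! ### Failure is bounded by the weight of the undetectable errors, for one code. -/

noncomputable section Soundness

open Matrix Kronecker ComplexOrder

namespace Protocol

variable {m n s d : ℕ} {Q : StabilizerCode n s} (D : Decoder Q m)

/-- With perfect encoded pairs, every delivered branch ends in a multiple of the ideal output,
whatever the adversary does on learning the Bell outcome. -/
theorem failProj_mul_run_decodeAndTeleport (y : Bits s) {ψ : Bits m → ℂ}
    (hψ : star ψ ⬝ᵥ ψ = 1) (c : Fin d → ℂ) (att : (decodeAndTeleport D).Attack d) :
    (failProj ψ * (decodeAndTeleport D).run d att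
      (proj (jointState ψ fun e => c e • syndromeProj Q.gen y))).trace = 0 := by
  rw [run_decodeAndTeleport, Matrix.mul_sum, trace_sum]
  refine Finset.sum_eq_zero fun p _ => ?_
  rw [trace_failProj_mul_heard_proj]
  refine Finset.sum_eq_zero fun j _ => ?_
  rw [liftE_mulVec_teleported, run_correctAndAccept, Matrix.mul_smul, failProj_mul_proj hψ,
    smul_zero, trace_zero]

theorem failProj_mul_heard_decodeAndTeleport (y : Bits s) {ψ : Bits m → ℂ}
    (hψ : star ψ ⬝ᵥ ψ = 1) (c : Fin d → ℂ)
    (att : (d' : ℕ) × Instrument Bool (Fin d) (Fin d') × (decodeAndTeleport D).Attack d') :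
    (failProj ψ * (decodeAndTeleport D).heard att
      (proj (jointState ψ fun e => c e • syndromeProj Q.gen y))).trace = 0 := by
  rw [trace_failProj_mul_heard_proj]
  refine Finset.sum_eq_zero fun j _ => ?_
  rw [liftE_mulVec_jointState]
  -- The adversary's Kraus operator only replaces the vector `c` by its image, so the hypothesis on
  -- the state is preserved.
  simp only [smul_smul, ← Finset.sum_smul]
  exact failProj_mul_run_decodeAndTeleport D y hψ _ _

/-- The output has no accepting component, and the failure projector lives on the accepting one. -/
theorem failProj_mul_run_reject (ψ : Bits m → ℂ) {A : Type} [Fintype A] [DecidableEq A]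
    (att : (finish (A := A) (reject n m)).Attack d)
    (ρ : Matrix (Fin d × A × Bits n) (Fin d × A × Bits n) ℂ) :
    (failProj ψ * (finish (A := A) (reject n m)).run d att ρ).trace = 0 := by
  have h : ∀ x y, (finish (A := A) (reject n m)).run d att ρ (x, true) y = 0 := by
    intro x y
    simp only [run]
    refine Finset.sum_eq_zero fun e _ => Finset.sum_eq_zero fun i _ => ?_
    rw [Instrument.branch, Matrix.sum_apply]
    refine Finset.sum_eq_zero fun j _ => ?_
    rw [Matrix.mul_assoc, mul_apply]
    refine Finset.sum_eq_zero fun w _ => ?_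
    have : liftB (Fin d) A ((reject n m).kraus () j) (e, i, x, true) w = 0 := by
      have h0 : (reject n m).kraus () j (x, true) w.2.2 = 0 :=
        single_apply_of_row_ne (by simp) _ _ _
      simp [liftB, kroneckerMap_apply, h0]
    rw [this, zero_mul]
  rw [trace]
  refine Finset.sum_eq_zero fun x _ => ?_
  rw [diag_apply, mul_apply]
  refine Finset.sum_eq_zero fun w _ => ?_
  obtain ⟨w, _ | _⟩ := w
  · simp [failProj, accProj, kroneckerMap_apply]
  · rw [h, mul_zero]

theorem trace_failProj_mul_heard_reject (ψ : Bits m → ℂ) {A : Type} [Fintype A] [DecidableEq A]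
    (att : (d' : ℕ) × Instrument Bool (Fin d) (Fin d') ×
      (finish (m := m) (A := A) (reject n m)).Attack d')
    (ρ : Matrix (Fin d × A × Bits n) (Fin d × A × Bits n) ℂ) :
    (failProj ψ * (finish (A := A) (reject n m)).heard att ρ).trace = 0 := by
  rw [heard, Matrix.mul_add, failProj_mul_jammed, add_zero, failProj_mul_run_reject]

theorem bobCompare_true_branch (Q : StabilizerCode n s) (y : Bits s) (ψ : Bits m → ℂ)
    (G : Fin d → Matrix (Bits n) (Bits n) ℂ) :
    (bobCompare Q y).branch (liftB (Fin d) (Bits m × Bits n)) true (proj (jointState ψ G)) =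
      proj (jointState ψ fun e => syndromeProj Q.gen y * G e) := by
  rw [Instrument.branch_proj]
  change ∑ y' : Bits s, proj (liftB (Fin d) (Bits m × Bits n)
    (if true = decide (y' = y) then syndromeProj Q.gen y' else 0) *ᵥ jointState ψ G) = _
  rw [Finset.sum_eq_single y]
  · simp [liftB_mulVec_jointState]
  · intro y' _ hy'
    simp [hy', liftB_mulVec_jointState, jointState_zero, proj_zero]
  · simp

theorem failProj_mul_run_compareSyndrome (y : Bits s) {ψ : Bits m → ℂ}
    (hψ : star ψ ⬝ᵥ ψ = 1) {G : Fin d → Matrix (Bits n) (Bits n) ℂ}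
    (hG : ∃ c : Fin d → ℂ, ∀ e, syndromeProj Q.gen y * G e = c e • syndromeProj Q.gen y)
    (att : (compareSyndrome D y).Attack d) :
    (failProj ψ * (compareSyndrome D y).run d att (proj (jointState ψ G))).trace = 0 := by
  obtain ⟨c, hc⟩ := hG
  have h : (compareSyndrome D y).run d att (proj (jointState ψ G)) =
      ∑ ok : Bool, heard (if ok then decodeAndTeleport D else .finish (reject n m)) (att ok)
        ((bobCompare Q y).branch (liftB (Fin d) (Bits m × Bits n)) ok
          (proj (jointState ψ G))) := rfl
  have h1 := failProj_mul_heard_decodeAndTeleport D y hψ c (att true)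
  have h2 := trace_failProj_mul_heard_reject ψ (att false)
    ((bobCompare Q y).branch (liftB (Fin d) (Bits m × Bits n)) false (proj (jointState ψ G)))
  rw [h, Fintype.sum_bool, bobCompare_true_branch, Matrix.mul_add, trace_add]
  simp only [hc]
  exact (congrArg₂ (· + ·) h1 h2).trans (add_zero 0)

theorem failProj_mul_heard_compareSyndrome (y : Bits s) {ψ : Bits m → ℂ}
    (hψ : star ψ ⬝ᵥ ψ = 1) {G : Fin d → Matrix (Bits n) (Bits n) ℂ}
    (hG : ∀ e, ∃ c : ℂ, syndromeProj Q.gen y * G e = c • syndromeProj Q.gen y)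
    (att : (d' : ℕ) × Instrument Bool (Fin d) (Fin d') × (compareSyndrome D y).Attack d') :
    (failProj ψ * (compareSyndrome D y).heard att (proj (jointState ψ G))).trace = 0 := by
  choose c hc using hG
  rw [trace_failProj_mul_heard_proj]
  refine Finset.sum_eq_zero fun j _ => ?_
  rw [liftE_mulVec_jointState]
  refine failProj_mul_run_compareSyndrome D y hψ
    ⟨fun e => ∑ e', att.2.1.kraus true j e e' * c e', fun e => ?_⟩ _
  simp only [Matrix.mul_sum, Matrix.mul_smul, hc, smul_smul, ← Finset.sum_smul]

open Classical in
/-- The total weight of the undetectable errors in an operator. -/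
def undetectableWeight (Q : StabilizerCode n s) (G : Fin d → Matrix (Bits n) (Bits n) ℂ) : ℝ :=
  ∑ x, if Q.Undetectable x then nrm fun e => pauliCoeff (G e) x else 0

open Classical in
/-- The component of an operator that consists of undetectable errors. -/
def undetectablePart (Q : StabilizerCode n s) (G : Matrix (Bits n) (Bits n) ℂ) :
    Matrix (Bits n) (Bits n) ℂ :=
  pauliSum fun x => if Q.Undetectable x then pauliCoeff G x else 0

theorem nrm_undetectablePart (Q : StabilizerCode n s) {ψ : Bits m → ℂ} (hψ : nrm ψ = 1)
    (G : Fin d → Matrix (Bits n) (Bits n) ℂ) :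
    nrm (jointState ψ fun e => undetectablePart Q (G e)) = undetectableWeight Q G := by
  rw [nrm_jointState hψ]
  have h : ∀ e, (nrm fun t : Bits n × Bits n => undetectablePart Q (G e) t.1 t.2) = _ :=
    fun e => nrm_pauliSum _
  rw [Finset.sum_congr rfl fun e _ => h e]
  simp only [undetectableWeight, nrm]
  rw [Finset.sum_comm]
  refine Finset.sum_congr rfl fun x _ => ?_
  split_ifs <;> simp

/-- Each remaining Pauli term either changes the syndrome and is annihilated between the projectors,
or belongs to the code and acts on the projected space as a scalar. The detectable part therefore
leaves perfect encoded pairs. -/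
theorem syndromeProj_mul_detectablePart (D : Decoder Q m) (y : Bits s) (G : Matrix (Bits n) (Bits n) ℂ) :
    ∃ c : ℂ, syndromeProj Q.gen y * ((G - undetectablePart Q G) * syndromeProj Q.gen y) =
      c • syndromeProj Q.gen y := by
  classical
  have h : ∀ x, ∃ c : ℂ, syndromeProj Q.gen y *
      ((pauliCoeff G x - if Q.Undetectable x then pauliCoeff G x else 0) • pauli x) *
        syndromeProj Q.gen y = c • syndromeProj Q.gen y := by
    intro x
    by_cases hx : Q.Undetectable x
    · exact ⟨0, by simp [hx]⟩
    · rw [if_neg hx, sub_zero, Matrix.mul_smul, Matrix.smul_mul]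
      by_cases hs : ∃ z ∈ Q.space, symp z x ≠ 0
      · exact ⟨0, by rw [D.syndromeProj_mul_pauli_mul_of_symp y x hs, smul_zero, zero_smul]⟩
      · have hQ : x ∈ Q.space := by
          by_contra hQ
          push Not at hs
          exact hx ⟨hs, hQ⟩
        obtain ⟨c, hc⟩ := D.exists_pauli_mul_syndromeProj y hQ
        exact ⟨pauliCoeff G x * c, by
          rw [Matrix.mul_assoc, hc, Matrix.mul_smul, D.syndromeProj_mul, if_pos rfl, smul_smul]⟩
  choose c hc using h
  refine ⟨∑ x, ((1 / Real.sqrt (2 ^ n) : ℝ) : ℂ) * c x, ?_⟩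
  have hG : G - undetectablePart Q G = ∑ x, ((1 / Real.sqrt (2 ^ n) : ℝ) : ℂ) •
      ((pauliCoeff G x - if Q.Undetectable x then pauliCoeff G x else 0) • pauli x) := by
    refine (congrArg (· - undetectablePart Q G) (pauliSum_pauliCoeff G)).symm.trans ?_
    refine (Finset.sum_sub_distrib _ _).symm.trans (Finset.sum_congr rfl fun x _ => ?_)
    rw [← sub_smul, smul_smul, mul_sub]
  rw [hG, ← Matrix.mul_assoc, Matrix.mul_sum, Matrix.sum_mul, Finset.sum_smul]
  refine Finset.sum_congr rfl fun x _ => ?_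
  rw [Matrix.mul_smul, Matrix.smul_mul, hc, smul_smul]

/-- The state is the sum of a detectable part, which never fails, and an undetectable part. The
first can be dropped without leaving cross terms, and the failure probability of the second is at
most its squared norm. -/
theorem failProj_mul_heard_compareSyndrome_le (y : Bits s) {ψ : Bits m → ℂ}
    (hψ : star ψ ⬝ᵥ ψ = 1) (G : Fin d → Matrix (Bits n) (Bits n) ℂ)
    (att : (d' : ℕ) × Instrument Bool (Fin d) (Fin d') × (compareSyndrome D y).Attack d') :
    (failProj ψ * (compareSyndrome D y).heard att
      (proj (jointState ψ fun e => G e * syndromeProj Q.gen y))).trace.re ≤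
      nrm (jointState ψ fun e => undetectablePart Q (G e) * syndromeProj Q.gen y) := by
  have h : (jointState ψ fun e => G e * syndromeProj Q.gen y) =
      (jointState ψ fun e => (G e - undetectablePart Q (G e)) * syndromeProj Q.gen y) +
        jointState ψ fun e => undetectablePart Q (G e) * syndromeProj Q.gen y := by
    rw [← jointState_add]
    simp only [← Matrix.add_mul, sub_add_cancel]
  have hop := (compareSyndrome D y).isOperation_heard att
  rw [h, hop.trace_mul_proj_add (posSemidef_failProj hψ)
    (failProj_mul_heard_compareSyndrome D y hψ
      (fun e => syndromeProj_mul_detectablePart D y (G e)) att)]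
  have h2 := hop.trace_mul_proj_le (posSemidef_one_sub_failProj ψ)
    (jointState ψ fun e => undetectablePart Q (G e) * syndromeProj Q.gen y)
  rw [star_dotProduct_self] at h2
  exact (Complex.le_def.1 h2).1

theorem aliceSyndrome_branch (y : Bits s) (ψ : Bits m → ℂ)
    (G : Fin d → Matrix (Bits n) (Bits n) ℂ) :
    (aliceSyndrome Q m).branch (liftA (Fin d) (Bits n)) y (proj (jointState ψ G)) =
      proj (jointState ψ fun e => G e * (syndromeProj Q.gen y)ᴴ) := by
  rw [aliceSyndrome, Instrument.branch_ofKraus_proj, liftA_mulVec_jointState]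

/-- Alice's measurement, which multiplies by the projectors from the right, is complete. Summing the
bounds for the separate outcomes `y` thus costs nothing. -/
theorem sum_nrm_mul_syndromeProj (D : Decoder Q m) (ψ : Bits m → ℂ) (G : Fin d → Matrix (Bits n) (Bits n) ℂ) :
    ∑ y, nrm (jointState ψ fun e => G e * syndromeProj Q.gen y) = nrm (jointState ψ G) := by
  rw [← sum_nrm_mulVec _ (liftA_complete (E := Fin d) (B := Bits n) (aliceSyndrome Q m))]
  refine Finset.sum_congr rfl fun y _ => ?_
  change _ = ∑ _ : Unit, nrm (liftA (Fin d) (Bits n)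
    ((1 : Matrix (Bits m) (Bits m) ℂ) ⊗ₖ (syndromeProj Q.gen y).map star) *ᵥ jointState ψ G)
  rw [liftA_mulVec_jointState, D.syndromeProj_conjTranspose]
  simp

theorem failProj_mul_run_measureSyndrome_le {ψ : Bits m → ℂ}
    (hψ : star ψ ⬝ᵥ ψ = 1) (G : Fin d → Matrix (Bits n) (Bits n) ℂ)
    (att : (measureSyndrome D).Attack d) :
    (failProj ψ * (measureSyndrome D).run d att (proj (jointState ψ G))).trace.re ≤
      undetectableWeight Q G := by
  have h : (measureSyndrome D).run d att (proj (jointState ψ G)) =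
      ∑ y, heard (compareSyndrome D y) (att y)
        ((aliceSyndrome Q m).branch (liftA (Fin d) (Bits n)) y (proj (jointState ψ G))) := rfl
  have hψ' : nrm ψ = 1 := by
    rw [star_dotProduct_self] at hψ
    exact_mod_cast hψ
  rw [h, Matrix.mul_sum, trace_sum, Complex.re_sum, ← nrm_undetectablePart Q hψ',
    ← sum_nrm_mul_syndromeProj D]
  refine Finset.sum_le_sum fun y _ => ?_
  rw [aliceSyndrome_branch, D.syndromeProj_conjTranspose]
  exact failProj_mul_heard_compareSyndrome_le D y hψ G (att y)

theorem pauliCoeff_sum_smul {ι : Type} (t : Finset ι) (c : ι → ℂ)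
    (G : ι → Matrix (Bits n) (Bits n) ℂ) (x : PauliVec n) :
    pauliCoeff (∑ i ∈ t, c i • G i) x = ∑ i ∈ t, c i * pauliCoeff (G i) x := by
  simp only [pauliCoeff, mulVec, dotProduct, Matrix.sum_apply, Matrix.smul_apply, smul_eq_mul,
    Finset.mul_sum]
  rw [Finset.sum_comm]
  exact Finset.sum_congr rfl fun i _ => Finset.sum_congr rfl fun t _ => by ring

/-- For each fixed error `x`, the coefficients form a vector of the adversary's system, on which the
instrument acts by its own Kraus operators. Acting after the code is announced cannot move weight
from one error to another. -/
theorem sum_undetectableWeight_le {d' : ℕ} (Q : StabilizerCode n s)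
    (μ : Instrument Bool (Fin d) (Fin d')) (G : Fin d → Matrix (Bits n) (Bits n) ℂ) :
    ∑ j, undetectableWeight Q (fun e => ∑ e', μ.kraus true j e e' • G e') ≤
      undetectableWeight Q G := by
  simp only [undetectableWeight]
  rw [Finset.sum_comm]
  refine Finset.sum_le_sum fun x _ => ?_
  split_ifs
  · simp only [pauliCoeff_sum_smul]
    exact sum_nrm_mulVec_le μ.kraus μ.complete true fun e => pauliCoeff (G e) x
  · simp

theorem failProj_mul_heard_measureSyndrome_le {ψ : Bits m → ℂ}
    (hψ : star ψ ⬝ᵥ ψ = 1) (G : Fin d → Matrix (Bits n) (Bits n) ℂ)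
    (att : (d' : ℕ) × Instrument Bool (Fin d) (Fin d') × (measureSyndrome D).Attack d') :
    (failProj ψ * (measureSyndrome D).heard att (proj (jointState ψ G))).trace.re ≤
      undetectableWeight Q G := by
  rw [trace_failProj_mul_heard_proj, Complex.re_sum]
  refine le_trans (Finset.sum_le_sum fun j _ => ?_) (sum_undetectableWeight_le Q att.2.1 G)
  rw [liftE_mulVec_jointState]
  exact failProj_mul_run_measureSyndrome_le D hψ _ _

end Protocol

end Soundness

/-! ### Averaging over the codes, the transmission, and the honest run. -/

noncomputable section Security

open Matrix Kronecker ComplexOrder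

namespace Protocol

variable {m n s d : ℕ} {K : Type} [Fintype K] {Q : K → StabilizerCode n s}

theorem undetectableWeight_smul (Q : StabilizerCode n s) (c : ℂ)
    (G : Fin d → Matrix (Bits n) (Bits n) ℂ) :
    undetectableWeight Q (fun e => c • G e) = Complex.normSq c * undetectableWeight Q G := by
  have h : ∀ e x, pauliCoeff (c • G e) x = c * pauliCoeff (G e) x := by
    intro e x
    simpa using pauliCoeff_sum_smul {()} (fun _ => c) (fun _ => G e) x
  simp only [undetectableWeight, h, nrm, Complex.normSq_mul, Finset.mul_sum, mul_ite, mul_zero]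

/-- Double counting: by Parseval the squared norm is the sum of the weights of all errors, and after
exchanging the sums each error is counted once for every code that misses it. -/
theorem sum_undetectableWeight_code_le {ε : ℝ} (hε : IsPurityTestingCode Q ε) {ψ : Bits m → ℂ}
    (hψ : nrm ψ = 1) (G : Fin d → Matrix (Bits n) (Bits n) ℂ) :
    ∑ k, undetectableWeight (Q k) G ≤ Fintype.card K * (ε * nrm (jointState ψ G)) := by
  classical
  have h1 : nrm (jointState ψ G) = ∑ x, nrm fun e => pauliCoeff (G e) x := by
    rw [nrm_jointState hψ, Finset.sum_congr rfl fun e _ => (nrm_pauliCoeff (G e)).symm]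
    exact Finset.sum_comm
  rw [h1, Finset.mul_sum, Finset.mul_sum]
  simp only [undetectableWeight]
  rw [Finset.sum_comm]
  refine Finset.sum_le_sum fun x _ => ?_
  have h2 : (∑ k, if (Q k).Undetectable x then nrm fun e => pauliCoeff (G e) x else 0) =
      (Nat.card {k // (Q k).Undetectable x} : ℝ) * nrm fun e => pauliCoeff (G e) x := by
    rw [← Finset.sum_filter, Finset.sum_const, nsmul_eq_mul, Nat.card_eq_fintype_card,
      Fintype.card_subtype]
  rw [h2, ← mul_assoc]
  refine mul_le_mul_of_nonneg_right ?_ (nrm_nonneg _)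
  rw [mul_comm]
  -- The purity testing condition does not cover the trivial error, but that error lies in every
  -- code and so is never undetectable.
  by_cases hx : x = 0
  · subst hx
    have h3 : IsEmpty {k // (Q k).Undetectable 0} :=
      ⟨fun k => k.2.2 (Submodule.zero_mem _)⟩
    rw [Nat.card_of_isEmpty, Nat.cast_zero]
    exact mul_nonneg hε.1 (Nat.cast_nonneg _)
  · exact hε.2 x hx

variable [Nonempty K] (D : ∀ k, Decoder (Q k) m)

/-- The part of the protocol that follows Bob's acknowledgement. -/
def chooseCode : Protocol m (Bits m × Bits n) (Bits n) :=
  .aliceSays (chooseUniformly K (Bits m × Bits n)) fun k => measureSyndrome (D k)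

/-- The part of the protocol that follows the transmission of the pairs. -/
def acknowledgeAndChoose : Protocol m (Bits m × Bits n) (Unit × Bits n) :=
  .bobSays (acknowledge n) fun _ => chooseCode D

theorem chooseUniformly_branch (k : K) (ψ : Bits m → ℂ)
    (G : Fin d → Matrix (Bits n) (Bits n) ℂ) :
    (chooseUniformly K (Bits m × Bits n)).branch (liftA (Fin d) (Bits n)) k
        (proj (jointState ψ G)) =
      proj (jointState ψ fun e => ((1 / Real.sqrt (Fintype.card K) : ℝ) : ℂ) • G e) := by
  rw [chooseUniformly, Instrument.branch_ofKraus_proj, jointState_smul]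
  congr 1
  simp [liftA, smul_kronecker, kronecker_smul, smul_mulVec]

/-- The operators `G e` are the same for all codes, since the adversary sent them before the code
was chosen; this is where the average over the codes may be taken. The amplitude of each choice
squares to the probability `1 / card K`. -/
theorem failProj_mul_run_chooseCode_le {ε : ℝ} (hε : IsPurityTestingCode Q ε) {ψ : Bits m → ℂ}
    (hψ : star ψ ⬝ᵥ ψ = 1) (G : Fin d → Matrix (Bits n) (Bits n) ℂ)
    (att : (chooseCode D).Attack d) :
    (failProj ψ * (chooseCode D).run d att (proj (jointState ψ G))).trace.re ≤
      ε * nrm (jointState ψ G) := by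
  have hψ' : nrm ψ = 1 := by
    rw [star_dotProduct_self] at hψ
    exact_mod_cast hψ
  have h : (chooseCode D).run d att (proj (jointState ψ G)) =
      ∑ k, heard (measureSyndrome (D k)) (att k)
        ((chooseUniformly K (Bits m × Bits n)).branch (liftA (Fin d) (Bits n)) k
          (proj (jointState ψ G))) := rfl
  have hK : (0 : ℝ) < Fintype.card K := by exact_mod_cast Fintype.card_pos
  have hc : Complex.normSq ((1 / Real.sqrt (Fintype.card K) : ℝ) : ℂ) = 1 / Fintype.card K := by
    rw [Complex.normSq_ofReal, div_mul_div_comm, Real.mul_self_sqrt hK.le, one_mul]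
  rw [h, Matrix.mul_sum, trace_sum, Complex.re_sum]
  have h2 : ∑ k, undetectableWeight (Q k)
      (fun e => ((1 / Real.sqrt (Fintype.card K) : ℝ) : ℂ) • G e) ≤
        ε * nrm (jointState ψ G) := by
    simp only [undetectableWeight_smul, hc, ← Finset.mul_sum]
    have h3 := sum_undetectableWeight_code_le hε hψ' G
    rw [one_div_mul_eq_div, div_le_iff₀ hK]
    linarith
  refine le_trans (Finset.sum_le_sum fun k _ => ?_) h2
  rw [chooseUniformly_branch]
  exact failProj_mul_heard_measureSyndrome_le (D k) hψ _ (att k)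

theorem failProj_mul_heard_chooseCode_le {ε : ℝ} (hε : IsPurityTestingCode Q ε)
    {ψ : Bits m → ℂ} (hψ : star ψ ⬝ᵥ ψ = 1) (G : Fin d → Matrix (Bits n) (Bits n) ℂ)
    (att : (d' : ℕ) × Instrument Bool (Fin d) (Fin d') × (chooseCode D).Attack d') :
    (failProj ψ * (chooseCode D).heard att (proj (jointState ψ G))).trace.re ≤
      ε * nrm (jointState ψ G) := by
  have h := mul_le_mul_of_nonneg_left (sum_nrm_mulVec_le _ (liftE_complete
    (A := Bits m × Bits n) (B := Bits n) att.2.1) true (jointState ψ G)) hε.1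
  rw [Finset.mul_sum] at h
  rw [trace_failProj_mul_heard_proj, Complex.re_sum]
  refine le_trans (Finset.sum_le_sum fun j _ => ?_) h
  rw [liftE_mulVec_jointState]
  exact failProj_mul_run_chooseCode_le D hε hψ _ _

theorem acknowledge_branch (ψ : Bits m → ℂ) (G : Fin d → Matrix (Unit × Bits n) (Bits n) ℂ) :
    (acknowledge n).branch (liftB (Fin d) (Bits m × Bits n)) () (proj (jointState ψ G)) =
      proj (jointState ψ fun e => (G e).submatrix (Prod.mk ()) id) := by
  rw [acknowledge, Instrument.branch_ofKraus_proj, liftB_mulVec_jointState]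
  congr 2
  funext e
  ext i j
  simp [mul_apply, one_apply, Fintype.sum_prod_type]

theorem failProj_mul_run_acknowledgeAndChoose_le {ε : ℝ} (hε : IsPurityTestingCode Q ε)
    {ψ : Bits m → ℂ} (hψ : star ψ ⬝ᵥ ψ = 1) (G : Fin d → Matrix (Unit × Bits n) (Bits n) ℂ)
    (att : (acknowledgeAndChoose D).Attack d) :
    (failProj ψ * (acknowledgeAndChoose D).run d att (proj (jointState ψ G))).trace.re ≤
      ε * nrm (jointState ψ G) := by
  have h : (acknowledgeAndChoose D).run d att (proj (jointState ψ G)) =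
      ∑ u, heard (chooseCode D) (att u)
        ((acknowledge n).branch (liftB (Fin d) (Bits m × Bits n)) u
          (proj (jointState ψ G))) := rfl
  have hn : nrm (jointState ψ fun e => (G e).submatrix (Prod.mk ()) id) =
      nrm (jointState ψ G) := by
    simp only [nrm, jointState, Fintype.sum_prod_type, submatrix_apply, id, Fintype.sum_unique]
  rw [h, Fintype.sum_unique, ← hn]
  change (failProj ψ * heard (chooseCode D) (att ()) ((acknowledge n).branch _ () _)).trace.re ≤ _
  rw [acknowledge_branch]
  exact failProj_mul_heard_chooseCode_le D hε hψ _ (att ())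

/-- The state of the adversary, the message in transit, Alice and Bob after Alice sent the halves
of the pairs. -/
def sentState (ψ : Bits m → ℂ) : (Fin 1 × Bits n) × (Bits m × Bits n) × Unit → ℂ :=
  fun x => ψ x.2.1.1 * if x.2.1.2 = x.1.2 then ((1 / Real.sqrt (2 ^ n) : ℝ) : ℂ) else 0

theorem startState_eq (ψ : Bits m → ℂ) : startState ψ = proj fun x => ψ x.2.1 := by
  ext ⟨e, t, u⟩ ⟨e', t', u'⟩
  rw [Subsingleton.elim e' e]
  simp [startState, proj, vecMulVec_apply]

theorem prepareEPR_branch (ψ : Bits m → ℂ) :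
    ((prepareEPR m n).branch (liftA (Fin 1) Unit) () (startState ψ)).submatrix
      (fromAlice (Fin 1) (Bits m × Bits n) (Bits n) Unit)
      (fromAlice (Fin 1) (Bits m × Bits n) (Bits n) Unit) = proj (sentState ψ) := by
  rw [startState_eq, prepareEPR, Instrument.ofIsometry, Instrument.branch_ofKraus_proj,
    proj_submatrix]
  congr 1
  funext ⟨⟨e, b⟩, ⟨t, a⟩, u⟩
  simp [fromAlice, sentState, liftA, mulVec, dotProduct, Fintype.sum_prod_type,
    kroneckerMap_apply, eprMatrix, one_apply, ite_and, Subsingleton.elim e 0, mul_comm]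

/-- Acting on one half of maximally entangled pairs writes the Kraus operator itself into the state,
as in the Choi correspondence: `G e` is the block of `κ` for the adversary's final state `e`, up to
normalisation. -/
theorem liftE_mulVec_sentState (κ : Matrix (Fin d × Bits n) (Fin 1 × Bits n) ℂ)
    (ψ : Bits m → ℂ) :
    (liftE (Bits m × Bits n) Unit κ *ᵥ sentState ψ) ∘
        toBob (Fin d) (Bits m × Bits n) (Bits n) Unit =
      jointState ψ fun e => Matrix.of fun b a =>
        κ (e, b.2) (0, a) * ((1 / Real.sqrt (2 ^ n) : ℝ) : ℂ) := by
  funext ⟨e, ⟨t, a⟩, u, b⟩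
  simp only [Function.comp_apply, toBob, liftE, mulVec, dotProduct,
    Fintype.sum_prod_type (α₁ := Fin 1 × Bits n), kroneckerMap_apply, one_apply, mul_ite, ite_mul,
    mul_one, mul_zero, zero_mul, Finset.sum_ite_eq, Finset.mem_univ, if_true, jointState,
    of_apply]
  simp only [sentState, Fintype.sum_prod_type, Fintype.sum_unique, mul_ite, mul_zero,
    Finset.sum_ite_eq, Finset.mem_univ, if_true]
  change κ (e, b) (0, a) * _ = _
  ring

theorem nrm_sentState {ψ : Bits m → ℂ} (hψ : star ψ ⬝ᵥ ψ = 1) :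
    nrm (sentState (n := n) ψ) = 1 := by
  have hψ' : nrm ψ = 1 := by
    rw [star_dotProduct_self] at hψ
    exact_mod_cast hψ
  have hc : (2 : ℝ) ^ n * Complex.normSq ((1 / Real.sqrt (2 ^ n) : ℝ) : ℂ) = 1 := by
    rw [Complex.normSq_ofReal, div_mul_div_comm, Real.mul_self_sqrt (by positivity), one_mul,
      mul_one_div_cancel (by positivity)]
  simp only [nrm] at hψ' ⊢
  simp only [sentState, Complex.normSq_mul, Fintype.sum_prod_type, Fintype.sum_unique,
    apply_ite Complex.normSq, Complex.normSq_zero, mul_ite, mul_zero, Finset.sum_ite_eq',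
    Finset.mem_univ, if_true]
  rw [← Finset.sum_mul, hψ', one_mul, Finset.sum_const, nsmul_eq_mul, ← hc]
  simp

theorem run_purityProtocol (ψ : Bits m → ℂ) {d' : ℕ}
    (μ : Instrument Bool (Fin 1 × Bits n) (Fin d' × Bits n))
    (att : (acknowledgeAndChoose D).Attack d') :
    (purityProtocol Q D).run 1 ⟨d', μ, att⟩ (startState ψ) =
      (acknowledgeAndChoose D).run d' att
        (∑ j, proj ((liftE (Bits m × Bits n) Unit (μ.kraus true j) *ᵥ sentState ψ) ∘
          toBob (Fin d') (Bits m × Bits n) (Bits n) Unit)) +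
      jammed m (μ.branch (liftE (Bits m × Bits n) Unit) false
        (proj (sentState ψ))).trace := by
  have h : (purityProtocol Q D).run 1 ⟨d', μ, att⟩ (startState ψ) =
      (acknowledgeAndChoose D).run d' att
        ((μ.branch (liftE (Bits m × Bits n) Unit) true
          (((prepareEPR m n).branch (liftA (Fin 1) Unit) () (startState ψ)).submatrix
      (fromAlice (Fin 1) (Bits m × Bits n) (Bits n) Unit)
      (fromAlice (Fin 1) (Bits m × Bits n) (Bits n) Unit))).submatrix
          (toBob (Fin d') (Bits m × Bits n) (Bits n) Unit)
          (toBob (Fin d') (Bits m × Bits n) (Bits n) Unit)) +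
      jammed m (μ.branch (liftE (Bits m × Bits n) Unit) false
        (((prepareEPR m n).branch (liftA (Fin 1) Unit) () (startState ψ)).submatrix
      (fromAlice (Fin 1) (Bits m × Bits n) (Bits n) Unit)
      (fromAlice (Fin 1) (Bits m × Bits n) (Bits n) Unit))).trace := rfl
  rw [h, prepareEPR_branch, Instrument.branch_proj]
  congr 2
  ext i j
  simp only [submatrix_apply, Matrix.sum_apply]
  rfl

theorem failProj_mul_run_purityProtocol_le {ε : ℝ} (hε : IsPurityTestingCode Q ε)
    {ψ : Bits m → ℂ} (hψ : star ψ ⬝ᵥ ψ = 1) (att : (purityProtocol Q D).Attack 1) :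
    (failProj ψ * (purityProtocol Q D).run 1 att (startState ψ)).trace.re ≤ ε := by
  obtain ⟨d', μ, att⟩ := att
  change (acknowledgeAndChoose D).Attack d' at att
  refine le_of_eq_of_le (congrArg (fun ρ => (failProj ψ * ρ).trace.re)
    (run_purityProtocol D ψ μ att)) ?_
  rw [Matrix.mul_add, failProj_mul_jammed, add_zero,
    ((acknowledgeAndChoose D).isOperation_run _ _).trace_mul_sum, Complex.re_sum]
  have h1 : ∑ j, ε * nrm (liftE (Bits m × Bits n) Unit (μ.kraus true j) *ᵥ
      -- The delivered branches have total squared norm at most that of the sent state, which is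
      -- one.
      sentState ψ) ≤ ε := by
    rw [← Finset.mul_sum]
    have := sum_nrm_mulVec_le _ (liftE_complete (A := Bits m × Bits n) (B := Unit) μ) true
      (sentState ψ)
    rw [nrm_sentState hψ] at this
    exact mul_le_of_le_one_right hε.1 this
  refine le_trans (Finset.sum_le_sum fun j _ => ?_) h1
  have h2 := nrm_comp_equiv (liftE (Bits m × Bits n) Unit (μ.kraus true j) *ᵥ sentState ψ)
    ⟨toBob (Fin d') (Bits m × Bits n) (Bits n) Unit, fun x => (x.1.1, x.2.1, (x.2.2, x.1.2)),
      fun _ => rfl, fun _ => rfl⟩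
  rw [← h2]
  change _ ≤ ε * nrm ((liftE (Bits m × Bits n) Unit (μ.kraus true j) *ᵥ sentState ψ) ∘
    toBob (Fin d') (Bits m × Bits n) (Bits n) Unit)
  rw [liftE_mulVec_sentState]
  exact failProj_mul_run_acknowledgeAndChoose_le D hε hψ _ _

theorem soundness {ε : ℝ} (hε : IsPurityTestingCode Q ε)
    {ψ : Bits m → ℂ} (hψ : star ψ ⬝ᵥ ψ = 1) (att : (purityProtocol Q D).Attack 1) :
    1 - ε ≤ (passProj ψ * (purityProtocol Q D).run 1 att (startState ψ)).trace.re := by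
  have h1 : (startState ψ).trace = 1 := by
    rw [startState_eq, trace_proj, ← hψ]
    simp [dotProduct, Fintype.sum_prod_type]
  rw [passProj_eq, Matrix.sub_mul, Matrix.one_mul, trace_sub,
    ((purityProtocol Q D).isOperation_run 1 att).trace_eq, h1, Complex.sub_re, Complex.one_re]
  exact sub_le_sub_left (failProj_mul_run_purityProtocol_le D hε hψ att) 1

/-! ### The protocol without intervention -/

/-- In the honest run each stage is only shown to give some multiple of the ideal output; the
factors are never computed, since the trace determines their total at the end. -/
theorem passive_decodeAndTeleport {Q : StabilizerCode n s} (D : Decoder Q m) (y : Bits s)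
    (ψ : Bits m → ℂ) (c : Fin d → ℂ) :
    ∃ w : ℂ, (decodeAndTeleport D).run d ((decodeAndTeleport D).passive d)
      (proj (jointState ψ fun e => c e • syndromeProj Q.gen y)) = w • (proj ψ ⊗ₖ accProj) := by
  rw [run_decodeAndTeleport]
  have h : ∀ p, heard (.finish (correctAndAccept p)) ((decodeAndTeleport D).passive d p)
        (proj (teleported p ψ fun e => ((1 / Real.sqrt (2 ^ m) : ℝ) : ℂ) * c e)) = _ :=
    fun p => (heard_passive _ d _).trans (run_correctAndAccept p ψ _ _)
  exact ⟨_, (Finset.sum_congr rfl fun p _ => h p).trans (Finset.sum_smul).symm⟩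

theorem bobCompare_false_branch {Q : StabilizerCode n s} (D : Decoder Q m) (y : Bits s)
    (ψ : Bits m → ℂ) (c : Fin d → ℂ) :
    (bobCompare Q y).branch (liftB (Fin d) (Bits m × Bits n)) false
      (proj (jointState ψ fun e => c e • syndromeProj Q.gen y)) = 0 := by
  rw [Instrument.branch_proj]
  change ∑ y' : Bits s, proj (liftB (Fin d) (Bits m × Bits n)
    (if false = decide (y' = y) then syndromeProj Q.gen y' else 0) *ᵥ jointState ψ _) = _
  refine Finset.sum_eq_zero fun y' _ => ?_
  rw [liftB_mulVec_jointState]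
  have h : ∀ e, (if false = decide (y' = y) then syndromeProj Q.gen y' else 0) *
      (c e • syndromeProj Q.gen y) = 0 := by
    intro e
    by_cases h : y' = y
    -- When the outcomes agree, the Kraus operator of the disagreeing result is zero by definition;
    -- otherwise the two projectors are orthogonal.
    · simp [h]
    · simp [h, D.syndromeProj_mul]
  simp only [h, jointState_zero, proj_zero]

theorem passive_compareSyndrome {Q : StabilizerCode n s} (D : Decoder Q m) (y : Bits s)
    (ψ : Bits m → ℂ) (c : Fin d → ℂ) :
    ∃ w : ℂ, (compareSyndrome D y).run d ((compareSyndrome D y).passive d)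
      (proj (jointState ψ fun e => c e • syndromeProj Q.gen y)) = w • (proj ψ ⊗ₖ accProj) := by
  obtain ⟨w, hw⟩ := passive_decodeAndTeleport D y ψ c
  refine ⟨w, ?_⟩
  have h : (compareSyndrome D y).run d ((compareSyndrome D y).passive d)
      (proj (jointState ψ fun e => c e • syndromeProj Q.gen y)) =
      ∑ ok : Bool, heard (if ok then decodeAndTeleport D else .finish (reject n m))
        ⟨d, Instrument.idle _, passive _ d⟩
        ((bobCompare Q y).branch (liftB (Fin d) (Bits m × Bits n)) ok
          (proj (jointState ψ fun e => c e • syndromeProj Q.gen y))) := rfl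
  rw [h]
  simp only [heard_passive, Fintype.sum_bool, bobCompare_true_branch, Matrix.mul_smul,
    D.syndromeProj_mul, if_true, bobCompare_false_branch D]
  refine (congrArg₂ (· + ·) hw ?_).trans (add_zero _)
  change (finish (A := Bits m × Bits n) (reject n m)).run d _ 0 = 0
  ext x y
  simp [run, Instrument.branch]

theorem passive_measureSyndrome {Q : StabilizerCode n s} (D : Decoder Q m)
    (ψ : Bits m → ℂ) (c : Fin d → ℂ) :
    ∃ w : ℂ, (measureSyndrome D).run d ((measureSyndrome D).passive d)
      (proj (jointState ψ fun e => c e • 1)) = w • (proj ψ ⊗ₖ accProj) := by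
  choose w hw using fun y => passive_compareSyndrome D y ψ c
  refine ⟨∑ y, w y, ?_⟩
  have h : (measureSyndrome D).run d ((measureSyndrome D).passive d)
      (proj (jointState ψ fun e => c e • 1)) =
      ∑ y, heard (compareSyndrome D y) ⟨d, Instrument.idle _, passive _ d⟩
        ((aliceSyndrome Q m).branch (liftA (Fin d) (Bits n)) y
          (proj (jointState ψ fun e => c e • 1))) := rfl
  rw [h, Finset.sum_smul]
  refine Finset.sum_congr rfl fun y _ => ?_
  rw [heard_passive, aliceSyndrome_branch, D.syndromeProj_conjTranspose, ← hw]
  simp only [Matrix.smul_mul, Matrix.one_mul]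

theorem passive_chooseCode (ψ : Bits m → ℂ) (c : Fin d → ℂ) :
    ∃ w : ℂ, (chooseCode D).run d ((chooseCode D).passive d)
      (proj (jointState ψ fun e => c e • 1)) = w • (proj ψ ⊗ₖ accProj) := by
  choose w hw using fun k => passive_measureSyndrome (D k) ψ
    fun e => ((1 / Real.sqrt (Fintype.card K) : ℝ) : ℂ) * c e
  refine ⟨∑ k, w k, ?_⟩
  have h : (chooseCode D).run d ((chooseCode D).passive d)
      (proj (jointState ψ fun e => c e • 1)) =
      ∑ k, heard (measureSyndrome (D k)) ⟨d, Instrument.idle _, passive _ d⟩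
        ((chooseUniformly K (Bits m × Bits n)).branch (liftA (Fin d) (Bits n)) k
          (proj (jointState ψ fun e => c e • 1))) := rfl
  rw [h, Finset.sum_smul]
  refine Finset.sum_congr rfl fun k _ => ?_
  rw [heard_passive, chooseUniformly_branch, ← hw]
  simp only [smul_smul]

theorem passive_purityProtocol {ψ : Bits m → ℂ} (hψ : star ψ ⬝ᵥ ψ = 1) :
    (purityProtocol Q D).run 1 ((purityProtocol Q D).passive 1) (startState ψ) =
      proj ψ ⊗ₖ accProj := by
  obtain ⟨w, hw⟩ : ∃ w : ℂ, (purityProtocol Q D).run 1 ((purityProtocol Q D).passive 1)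
      (startState ψ) = w • (proj ψ ⊗ₖ accProj) := by
    obtain ⟨w, hw⟩ := passive_chooseCode D ψ
      fun _ : Fin 1 => ((1 / Real.sqrt (2 ^ n) : ℝ) : ℂ)
    refine ⟨w, ?_⟩
    refine (run_purityProtocol D ψ (Instrument.idle _) ((acknowledgeAndChoose D).passive 1)).trans ?_
    have h0 : jammed m (((Instrument.idle (Fin 1 × Bits n)).branch
        (liftE (Bits m × Bits n) Unit) false (proj (sentState ψ))).trace) = 0 := by
      have : (Instrument.idle (Fin 1 × Bits n)).branch
          (liftE (Bits m × Bits n) Unit) false (proj (sentState ψ)) = 0 := by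
        change ∑ _ : Unit, _ = _
        simp [Instrument.idle, Instrument.ofKraus, liftE]
      simp [this, jammed]
    refine (congrArg₂ (· + ·) ?_ h0).trans (add_zero _)
    change (acknowledgeAndChoose D).run 1 ((acknowledgeAndChoose D).passive 1)
      (∑ _ : Unit, proj ((liftE (Bits m × Bits n) Unit (if true then 1 else 0) *ᵥ
        sentState ψ) ∘ toBob (Fin 1) (Bits m × Bits n) (Bits n) Unit)) = _
    rw [Fintype.sum_unique, liftE_mulVec_sentState, ← hw]
    have h : ∀ ρ, (acknowledgeAndChoose D).run 1 ((acknowledgeAndChoose D).passive 1) ρ =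
        ∑ u : Unit, heard (chooseCode D) ⟨1, Instrument.idle _, passive _ 1⟩
        ((acknowledge n).branch (liftB (Fin 1) (Bits m × Bits n)) u ρ) := fun _ => rfl
    rw [h, Fintype.sum_unique, heard_passive]
    congr 1
    refine (acknowledge_branch ψ _).trans ?_
    congr 2
    funext e
    ext b a
    simp [one_apply, Subsingleton.elim e 0]
  have h1 : (startState ψ).trace = 1 := by
    rw [startState_eq, trace_proj, ← hψ]
    simp [dotProduct, Fintype.sum_prod_type]
  -- The initial state and the ideal output both have trace one, and the run preserves the trace, so
  -- `w = 1`.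
  have h2 := ((purityProtocol Q D).isOperation_run 1 _).trace_eq (startState ψ) ▸
    congrArg trace hw.symm
  rw [trace_smul, trace_kronecker, trace_proj, hψ, h1] at h2
  have h3 : w = 1 := by simpa [accProj] using h2
  rw [hw, h3, one_smul]

end Protocol

theorem isSecure_purityProtocol {n m s : ℕ} {K : Type} [Fintype K] [Nonempty K]
    {Q : K → StabilizerCode n s} (D : ∀ k, Decoder (Q k) m) {ε : ℝ}
    (hε : IsPurityTestingCode Q ε) : IsSecure (purityProtocol Q D) ε := fun _ hψ =>
  ⟨Protocol.passive_purityProtocol D hψ, fun att => Protocol.soundness D hε hψ att⟩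

end Security

/-! ### Purity testing codes from normal rational curves. -/

noncomputable section NormalRationalCurves

open Matrix Polynomial

theorem eq_zero_of_forall_symp_eq_zero {n : ℕ} {x : PauliVec n} (h : ∀ y, symp y x = 0) :
    x = 0 := by
  refine Prod.ext (funext fun i => ?_) (funext fun i => ?_)
  · simpa [symp] using h (0, Pi.single i 1)
  · simpa [symp] using h (Pi.single i 1, 0)

namespace CurveData

variable {r s : ℕ} (d : CurveData r s)

theorem card_L : Fintype.card d.L = 2 ^ s := by
  rw [Fintype.card_congr d.basisL.equivFun.toEquiv]
  simp

/-- The vectors all of whose multiples commute with the error `x`. -/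
def commutant (x : PauliVec (r * s)) : Submodule d.L d.F where
  carrier := {v | ∀ l : d.L, symp (d.φ (l • v)) x = 0}
  add_mem' := by
    intro v w hv hw l
    rw [smul_add, map_add, symp_add_left, hv, hw, add_zero]
  zero_mem' := by
    intro l
    simp [symp]
  smul_mem' := by
    intro c v hv l
    rw [smul_smul]
    exact hv _

/-- The code of a point consists of all `L`-multiples of that point, so commuting with the code is a
condition on the point that is linear over `L`. -/
theorem point_mem_commutant (hr : 0 < r) {x : PauliVec (r * s)} {k : Option d.L}
    (h : (d.code hr k).Undetectable x) : d.point k ∈ d.commutant x := by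
  intro l
  refine h.1 _ ?_
  rw [← d.basisL.sum_repr l, Finset.sum_smul, map_sum]
  refine Submodule.sum_mem _ fun j _ => ?_
  rw [smul_assoc, map_smul]
  exact Submodule.smul_mem _ _ (Submodule.subset_span ⟨j, rfl⟩)

/-- Otherwise `x` would be orthogonal to everything, against the nondegeneracy of the symplectic
form. -/
theorem commutant_lt_top {x : PauliVec (r * s)} (hx : x ≠ 0) : d.commutant x < ⊤ := by
  refine lt_top_iff_ne_top.2 fun h => hx (eq_zero_of_forall_symp_eq_zero fun y => ?_)
  have h1 : d.φ.symm y ∈ d.commutant x := h ▸ Submodule.mem_top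
  simpa using h1 1

/-- A hyperplane contains at most `2r - 1` points `[1 : y : ⋯]` of the normal rational curve. -/
theorem card_points_le (hr : 0 < r) {W : Submodule d.L d.F} (hW : W < ⊤) :
    Nat.card {y : d.L // d.point (some y) ∈ W} ≤ 2 * r - 1 := by
  classical
  obtain ⟨f, hf, hfW⟩ := Submodule.exists_le_ker_of_lt_top W hW
  -- The value of `f` at the point with parameter `y` is `P(y)`, and the coefficients of `P` are the
  -- values of `f` on the basis, so `P ≠ 0`.
  let P : d.L[X] := ∑ i : Fin (2 * r), C (f (d.basisF i)) * X ^ (i : ℕ)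
  have hdeg : P.natDegree ≤ 2 * r - 1 := by
    refine natDegree_sum_le_of_forall_le _ _ fun i _ => ?_
    exact (natDegree_C_mul_X_pow_le _ _).trans (by omega)
  have hP : P ≠ 0 := by
    intro h
    refine hf (d.basisF.ext fun i => ?_)
    have h1 := congrArg (fun p : d.L[X] => p.coeff (i : ℕ)) h
    simpa [P, finsetSum_coeff, coeff_C_mul, coeff_X_pow, Fin.val_inj] using h1
  have hroot : ∀ y : {y : d.L // d.point (some y) ∈ W}, (y : d.L) ∈ P.roots.toFinset := by
    intro y
    have h1 := hfW y.2
    rw [LinearMap.mem_ker, point, map_sum] at h1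
    rw [Multiset.mem_toFinset, mem_roots hP, IsRoot.def, eval_finsetSum, ← h1]
    exact Finset.sum_congr rfl fun i _ => by
      rw [eval_mul, eval_C, eval_pow, eval_X, map_smul, smul_eq_mul, mul_comm]
  calc Nat.card {y : d.L // d.point (some y) ∈ W}
      ≤ Nat.card P.roots.toFinset :=
        Nat.card_le_card_of_injective (fun y => ⟨y, hroot y⟩) fun a b h => by
          simpa [Subtype.ext_iff] using h
    _ = P.roots.toFinset.card := by rw [Nat.card_eq_fintype_card, Fintype.card_coe]
    _ ≤ P.roots.card := P.roots.toFinset_card_le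
    _ ≤ P.natDegree := P.card_roots'
    _ ≤ _ := hdeg

theorem card_undetectable_le (hr : 0 < r) {x : PauliVec (r * s)} (hx : x ≠ 0) :
    Nat.card {k // (d.code hr k).Undetectable x} ≤ 2 * r := by
  classical
  have h1 := d.card_points_le hr (d.commutant_lt_top hx)
  have h2 : Nat.card {k // (d.code hr k).Undetectable x} ≤
      -- The extra element of `Option` allows for the point at infinity, which raises the bound from
      -- `2r - 1` to `2r`.
      Nat.card (Option {y : d.L // d.point (some y) ∈ d.commutant x}) := by
    refine Nat.card_le_card_of_injective (fun k => match k with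
      | ⟨none, _⟩ => none
      | ⟨some y, hy⟩ => some ⟨y, d.point_mem_commutant hr hy⟩) ?_
    rintro ⟨_ | y, hy⟩ ⟨_ | y', hy'⟩ h <;> simp_all
  rw [Nat.card_eq_fintype_card (α := Option _), Fintype.card_option,
    ← Nat.card_eq_fintype_card] at h2
  omega

theorem isPurityTestingCode (hr : 0 < r) :
    IsPurityTestingCode (d.code hr) (2 * r / (2 ^ s + 1)) := by
  refine ⟨by positivity, fun x hx => ?_⟩
  rw [Fintype.card_option, d.card_L]
  push_cast
  rw [div_mul_cancel₀ _ (by positivity)]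
  exact_mod_cast d.card_undetectable_le hr hx

end CurveData

theorem IsSecure.mono {m : ℕ} {p : Protocol m (Bits m) Unit} {ε ε' : ℝ} (h : IsSecure p ε)
    (hε : ε ≤ ε') : IsSecure p ε' := fun ψ hψ =>
  ⟨(h ψ hψ).1, fun att => (sub_le_sub_left hε 1).trans ((h ψ hψ).2 att)⟩

/-- With `n = rs` the exponent `n / r` is `s`, and `2^s ≤ 2^s + 1`. -/
theorem curve_error_le {r : ℕ} (s : ℕ) (hr : 0 < r) :
    (2 * r / (2 ^ s + 1) : ℝ) ≤ 2 * r * (2 : ℝ) ^ (-((r * s : ℕ) / r : ℝ)) := by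
  have hr' : (r : ℝ) ≠ 0 := by exact_mod_cast hr.ne'
  have h : (((r * s : ℕ) : ℝ) / r) = s := by
    rw [Nat.cast_mul]
    field_simp
  rw [h, Real.rpow_neg zero_le_two, Real.rpow_natCast, div_eq_mul_inv]
  gcongr
  linarith

end NormalRationalCurves

/-! ### Existence of the field data and of the symplectic identification. -/

noncomputable section SymplecticBasis

open Matrix Module

theorem symp_cons {n : ℕ} (a b a' b' : ZMod 2) (x y : PauliVec n) :
    symp ((Fin.cons a x.1, Fin.cons b x.2) : PauliVec (n + 1)) (Fin.cons a' y.1, Fin.cons b' y.2) =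
      a' * b - a * b' + symp x y := by
  simp only [symp, dotProduct, Fin.sum_univ_succ, Fin.cons_zero, Fin.cons_succ]
  ring

/-- Every alternating form over `GF(2)` is a pullback of a standard symplectic form. -/
theorem exists_linearMap_symp_eq (n : ℕ) : ∀ (V : Type) [AddCommGroup V] [Module (ZMod 2) V]
    [FiniteDimensional (ZMod 2) V] (B : V →ₗ[ZMod 2] V →ₗ[ZMod 2] ZMod 2),
    (∀ x, B x x = 0) → finrank (ZMod 2) V ≤ 2 * n + 1 →
    ∃ e : V →ₗ[ZMod 2] PauliVec n, ∀ x y, B x y = symp (e x) (e y) := by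
  induction n with
  | zero =>
    intro V _ _ _ B hB hV
    refine ⟨0, fun x y => ?_⟩
    by_contra h
    have hxy : B x y ≠ 0 := by simpa [symp] using h
    -- In dimension at most one an alternating form vanishes: a pair with `B x y ≠ 0` would be
    -- independent. Alternating forms have even rank, which is why the bound on the dimension can be
    -- `2 * n + 1`; allowing degenerate forms spares the induction from carrying nondegeneracy to
    -- the complement.
    have hli : LinearIndependent (ZMod 2) ![x, y] := by
      refine LinearIndependent.pair_iff.2 fun s t hst => ?_
      have h1 := congrArg (fun z => B z y) hst
      have h2 := congrArg (fun z => B x z) hst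
      simp only [map_add, map_smul, LinearMap.add_apply, LinearMap.smul_apply, hB, smul_eq_mul,
        mul_zero, add_zero, zero_add, map_zero, LinearMap.zero_apply, mul_eq_zero, hxy,
        or_false] at h1 h2
      exact ⟨h1, h2⟩
    have := hli.fintype_card_le_finrank
    simp at this
    omega
  | succ n ih =>
    intro V _ _ _ B hB hV
    by_cases h0 : ∀ x y, B x y = 0
    · exact ⟨0, fun x y => by simp [h0, symp]⟩
    push Not at h0
    obtain ⟨v, w, hvw⟩ := h0
    replace hvw : B v w = 1 := (zmod_two_eq _).resolve_left hvw
    have hsymm : ∀ x y, B x y = B y x := by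
      intro x y
      have h := hB (x + y)
      simp only [map_add, LinearMap.add_apply, hB, zero_add, add_zero] at h
      exact (CharTwo.add_eq_zero.1 h).symm
    have hwv : B w v = 1 := by rw [hsymm, hvw]
    -- The kernel of `q` is the orthogonal complement of the hyperbolic pair `v, w`, of codimension
    -- two. Below, `P` is the projection onto it along the pair, and the pair supplies one new
    -- coordinate in each half.
    let q : V →ₗ[ZMod 2] ZMod 2 × ZMod 2 := (B v).prod (B w)
    have hq : Function.Surjective q := by
      rintro ⟨a, b⟩
      exact ⟨a • w + b • v, by simp [q, hvw, hwv, hB]⟩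
    have hW : finrank (ZMod 2) (LinearMap.ker q) ≤ 2 * n + 1 := by
      have h1 := LinearMap.finrank_range_add_finrank_ker q
      rw [LinearMap.range_eq_top.2 hq, finrank_top] at h1
      simp at h1
      omega
    obtain ⟨e, he⟩ := ih (LinearMap.ker q) (B.domRestrict₁₂ _ _)
      (fun x => hB x) hW
    let P : V →ₗ[ZMod 2] LinearMap.ker q := LinearMap.codRestrict _
      (LinearMap.id - (B.flip w).smulRight v - (B.flip v).smulRight w) (fun x => by
        simp [q, hvw, hwv, hB, hsymm x])
    have hP : ∀ x, (P x : V) = x - B x w • v - B x v • w := fun x => rfl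
    let a : V →ₗ[ZMod 2] Bits (n + 1) := LinearMap.pi
      (Fin.cons (B.flip w) fun i => LinearMap.proj i ∘ₗ LinearMap.fst _ _ _ ∘ₗ e ∘ₗ P)
    let b : V →ₗ[ZMod 2] Bits (n + 1) := LinearMap.pi
      (Fin.cons (B.flip v) fun i => LinearMap.proj i ∘ₗ LinearMap.snd _ _ _ ∘ₗ e ∘ₗ P)
    have hab : ∀ x, (a.prod b) x =
        (Fin.cons (B x w) (e (P x)).1, Fin.cons (B x v) (e (P x)).2) := by
      intro x
      refine Prod.ext (funext fun i => ?_) (funext fun i => ?_) <;>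
        refine Fin.cases ?_ (fun i => ?_) i <;> simp [a, b]
    refine ⟨a.prod b, fun x y => ?_⟩
    rw [hab, hab, symp_cons, ← he]
    simp only [LinearMap.domRestrict₁₂_apply, hP, map_sub, map_smul, LinearMap.sub_apply,
      LinearMap.smul_apply, smul_eq_mul, hvw, hwv, hB, hsymm v y, hsymm w y]
    have h2 : (2 : ZMod 2) = 0 := rfl
    linear_combination (B x w * B y v) * h2

theorem exists_linearEquiv_symp_eq {n : ℕ} {V : Type} [AddCommGroup V] [Module (ZMod 2) V]
    [FiniteDimensional (ZMod 2) V] (B : V →ₗ[ZMod 2] V →ₗ[ZMod 2] ZMod 2)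
    (hB : ∀ x, B x x = 0) (hB' : ∀ x, (∀ y, B x y = 0) → x = 0)
    (hV : finrank (ZMod 2) V = 2 * n) :
    ∃ e : V ≃ₗ[ZMod 2] PauliVec n, ∀ x y, B x y = symp (e x) (e y) := by
  obtain ⟨e, he⟩ := exists_linearMap_symp_eq n V B hB (by omega)
  have hinj : Function.Injective e := by
    refine (injective_iff_map_eq_zero e).2 fun x hx => hB' x fun y => ?_
    rw [he, hx]
    simp [symp]
  exact ⟨LinearMap.linearEquivOfInjective e hinj (by simp [hV, two_mul]), he⟩

/-- The map `y ↦ y^(2^k)` on a field of characteristic two. -/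
def frobeniusPow (F : Type) [Field F] [Algebra (ZMod 2) F] (k : ℕ) : F →ₗ[ZMod 2] F where
  toFun y := y ^ 2 ^ k
  map_add' x y := by
    have : CharP F 2 := charP_of_injective_algebraMap (algebraMap (ZMod 2) F).injective 2
    exact add_pow_char_pow x y 2 k
  map_smul' c y := by
    rcases zmod_two_eq c with rfl | rfl <;> simp

/-- The form `Tr (x y^(2^k))` on a finite field of characteristic two. -/
def traceFrobeniusForm (F : Type) [Field F] [Algebra (ZMod 2) F] (k : ℕ) :
    F →ₗ[ZMod 2] F →ₗ[ZMod 2] ZMod 2 :=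
  LinearMap.compl₂ (Algebra.traceForm (ZMod 2) F) (frobeniusPow F k)

theorem traceFrobeniusForm_apply (F : Type) [Field F] [Algebra (ZMod 2) F] (k : ℕ) (x y : F) :
    traceFrobeniusForm F k x y = Algebra.trace (ZMod 2) F (x * y ^ 2 ^ k) := rfl

theorem pow_two_pow_finrank (F : Type) [Field F] [Finite F] [Algebra (ZMod 2) F] (x : F) :
    x ^ 2 ^ finrank (ZMod 2) F = x := by
  have := Fintype.ofFinite F
  have h : Fintype.card F = 2 ^ finrank (ZMod 2) F := by
    rw [Module.card_eq_pow_finrank (K := ZMod 2), ZMod.card]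
  rw [← h, FiniteField.pow_card]

theorem algebraMap_traceFrobeniusForm (F : Type) [Field F] [Finite F] [Algebra (ZMod 2) F]
    (k : ℕ) (x y : F) : algebraMap (ZMod 2) F (traceFrobeniusForm F k x y) =
      ∑ i ∈ Finset.range (finrank (ZMod 2) F), (x * y ^ 2 ^ k) ^ 2 ^ i := by
  rw [traceFrobeniusForm_apply, FiniteField.algebraMap_trace_eq_sum_pow, Nat.card_zmod]

/-- The element `x * x^(2^k)` is fixed by the `k`-th power of Frobenius, where `k` is half the
degree, so the two halves of its trace coincide and cancel in characteristic two. -/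
theorem traceFrobeniusForm_self {F : Type} [Field F] [Finite F] [Algebra (ZMod 2) F]
    {k : ℕ} (hk : finrank (ZMod 2) F = 2 * k) (x : F) : traceFrobeniusForm F k x x = 0 := by
  have : CharP F 2 := charP_of_injective_algebraMap (algebraMap (ZMod 2) F).injective 2
  have hx := pow_two_pow_finrank F x
  apply (algebraMap (ZMod 2) F).injective
  rw [algebraMap_traceFrobeniusForm, map_zero, hk, two_mul, Finset.sum_range_add]
  have hz : (x * x ^ 2 ^ k) ^ 2 ^ k = x * x ^ 2 ^ k := by
    rw [hk, two_mul, pow_add, pow_mul] at hx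
    rw [mul_pow, hx, mul_comm]
  simp only [pow_add, pow_mul _ (2 ^ k), hz]
  exact CharTwo.add_self_eq_zero _

theorem eq_zero_of_traceFrobeniusForm {F : Type} [Field F] [Finite F] [Algebra (ZMod 2) F]
    {k : ℕ} (hk : finrank (ZMod 2) F = 2 * k) (x : F)
    (hx : ∀ y, traceFrobeniusForm F k x y = 0) : x = 0 := by
  refine (traceForm_nondegenerate (ZMod 2) F).1 x fun z => ?_
  -- Applying the `k`-th power of Frobenius twice is the identity, so this choice of `y` reduces the
  -- claim to nondegeneracy of the trace form.
  have h := hx (z ^ 2 ^ k)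
  have hz := pow_two_pow_finrank F z
  rw [hk, two_mul, pow_add, pow_mul] at hz
  rwa [traceFrobeniusForm_apply, hz] at h

/-- `GF(2^s)` embeds into `GF(2^(2rs))` because `s` divides `2rs`. The identification `φ` is a
symplectic basis for the Frobenius-twisted trace form. -/
theorem nonempty_curveData {r s : ℕ} (hr : 0 < r) (hs : 0 < s) : Nonempty (CurveData r s) := by
  have hF : finrank (ZMod 2) (GaloisField 2 (2 * r * s)) = 2 * r * s :=
    GaloisField.finrank 2 (by positivity)
  have hL : finrank (ZMod 2) (GaloisField 2 s) = s := GaloisField.finrank 2 hs.ne'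
  obtain ⟨f⟩ : Nonempty (GaloisField 2 s →ₐ[ZMod 2] GaloisField 2 (2 * r * s)) :=
    FiniteField.nonempty_algHom_of_finrank_dvd (by rw [hF, hL]; exact dvd_mul_left _ _)
  let : Algebra (GaloisField 2 s) (GaloisField 2 (2 * r * s)) := f.toRingHom.toAlgebra
  have tower : IsScalarTower (ZMod 2) (GaloisField 2 s) (GaloisField 2 (2 * r * s)) :=
    IsScalarTower.of_algebraMap_eq fun x => (f.commutes x).symm
  have hLF : finrank (GaloisField 2 s) (GaloisField 2 (2 * r * s)) = 2 * r := by
    have h := finrank_mul_finrank (ZMod 2) (GaloisField 2 s) (GaloisField 2 (2 * r * s))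
    rw [hF, hL, mul_comm] at h
    exact Nat.eq_of_mul_eq_mul_right hs h
  have hF' : finrank (ZMod 2) (GaloisField 2 (2 * r * s)) = 2 * (r * s) := by rw [hF, mul_assoc]
  obtain ⟨φ, hφ⟩ := exists_linearEquiv_symp_eq (n := r * s)
    (traceFrobeniusForm (GaloisField 2 (2 * r * s)) (r * s)) (traceFrobeniusForm_self hF')
    (eq_zero_of_traceFrobeniusForm hF') hF'
  exact ⟨{
    L := GaloisField 2 s
    F := GaloisField 2 (2 * r * s)
    fintypeL := Fintype.ofFinite _
    basisL := finBasisOfFinrankEq _ _ hL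
    basisF := finBasisOfFinrankEq _ _ hLF
    φ := φ
    symplectic := fun x y => by rw [← hφ, algebraMap_traceFrobeniusForm, hF] }⟩

end SymplecticBasis

/-! ### The elementary gates as Clifford operators. -/

noncomputable section CliffordCircuits

open Matrix

variable {n : ℕ}

/-! ### The action of the gates on Pauli operators -/

/-- The action of a gate on Pauli operators, up to phase. -/
def Gate.act : Gate n → PauliVec n → PauliVec n
  | X _, x => x
  | H i, x => (x.1 + Pi.single i (x.1 i + x.2 i), x.2 + Pi.single i (x.1 i + x.2 i))
  | S i, x => (x.1, x.2 + Pi.single i (x.1 i))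
  | CNOT i j _, x => (x.1 + Pi.single j (x.1 i), x.2 + Pi.single i (x.2 j))

theorem Gate.act_add (g : Gate n) (x y : PauliVec n) : g.act (x + y) = g.act x + g.act y := by
  cases g <;> simp only [act, Prod.fst_add, Prod.snd_add, Pi.add_apply, Prod.mk_add_mk,
    Pi.single_add] <;> ext k <;> simp <;> ring

theorem Gate.act_act (g : Gate n) (x : PauliVec n) : g.act (g.act x) = x := by
  have h2 : ∀ a b : ZMod 2, a + (b + b) = a := fun a b => by
    rw [CharTwo.add_self_eq_zero, add_zero]
  cases g with
  | X i => rfl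
  -- Adding the sum of two bits to each of them exchanges them, which is how the Hadamard gate swaps
  -- `X` and `Z`.
  | H i =>
    have h : ∀ a b : ZMod 2, a + (a + b) + (b + (a + b)) = a + b := by decide
    simp only [act, Pi.add_apply, Pi.single_eq_same, h, add_assoc, bits_add_self, add_zero]
  | S i => simp only [act, add_assoc, bits_add_self, add_zero]
  | CNOT i j hij =>
    simp only [act, Pi.add_apply, Pi.single_eq_of_ne hij, Pi.single_eq_of_ne hij.symm, add_zero,
      add_assoc, bits_add_self]

theorem Gate.symp_act (g : Gate n) (x y : PauliVec n) : symp (g.act x) (g.act y) = symp x y := by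
  cases g with
  | X i => rfl
  | H i =>
    simp only [act, symp, add_dotProduct, dotProduct_add, single_dotProduct, dotProduct_single,
      Pi.add_apply, Pi.single_eq_same]
    generalize y.1 ⬝ᵥ x.2 = u, x.1 ⬝ᵥ y.2 = v, x.1 i = a, x.2 i = b, y.1 i = c, y.2 i = d
    revert u v a b c d
    decide
  | S i =>
    simp only [act, symp, dotProduct_add, dotProduct_single]
    ring
  | CNOT i j hij =>
    simp only [act, symp, add_dotProduct, dotProduct_add, single_dotProduct, dotProduct_single,
      Pi.add_apply, Pi.single_eq_of_ne hij, add_zero]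
    generalize y.1 ⬝ᵥ x.2 = u, x.1 ⬝ᵥ y.2 = v, x.1 i = a, x.2 j = b, y.1 i = c, y.2 j = d
    revert u v a b c d
    decide

/-- The gate carries the operator `X^a Z^b` to its image under the action, up to phase. -/
theorem Gate.exists_mul_xz (g : Gate n) (x : PauliVec n) :
    ∃ c : ℂ, g.matrix * xz x = c • (xz (g.act x) * g.matrix) := by
  have hmul : ∀ (M : Matrix (Bits n) (Bits n) ℂ) u t,
      (M * xz x) u t = M u (t + x.1) * sgn (x.2 ⬝ᵥ t) := by
    intro M u t
    rw [mul_apply, Finset.sum_eq_single (t + x.1)]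
    · simp [xz]
    · intro b _ hb
      simp [xz, hb]
    · simp
  have hmul' : ∀ (y : PauliVec n) (M : Matrix (Bits n) (Bits n) ℂ) u t,
      (xz y * M) u t = sgn (y.2 ⬝ᵥ (u + y.1)) * M (u + y.1) t := by
    intro y M u t
    rw [mul_apply, Finset.sum_eq_single (u + y.1)]
    · simp [xz, add_assoc, bits_add_self]
    · intro b _ hb
      have : ¬ u = b + y.1 := fun e => hb ((bits_eq_add _ _ _).1 e)
      simp [xz, this]
    · simp
  cases g with
  | X i =>
    refine ⟨sgn (x.2 i), ?_⟩
    ext u t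
    rw [Matrix.smul_apply, hmul, hmul', smul_eq_mul]
    change (if u = t + x.1 + Pi.single i 1 then (1 : ℂ) else 0) * sgn (x.2 ⬝ᵥ t) =
      sgn (x.2 i) * (sgn (x.2 ⬝ᵥ (u + x.1)) * if u + x.1 = t + Pi.single i 1 then 1 else 0)
    by_cases h : u = t + x.1 + Pi.single i 1
    · have h' : u + x.1 = t + Pi.single i 1 := by
        rw [h, add_right_comm, add_assoc t, bits_add_self, add_zero]
      rw [if_pos h, if_pos h', h', dotProduct_add, sgn_add, dotProduct_single, mul_one, mul_one]
      have := sgn_mul_self (x.2 i)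
      linear_combination (-sgn (x.2 ⬝ᵥ t)) * this
    · have h' : ¬ u + x.1 = t + Pi.single i 1 := fun e => h (by
        rw [(bits_eq_add (t + Pi.single i 1) u x.1).1 e.symm, add_right_comm])
      rw [if_neg h, if_neg h']
      ring
  | S i =>
    refine ⟨Complex.I ^ (x.1 i).val, ?_⟩
    ext u t
    rw [Matrix.smul_apply, hmul, hmul', smul_eq_mul]
    simp only [matrix, act, diagonal_apply]
    by_cases h : u = t + x.1
    · have h' : u + x.1 = t := by rw [h, add_assoc, bits_add_self, add_zero]
      rw [if_pos h, if_pos h', h', h, add_dotProduct, single_dotProduct, sgn_add, Pi.add_apply]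
      have key : ∀ a b : ZMod 2, Complex.I ^ (a + b).val =
          Complex.I ^ b.val * Complex.I ^ a.val * sgn (b * a) := by
        intro a b
        rcases zmod_two_eq a with rfl | rfl <;> rcases zmod_two_eq b with rfl | rfl <;>
          simp [sgn, ZMod.val_one, show (1 : ZMod 2) + 1 = 0 from rfl]
      rw [key]
      ring
    · have h' : ¬ u + x.1 = t := fun e => h ((bits_eq_add _ _ _).1 e.symm)
      rw [if_neg h, if_neg h']
      ring
  | CNOT i j hij =>
    refine ⟨1, ?_⟩
    ext u t
    rw [one_smul, hmul, hmul']
    change (if u = t + x.1 + Pi.single j (t i + x.1 i) then (1 : ℂ) else 0) * sgn (x.2 ⬝ᵥ t) =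
      sgn ((x.2 + Pi.single i (x.2 j)) ⬝ᵥ (u + (x.1 + Pi.single j (x.1 i)))) *
        if u + (x.1 + Pi.single j (x.1 i)) = t + Pi.single j (t i) then 1 else 0
    have h1 : (u = t + x.1 + Pi.single j (t i + x.1 i)) ↔
        (u + (x.1 + Pi.single j (x.1 i)) = t + Pi.single j (t i)) := by
      rw [Pi.single_add]
      generalize x.1 = a, (Pi.single j (t i) : Bits n) = p, (Pi.single j (x.1 i) : Bits n) = q
      constructor <;>
      · intro h
        funext k
        have hk := congrFun h k
        simp only [Pi.add_apply] at hk ⊢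
        generalize u k = u, t k = t, a k = a, p k = p, q k = q at hk ⊢
        revert u t a p q
        decide
    simp only [h1]
    by_cases h : u + (x.1 + Pi.single j (x.1 i)) = t + Pi.single j (t i)
    · rw [if_pos h, h]
      simp only [add_dotProduct, dotProduct_add, single_dotProduct, dotProduct_single,
        Pi.add_apply, Pi.single_eq_of_ne hij.symm, add_zero, sgn_add, one_mul, mul_one]
      rw [mul_assoc, sgn_mul_self, mul_one]
    · rw [if_neg h]
      ring
  | H i =>
    -- Exchanging `X` and `Z` on qubit `i` reverses their order, and restoring the order costs a
    -- sign when both are present.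
    refine ⟨sgn (x.1 i * x.2 i), ?_⟩
    ext u t
    rw [Matrix.smul_apply, hmul, hmul', smul_eq_mul]
    simp only [matrix, act, Pi.add_apply, Pi.single_eq_same]
    by_cases h : ∀ j, j ≠ i → u j = t j + x.1 j
    · have h' : ∀ j, j ≠ i →
          u j + (x.1 j + (Pi.single i (x.1 i + x.2 i) : Bits n) j) = t j := by
        intro j hj
        rw [h j hj, Pi.single_eq_of_ne hj, add_zero, add_assoc, CharTwo.add_self_eq_zero, add_zero]
      have hu : u + (x.1 + Pi.single i (x.1 i + x.2 i)) =
          t + Pi.single i (t i + u i + x.2 i) := by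
        funext j
        by_cases hj : j = i
        · subst hj
          simp only [Pi.add_apply, Pi.single_eq_same]
          generalize u j = a, x.1 j = b, x.2 j = c, t j = d
          revert a b c d
          decide
        · simpa [Pi.single_eq_of_ne hj] using h' j hj
      rw [if_pos h, if_pos h', hu]
      simp only [dotProduct_add, add_dotProduct, single_dotProduct, dotProduct_single,
        Pi.add_apply, Pi.single_eq_same]
      -- The two sides are products of signs, so only the exponents modulo two matter; the
      -- comparison involves five bits.
      have key : u i * (t i + x.1 i) + x.2 ⬝ᵥ t =
          x.1 i * x.2 i + (x.2 ⬝ᵥ t + (x.1 i + x.2 i) * t i +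
            (x.2 i + (x.1 i + x.2 i)) * (t i + u i + x.2 i) +
              (u i + (x.1 i + (x.1 i + x.2 i))) * t i) := by
        generalize u i = a, x.1 i = b, x.2 i = c, t i = d, x.2 ⬝ᵥ t = e
        revert a b c d e
        decide
      rw [mul_assoc, ← sgn_add, key]
      simp only [sgn_add]
      ring
    · have h' : ¬ ∀ j, j ≠ i →
          u j + (x.1 j + (Pi.single i (x.1 i + x.2 i) : Bits n) j) = t j := by
        intro h'
        refine h fun j hj => ?_
        rw [← h' j hj, Pi.single_eq_of_ne hj, add_zero, add_assoc, CharTwo.add_self_eq_zero,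
          add_zero]
      rw [if_neg h, if_neg h']
      ring

theorem Gate.exists_mul_pauli (g : Gate n) (x : PauliVec n) :
    ∃ c : ℂ, g.matrix * pauli x = c • (pauli (g.act x) * g.matrix) := by
  obtain ⟨c, hc⟩ := g.exists_mul_xz x
  rw [pauli_eq_smul_xz x, Matrix.mul_smul, hc, xz_eq_smul_pauli, Matrix.smul_mul, smul_smul,
    smul_smul]
  exact ⟨_, rfl⟩

/-- Written this way, the gate is visibly unitary: its two summands are anticommuting involutions,
so the cross terms of the square cancel. -/
theorem Gate.matrix_H (i : Fin n) : (Gate.H i).matrix = ((1 / Real.sqrt 2 : ℝ) : ℂ) •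
    (pauli (Pi.single i 1, 0) + pauli (0, Pi.single i 1)) := by
  ext u t
  have h0 : ∀ b : Bits n, numY ((b, 0) : PauliVec n) = 0 := by intro b; simp [numY]
  have h0' : ∀ b : Bits n, numY ((0, b) : PauliVec n) = 0 := by intro b; simp [numY]
  simp only [matrix, Matrix.smul_apply, Matrix.add_apply, pauli, h0, h0', pow_zero, one_mul,
    zero_dotProduct, single_dotProduct, smul_eq_mul, add_zero]
  have hs : sgn 0 = 1 := by simp [sgn]
  by_cases h : ∀ j, j ≠ i → u j = t j
  · have hu : u = t + Pi.single i (u i + t i) := by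
      funext j
      by_cases hj : j = i
      · subst hj
        rw [Pi.add_apply, Pi.single_eq_same, add_left_comm, CharTwo.add_self_eq_zero, add_zero]
      · simp [hj, h j hj]
    rw [if_pos h]
    -- The labels differ at most at `i`: if they agree only the `Z` term contributes, and if they
    -- differ only the `X` term does.
    rcases zmod_two_eq (u i + t i) with e | e
    · have hut : u = t := by rw [hu, e, Pi.single_zero, add_zero]
      have : ¬ t = t + Pi.single i 1 := fun e => by
        have := congrFun e i
        simp at this
      subst hut
      rw [if_neg this, if_pos rfl, zero_add]
      congr 2
      rcases zmod_two_eq (u i) with e | e <;> simp [e]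
    · rw [e] at hu
      have hne : ¬ u = t := fun e' => by
        rw [e', CharTwo.add_self_eq_zero] at e
        exact zero_ne_one e
      rw [if_pos hu, if_neg hne, add_zero, hs]
      have : u i * t i = 0 := by
        rcases zmod_two_eq (u i) with h1 | h1 <;> rcases zmod_two_eq (t i) with h2 | h2 <;>
          simp_all
      rw [this, hs]
  · have h1 : ¬ u = t + Pi.single i 1 := by
      rintro rfl
      exact h fun j hj => by simp [hj]
    have h2 : ¬ u = t := by
      rintro rfl
      exact h fun j hj => rfl
    rw [if_neg h, if_neg h1, if_neg h2]
    simp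

theorem Gate.isometry (g : Gate n) : g.matrixᴴ * g.matrix = 1 := by
  cases g with
  | X i =>
    have : (X i).matrix = pauli (Pi.single i 1, 0) := by
      ext u t
      simp [matrix, pauli, numY, sgn]
    rw [this, pauli_unitary]
  | S i =>
    rw [matrix, diagonal_conjTranspose, diagonal_mul_diagonal, ← diagonal_one]
    congr 1
    funext t
    rw [Pi.star_apply, mul_comm, I_pow_mul_star]
  | CNOT i j hij =>
    have hm : ∀ u t, (CNOT i j hij).matrix u t = if u = t + Pi.single j (t i) then 1 else 0 :=
      fun _ _ => rfl
    ext u t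
    rw [mul_apply, Finset.sum_eq_single (u + Pi.single j (u i))]
    · rw [conjTranspose_apply, hm, hm, if_pos rfl, star_one, one_mul, one_apply]
      refine if_congr ⟨fun h => ?_, fun h => by rw [h]⟩ rfl rfl
      have hi : u i = t i := by
        have := congrFun h i
        simpa [Pi.single_eq_of_ne hij] using this
      rw [hi] at h
      exact add_right_cancel h
    · intro b _ hb
      rw [conjTranspose_apply, hm, if_neg hb, star_zero, zero_mul]
    · simp
  | H i =>
    have hanti : pauli ((Pi.single i 1, 0) : PauliVec n) * pauli (0, Pi.single i 1) =
        -(pauli (0, Pi.single i 1) * pauli (Pi.single i 1, 0)) := by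
      rw [pauli_mul_comm]
      simp [symp, sgn]
    rw [matrix_H, conjTranspose_smul, conjTranspose_add, pauli_conjTranspose, pauli_conjTranspose,
      smul_mul_smul_comm, add_mul, mul_add, mul_add, pauli_mul_self, pauli_mul_self, hanti]
    have h2 : star ((1 / Real.sqrt 2 : ℝ) : ℂ) * ((1 / Real.sqrt 2 : ℝ) : ℂ) * 2 = 1 := by
      rw [show star ((1 / Real.sqrt 2 : ℝ) : ℂ) = ((1 / Real.sqrt 2 : ℝ) : ℂ) from
        Complex.conj_ofReal _]
      have h := sqrt_two_pow_sq 1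
      simpa using h
    rw [show ∀ a : Matrix (Bits n) (Bits n) ℂ, 1 + -a + (a + 1) = (2 : ℂ) • 1 from fun a => by
      rw [two_smul]; abel, smul_smul, h2, one_smul]

end CliffordCircuits

/-! ### Symplectic elimination and decoder circuits of polynomial size. -/

noncomputable section DecoderCircuits

open Matrix

variable {n : ℕ}

/-- The action of a circuit on Pauli operators, up to phase. -/
def circuitAct : List (Gate n) → PauliVec n → PauliVec n
  | [], x => x
  | g :: c, x => circuitAct c (g.act x)

theorem circuitAct_append (c c' : List (Gate n)) (x : PauliVec n) :
    circuitAct (c ++ c') x = circuitAct c' (circuitAct c x) := by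
  induction c generalizing x with
  | nil => rfl
  | cons g c ih => exact ih _

theorem circuitMatrix_append (c c' : List (Gate n)) :
    circuitMatrix (c ++ c') = circuitMatrix c' * circuitMatrix c := by
  induction c with
  | nil => exact (Matrix.mul_one _).symm
  | cons g c ih => rw [List.cons_append, circuitMatrix, circuitMatrix, ih, Matrix.mul_assoc]

theorem circuitAct_add (c : List (Gate n)) (x y : PauliVec n) :
    circuitAct c (x + y) = circuitAct c x + circuitAct c y := by
  induction c generalizing x y with
  | nil => rfl
  | cons g c ih => rw [circuitAct, circuitAct, circuitAct, g.act_add, ih]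

theorem symp_circuitAct (c : List (Gate n)) (x y : PauliVec n) :
    symp (circuitAct c x) (circuitAct c y) = symp x y := by
  induction c generalizing x y with
  | nil => rfl
  | cons g c ih => rw [circuitAct, circuitAct, ih, g.symp_act]

theorem circuitAct_injective (c : List (Gate n)) : Function.Injective (circuitAct c) := by
  induction c with
  | nil => exact Function.injective_id
  | cons g c ih => exact ih.comp (Function.LeftInverse.injective g.act_act)

/-- The action of a circuit as a linear map. -/
def circuitLinear (c : List (Gate n)) : PauliVec n →ₗ[ZMod 2] PauliVec n :=
  AddMonoidHom.toZModLinearMap 2 (AddMonoidHom.mk' (circuitAct c) (circuitAct_add c))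

theorem circuitLinear_apply (c : List (Gate n)) (x : PauliVec n) :
    circuitLinear c x = circuitAct c x := rfl

theorem circuitMatrix_isometry (c : List (Gate n)) :
    (circuitMatrix c)ᴴ * circuitMatrix c = 1 := by
  induction c with
  | nil => simp [circuitMatrix]
  | cons g c ih =>
    rw [circuitMatrix, conjTranspose_mul, Matrix.mul_assoc, ← Matrix.mul_assoc _ _ g.matrix, ih,
      Matrix.one_mul, g.isometry]

/-- A circuit carries a Pauli operator to a multiple of another; since both square to one, the
factor squares to one and is a sign. -/
theorem exists_circuitMatrix_mul_pauli (c : List (Gate n)) (x : PauliVec n) :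
    ∃ t : ZMod 2, circuitMatrix c * pauli x =
      sgn t • (pauli (circuitAct c x) * circuitMatrix c) := by
  obtain ⟨a, ha⟩ : ∃ a : ℂ, circuitMatrix c * pauli x =
      a • (pauli (circuitAct c x) * circuitMatrix c) := by
    induction c generalizing x with
    | nil => exact ⟨1, by simp [circuitMatrix, circuitAct]⟩
    | cons g c ih =>
      obtain ⟨b, hb⟩ := g.exists_mul_pauli x
      obtain ⟨a, ha⟩ := ih (g.act x)
      refine ⟨b * a, ?_⟩
      rw [circuitMatrix, Matrix.mul_assoc, hb, Matrix.mul_smul, ← Matrix.mul_assoc, ha,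
        Matrix.smul_mul, smul_smul, circuitAct, Matrix.mul_assoc]
  have h1 : circuitMatrix c = (a * a) • circuitMatrix c := by
    conv_lhs => rw [← Matrix.mul_one (circuitMatrix c), ← pauli_mul_self x, ← Matrix.mul_assoc,
      ha, Matrix.smul_mul, Matrix.mul_assoc, ha, Matrix.mul_smul, ← Matrix.mul_assoc,
      pauli_mul_self, Matrix.one_mul, smul_smul]
  -- Any diagonal entry of the identity would do to read off `a * a = 1`.
  have h2 := congrArg (fun M => ((circuitMatrix c)ᴴ * M) 0 0) h1
  simp only [Matrix.mul_smul, circuitMatrix_isometry, Matrix.smul_apply, one_apply_eq,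
    smul_eq_mul, mul_one] at h2
  rcases mul_self_eq_one_iff.1 h2.symm with rfl | rfl
  · exact ⟨0, by simpa [sgn] using ha⟩
  · exact ⟨1, by simpa [sgn] using ha⟩

/-! ### Reduction of a Pauli operator to a single `Z` -/

/-- On each qubit of the support, an `X` becomes `Z` by a Hadamard gate, and a `Y` first becomes `X`
by a phase gate. Products of `Z`s elsewhere are unaffected since no other qubit is touched. -/
theorem exists_circuit_fst_eq_zero (x : PauliVec n) : ∃ c : List (Gate n),
    c.length ≤ 2 * (Finset.univ.filter fun i => x.1 i ≠ 0).card ∧ (circuitAct c x).1 = 0 ∧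
      ∀ y : Bits n, (∀ i, x.1 i ≠ 0 → y i = 0) → circuitAct c (0, y) = (0, y) := by
  generalize hN : (Finset.univ.filter fun i => x.1 i ≠ 0).card = N
  induction N generalizing x with
  | zero =>
    refine ⟨[], by simp, funext fun i => ?_, fun y _ => rfl⟩
    by_contra h
    have h1 : x.1 i ≠ 0 := h
    have : i ∈ Finset.univ.filter fun i => x.1 i ≠ 0 := by simpa using h1
    rw [Finset.card_eq_zero.1 hN] at this
    simp at this
  | succ N ih =>
    obtain ⟨i, hi⟩ : ∃ i, i ∈ Finset.univ.filter fun i => x.1 i ≠ 0 :=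
      Finset.card_pos.1 (by omega)
    have hi0 : x.1 i ≠ 0 := by simpa using hi
    have hi1 : x.1 i = 1 := (zmod_two_eq _).resolve_left hi0
    obtain ⟨c₀, hc₀, hx, hy⟩ : ∃ c₀ : List (Gate n), c₀.length ≤ 2 ∧
        (circuitAct c₀ x).1 = x.1 + Pi.single i 1 ∧
        ∀ y : Bits n, y i = 0 → circuitAct c₀ (0, y) = (0, y) := by
      rcases zmod_two_eq (x.2 i) with h | h
      · exact ⟨[.H i], by simp, by simp [circuitAct, Gate.act, hi1, h],
          fun y hy => by simp [circuitAct, Gate.act, hy]⟩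
      · exact ⟨[.S i, .H i], by simp, by
          simp [circuitAct, Gate.act, hi1, h, show (1 : ZMod 2) + 1 = 0 from rfl],
          fun y hy => by simp [circuitAct, Gate.act, hy]⟩
    have hsupp : (Finset.univ.filter fun j => (circuitAct c₀ x).1 j ≠ 0) =
        (Finset.univ.filter fun j => x.1 j ≠ 0).erase i := by
      ext j
      by_cases hj : j = i
      · subst hj
        simp [hx, hi1, show (1 : ZMod 2) + 1 = 0 from rfl]
      · simp [hx, hj]
    obtain ⟨c, hc, hcx, hcy⟩ := ih (circuitAct c₀ x) (by
      rw [hsupp, Finset.card_erase_of_mem hi, hN, Nat.add_sub_cancel])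
    refine ⟨c₀ ++ c, by rw [List.length_append]; omega, by rw [circuitAct_append, hcx], ?_⟩
    intro y hxy
    rw [circuitAct_append, hy y (hxy i hi0)]
    refine hcy y fun j hj => hxy j ?_
    have : j ∈ Finset.univ.filter fun j => (circuitAct c₀ x).1 j ≠ 0 := by simpa using hj
    rw [hsupp] at this
    simpa using (Finset.mem_erase.1 this).2

/-- A controlled `NOT` with target `k` copies a `Z` on `k` to its control, so it erases an unwanted
`Z` there. Products of `Z`s that avoid `k` are fixed. -/
theorem exists_circuit_snd_eq_single (k : Fin n) (b : Bits n) (hb : b k = 1) :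
    ∃ c : List (Gate n), c.length ≤ (Finset.univ.filter fun i => i ≠ k ∧ b i ≠ 0).card ∧
      circuitAct c (0, b) = (0, Pi.single k 1) ∧
      ∀ y : Bits n, y k = 0 → circuitAct c (0, y) = (0, y) := by
  generalize hN : (Finset.univ.filter fun i => i ≠ k ∧ b i ≠ 0).card = N
  induction N generalizing b with
  | zero =>
    refine ⟨[], le_refl _, Prod.ext rfl (funext fun i => ?_), fun y _ => rfl⟩
    by_cases hi : i = k
    · subst hi
      simpa [circuitAct] using hb
    · have h0 : b i = 0 := by
        by_contra h
        have : i ∈ Finset.univ.filter fun i => i ≠ k ∧ b i ≠ 0 := by simp [hi, h]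
        rw [Finset.card_eq_zero.1 hN] at this
        simp at this
      simp [circuitAct, hi, h0]
  | succ N ih =>
    obtain ⟨i, hi⟩ : ∃ i, i ∈ Finset.univ.filter fun i => i ≠ k ∧ b i ≠ 0 :=
      Finset.card_pos.1 (by omega)
    obtain ⟨hik, hi0⟩ : i ≠ k ∧ b i ≠ 0 := by simpa using hi
    have hi1 : b i = 1 := (zmod_two_eq _).resolve_left hi0
    have hsupp : (Finset.univ.filter fun j => j ≠ k ∧ (b + Pi.single i 1 : Bits n) j ≠ 0) =
        (Finset.univ.filter fun j => j ≠ k ∧ b j ≠ 0).erase i := by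
      ext j
      by_cases hj : j = i
      · subst hj
        simp [hi1, show (1 : ZMod 2) + 1 = 0 from rfl]
      · simp [hj]
    obtain ⟨c, hc, hcx, hcy⟩ := ih (b + Pi.single i 1) (by simp [hb, hik.symm]) (by
      rw [hsupp, Finset.card_erase_of_mem hi, hN, Nat.add_sub_cancel])
    refine ⟨.CNOT i k hik :: c, by rw [List.length_cons]; omega, ?_, fun y hy => ?_⟩
    · rw [circuitAct, ← hcx]
      simp [Gate.act, hb]
    · rw [circuitAct]
      simpa [Gate.act, hy] using hcy y hy

/-- A Pauli operator that commutes with the `Z`s on the qubits in `p`, and that is not a product of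
these, can be carried to the `Z` on another given qubit. -/
theorem exists_circuit_eq_single (p : Fin n → Prop) {k : Fin n} (hk : ¬ p k) (x : PauliVec n)
    (hx : ∀ j, p j → x.1 j = 0) (hx' : ∀ b : Bits n, (∀ i, ¬ p i → b i = 0) → x ≠ (0, b)) :
    ∃ c : List (Gate n), c.length ≤ 3 * n + 1 ∧ circuitAct c x = (0, Pi.single k 1) ∧
      ∀ y : Bits n, (∀ i, ¬ p i → y i = 0) → circuitAct c (0, y) = (0, y) := by
  obtain ⟨c₁, hc₁, h1, h1y⟩ := exists_circuit_fst_eq_zero x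
  have hy : ∀ y : Bits n, (∀ i, ¬ p i → y i = 0) → circuitAct c₁ (0, y) = (0, y) :=
    fun y hy => h1y y fun i hi => hy i fun hp => hi (hx i hp)
  obtain ⟨b, hb⟩ : ∃ b, circuitAct c₁ x = (0, b) := ⟨_, Prod.ext h1 rfl⟩
  -- Otherwise the image of `x` would be a product of protected `Z`s, which the circuit fixes, and
  -- by injectivity `x` would be that product.
  obtain ⟨i, hpi, hbi⟩ : ∃ i, ¬ p i ∧ b i = 1 := by
    by_contra! h
    have hb0 : ∀ i, ¬ p i → b i = 0 := fun i hi => (zmod_two_eq _).resolve_right (h i hi)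
    exact hx' b hb0 (circuitAct_injective c₁ (hb.trans (hy b hb0).symm))
  obtain ⟨c₂, b', hc₂, hb', hbk, h2y⟩ : ∃ (c₂ : List (Gate n)) (b' : Bits n), c₂.length ≤ 1 ∧
      circuitAct c₂ (0, b) = (0, b') ∧ b' k = 1 ∧
      ∀ y : Bits n, (∀ i, ¬ p i → y i = 0) → circuitAct c₂ (0, y) = (0, y) := by
    -- If there is no `Z` on `k` yet, one controlled `NOT` with control `k` and target `i` creates
    -- it.
    rcases zmod_two_eq (b k) with h | h
    · have hki : k ≠ i := fun e => by
        rw [e, hbi] at h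
        exact one_ne_zero h
      exact ⟨[.CNOT k i hki], b + Pi.single k 1, by simp, by simp [circuitAct, Gate.act, hbi],
        by simp [h], fun y hy => by simp [circuitAct, Gate.act, hy i hpi]⟩
    · exact ⟨[], b, by simp, rfl, h, fun y _ => rfl⟩
  obtain ⟨c₃, hc₃, h3, h3y⟩ := exists_circuit_snd_eq_single k b' hbk
  refine ⟨c₁ ++ (c₂ ++ c₃), ?_, ?_, fun y hy' => ?_⟩
  -- The three circuits have at most `2n`, `1` and `n` gates.
  · have e1 := Finset.card_le_univ (Finset.univ.filter fun i => x.1 i ≠ 0)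
    have e2 := Finset.card_le_univ (Finset.univ.filter fun i => i ≠ k ∧ b' i ≠ 0)
    rw [Fintype.card_fin] at e1 e2
    rw [List.length_append, List.length_append]
    omega
  · rw [circuitAct_append, circuitAct_append, hb, hb', h3]
  · rw [circuitAct_append, circuitAct_append, hy y hy', h2y y hy', h3y y (hy' k hk)]

section

variable {s m : ℕ} (Q : StabilizerCode (s + m) s)

/-- Elimination, one generator at a time. Commutation with the earlier generators, preserved by
circuits, excludes `X` on the first `t` qubits; independence excludes that the next generator has
become a product of the `Z`s already there. -/
theorem exists_circuit_gen (t : ℕ) (ht : t ≤ s) : ∃ c : List (Gate (s + m)),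
    c.length ≤ t * (3 * (s + m) + 1) ∧ ∀ j : Fin s, (j : ℕ) < t →
      circuitAct c (Q.gen j) = (0, Pi.single (Fin.castAdd m j) 1) := by
  induction t with
  | zero => exact ⟨[], by simp, fun j hj => absurd hj (Nat.not_lt_zero _)⟩
  | succ t ih =>
    obtain ⟨c, hc, hcj⟩ := ih (by omega)
    let k : Fin s := ⟨t, by omega⟩
    obtain ⟨c', hc', hk, hy⟩ := exists_circuit_eq_single (fun i : Fin (s + m) => (i : ℕ) < t)
      (k := Fin.castAdd m k) (by simp [k]) (circuitAct c (Q.gen k)) (by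
        intro j hj
        have h := symp_circuitAct c (Q.gen k) (Q.gen ⟨j, by omega⟩)
        rw [hcj ⟨j, by omega⟩ hj, Q.isotropic] at h
        have e : Fin.castAdd m (⟨j, by omega⟩ : Fin s) = j := rfl
        simpa [symp, e] using h) (by
        intro b hb hgb
        have hspan := Q.independent.notMem_span_image (s := {j : Fin s | (j : ℕ) < t}) (x := k)
          (by simp [k])
        refine hspan ?_
        have hg : Q.gen k = ∑ j ∈ Finset.univ.filter (fun j : Fin s => (j : ℕ) < t),
            b (Fin.castAdd m j) • Q.gen j := by
          apply circuitAct_injective c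
          rw [hgb, ← circuitLinear_apply, map_sum]
          have h1 : ∀ j ∈ Finset.univ.filter (fun j : Fin s => (j : ℕ) < t),
              circuitLinear c (b (Fin.castAdd m j) • Q.gen j) =
                (0, Pi.single (Fin.castAdd m j) (b (Fin.castAdd m j))) := by
            intro j hj
            rw [map_smul, circuitLinear_apply, hcj j (by simpa using hj), Prod.smul_mk, smul_zero,
              ← Pi.single_smul, smul_eq_mul, mul_one]
          rw [Finset.sum_congr rfl h1]
          refine Prod.ext ?_ (funext fun i => ?_)
          · simp [Prod.fst_sum]
          · rw [Prod.snd_sum, Finset.sum_apply]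
            by_cases hi : (i : ℕ) < t
            · rw [Finset.sum_eq_single (⟨i, by omega⟩ : Fin s)]
              · exact (Pi.single_eq_same (M := fun _ => ZMod 2) i (b i)).symm
              · intro j _ hj
                refine Pi.single_eq_of_ne (fun e => hj ?_) _
                ext
                simp [e]
              · intro h
                exact absurd (by simpa using hi) h
            · rw [Finset.sum_eq_zero]
              · exact hb i hi
              · intro j hj
                refine Pi.single_eq_of_ne (fun e => hi ?_) _
                rw [e]
                simpa using hj
        rw [hg]
        exact Submodule.sum_mem _ fun j hj => Submodule.smul_mem _ _
          (Submodule.subset_span ⟨j, by simpa using hj, rfl⟩))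
    refine ⟨c ++ c', ?_, fun j hj => ?_⟩
    · rw [List.length_append, Nat.succ_mul]
      omega
    · rw [circuitAct_append]
      rcases Nat.lt_succ_iff_lt_or_eq.1 hj with h | h
      · rw [hcj j h, hy]
        intro i hi
        refine Pi.single_eq_of_ne (fun e => hi ?_) _
        rw [e]
        exact h
      · have : j = k := Fin.ext h
        rw [this, hk]

/-- The action on labels ignores signs. A wrong sign on the `k`-th generator is repaired by an `X`
gate on qubit `k`, which anticommutes with `Z` on that qubit and commutes with the others, so no
other sign changes. -/
theorem exists_circuit_intertwines (t : ℕ) (ht : t ≤ s) : ∃ c : List (Gate (s + m)),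
    c.length ≤ s * (3 * (s + m) + 1) + t ∧ ∀ j : Fin s, ∃ u : ZMod 2,
      circuitMatrix c * pauli (Q.gen j) =
        sgn u • (pauli (0, Pi.single (Fin.castAdd m j) 1) * circuitMatrix c) ∧
      ((j : ℕ) < t → u = 0) := by
  induction t with
  | zero =>
    obtain ⟨c, hc, hcj⟩ := exists_circuit_gen Q s le_rfl
    refine ⟨c, hc, fun j => ?_⟩
    obtain ⟨u, hu⟩ := exists_circuitMatrix_mul_pauli c (Q.gen j)
    rw [hcj j j.2] at hu
    exact ⟨u, hu, fun h => absurd h (Nat.not_lt_zero _)⟩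
  | succ t ih =>
    obtain ⟨c, hc, hcj⟩ := ih (by omega)
    choose u hu hu0 using hcj
    let k : Fin s := ⟨t, by omega⟩
    rcases zmod_two_eq (u k) with h | h
    · refine ⟨c, by omega, fun j => ⟨u j, hu j, fun hj => ?_⟩⟩
      rcases Nat.lt_succ_iff_lt_or_eq.1 hj with h' | h'
      · exact hu0 j h'
      · have : j = k := Fin.ext h'
        rw [this, h]
    · refine ⟨c ++ [.X (Fin.castAdd m k)], by simp; omega, fun j =>
        ⟨u j + (Pi.single k 1 : Bits s) j, ?_, fun hj => ?_⟩⟩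
      · have hX : (Gate.X (Fin.castAdd m k)).matrix = pauli (Pi.single (Fin.castAdd m k) 1, 0) := by
          ext v w
          simp [Gate.matrix, pauli, numY, sgn]
        have hs : symp ((Pi.single (Fin.castAdd m k) 1, 0) : PauliVec (s + m))
            (0, Pi.single (Fin.castAdd m j) 1) = (Pi.single k 1 : Bits s) j := by
          simp only [symp, zero_dotProduct, zero_sub, single_dotProduct, one_mul,
            CharTwo.neg_eq]
          by_cases hjk : j = k
          · subst hjk
            simp
          · have : Fin.castAdd m k ≠ Fin.castAdd m j := fun e => hjk (by simpa using e.symm)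
            rw [Pi.single_eq_of_ne this, Pi.single_eq_of_ne hjk]
        rw [circuitMatrix_append, circuitMatrix, circuitMatrix, Matrix.one_mul, Matrix.mul_assoc,
          hu j, Matrix.mul_smul, ← Matrix.mul_assoc, hX, pauli_mul_comm, hs, Matrix.smul_mul,
          smul_smul, ← sgn_add, Matrix.mul_assoc]
      · rcases Nat.lt_succ_iff_lt_or_eq.1 hj with h' | h'
        · have : j ≠ k := fun e => by
            rw [e] at h'
            exact lt_irrefl _ h'
          rw [hu0 j h', Pi.single_eq_of_ne this, add_zero]
        · have : j = k := Fin.ext h'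
          rw [this, h, Pi.single_eq_same]
          rfl

theorem exists_decoder_circuit : ∃ (D : Decoder Q m) (c : List (Gate (s + m))),
    D.IsComputedBy rfl c ∧ c.length ≤ 3 * (s + m + 1) ^ 3 := by
  obtain ⟨c, hc, hcj⟩ := exists_circuit_intertwines Q s le_rfl
  let e : Bits s × Bits m ≃ Bits (s + m) := Fin.appendEquiv s m
  have hco : circuitMatrix c * (circuitMatrix c)ᴴ = 1 :=
    mul_eq_one_comm.1 (circuitMatrix_isometry c)
  refine ⟨{
    U := (circuitMatrix c).submatrix e id
    isometry := ?_
    coisometry := ?_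
    intertwines := fun j => ?_ }, c, fun z t x => rfl, ?_⟩
  · rw [conjTranspose_submatrix, submatrix_mul_equiv, circuitMatrix_isometry]
    rfl
  · have := submatrix_mul_equiv (circuitMatrix c) (circuitMatrix c)ᴴ e (Equiv.refl _) e
    rw [conjTranspose_submatrix]
    exact this.trans (by rw [hco, submatrix_one_equiv])
  · obtain ⟨u, hu, hu0⟩ := hcj j
    rw [hu0 j.2, show sgn 0 = 1 by simp [sgn], one_smul] at hu
    ext z x
    have h1 := congrFun (congrFun hu (e z)) x
    have h2 : pauli ((0, Pi.single (Fin.castAdd m j) 1) : PauliVec (s + m)) =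
        diagonal fun v => sgn (v (Fin.castAdd m j)) := by
      ext v w
      by_cases hvw : v = w
      · subst hvw
        simp [pauli, numY]
      · simp [pauli, hvw]
    rw [h2, diagonal_mul] at h1
    rw [diagonal_mul]
    refine Eq.trans ?_ (h1.trans ?_)
    · rfl
    · congr 2
      exact Fin.append_left z.1 z.2 j
  -- A quadratic bound already holds; it is relaxed to a cubic one so that the same constant can
  -- serve as factor and exponent.
  · have h1 : s * (3 * (s + m) + 1) + s ≤ 3 * (s + m + 1) ^ 2 := by nlinarith
    have h2 : 3 * (s + m + 1) ^ 2 ≤ 3 * (s + m + 1) ^ 3 :=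
      Nat.mul_le_mul_left _ (Nat.pow_le_pow_right (by omega) (by omega))
    omega

end

end DecoderCircuits

/-! ### The main theorem. -/

theorem mainTheorem6 :
    -- decoders exist and are carried out by circuits of polynomial size
    (∃ c : ℕ, ∀ (n m s : ℕ) (h : s + m = n) (Q : StabilizerCode n s),
      ∃ (D : Decoder Q m) (circ : List (Gate n)),
        D.IsComputedBy h circ ∧ circ.length ≤ c * (n + 1) ^ c) ∧
    -- the protocol with an arbitrary purity testing code
    (∀ (n m s : ℕ) (K : Type) [Fintype K] [Nonempty K] (Q : K → StabilizerCode n s)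
      (D : ∀ k, Decoder (Q k) m) (ε : ℝ),
      IsPurityTestingCode Q ε → IsSecure (purityProtocol Q D) ε) ∧
    -- the protocol with the codes from normal rational curves
    (∀ r s : ℕ, 0 < r → 0 < s → Nonempty (CurveData r s)) ∧
    (∀ (r s : ℕ) (hr : 0 < r) (d : CurveData r s)
      (D : ∀ k, Decoder (d.code hr k) ((r - 1) * s)),
      IsSecure (purityProtocol (d.code hr) D) (2 * r / (2 ^ s + 1)) ∧
      IsSecure (purityProtocol (d.code hr) D) (2 * r * (2 : ℝ) ^ (-((r * s : ℕ) / r : ℝ)))) := by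
  refine ⟨⟨3, ?_⟩, ?_, ?_, ?_⟩
  · intro n m s h Q
    subst h
    exact exists_decoder_circuit Q
  · intro n m s K _ _ Q D ε hε
    exact isSecure_purityProtocol D hε
  · exact fun r s hr hs => nonempty_curveData hr hs
  · intro r s hr d D
    have h := isSecure_purityProtocol D (d.isPurityTestingCode hr)
    exact ⟨h, h.mono (curve_error_le s hr)⟩
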